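/- Let $p>0$, $\alpha=2/(1+p)$, $a_0>0$, and let $G_\alpha$ be the symmetric stable distribution function with characteristic function $\hat g_\alpha(\xi)=e^{-a_0|\xi|^\alpha}$ and density $g_\alpha$, $\|g_\alpha\|=\sup_x|g_\alpha(x)|$. Put $c(\theta)=\cos\theta\,|\cos\theta|^p$, $s(\theta)=\sin\theta\,|\sin\theta|^p$. Let $F_0$ be a probability distribution function with characteristic function $\phi_0$, belonging to the domain of normal attraction of $G_\alpha$ (for i.i.d. $X_i$ with distribution function $F_0$ and suitable constants $m_n$, $n^{-1/\alpha}\sum_{i\le n}X_i-m_n$ converges in law to $G_\alpha$). Let $F(\cdot,t)$, $t\ge 0$, be the probability distribution functions whose characteristic functions $\phi(\cdot,t)$ solve $$\frac{\partial}{\partial t}\phi(\xi,t)=\frac1{2\pi}\int_0^{2\pi}\phi(\xi s(\theta),t)\,\phi(\xi c(\theta),t)\,d\theta-\phi(\xi,t)\quad(t>0),\qquad \phi(\xi,0)=\phi_0(\xi),$$ with $\phi(\xi,\cdot)$ continuous at $t=0$. Let $K(F,G)=\sup_x|F(x)-G(x)|$. Define $v_0^*$ by $1-\mathrm{Re}\,\phi_0(\xi)=(a_0+v_0^*(\xi))|\xi|^\alpha$,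 $v_0^*(0)=0$, and assume that $|v_0^*(\xi)|=O(|\xi|^\delta)$ as $\xi\to0$ for some $\delta>0$. Set $\|v_0^*\|=\sup_{\xi\ge0}|v_0^*(\xi)|$, $M=a_0+\|v_0^*\|$, $\bar v_0^*(\xi)=\sup_{0\le x\le\xi}|v_0^*(x)|$, and, for $d\in(0,1)$, $\tilde d=(3d/(8M))^{1/\alpha}$. For $\eta\in(0,a_0)$ call $(d,\rho)$ with $d\in(0,1)$, $\rho>0$ admissible if $|x|\le\tilde d$ entails both $\frac45M^2|x|^\alpha+\bar v_0^*(|x|)\le\eta$ and $|v_0^*(x)|\le\rho|x|^\delta$. Put $N_l=\int_0^\infty e^{-(a_0-\eta)\xi^\alpha}\xi^{l-1}d\xi$ and $A_m=\frac1{2\pi}\int_0^{2\pi}|\sin\theta|^m d\theta$. Let $\nu_t$ have law $P_t\{\nu_t=n\}=e^{-t}(1-e^{-t})^{n-1}$, $n\ge1$. Given $\nu_t=n$, let $\gamma_t$ be a random binary tree with $n$ leaves in which, if $n\geq 2$, the number of leaves of the left subtree is uniform on $\{1,\dots,n-1\}$ and, given it, the two subtrees are independent and built recursively by the same rule. Attach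 to the internal nodes angles that are independent of the tree, i.i.d. and uniform on $[0,2\pi)$. For each leaf $j$ let $\beta_{j,t}$ be the product, along the path from the root to $j$, of $c(\theta)$ for each step to a left child and $s(\theta)$ for each step to a right child, $\theta$ being the angle of the node the step leaves ($\beta_{1,t}=1$ if $n=1$). Let $\beta_{(\nu_t)}=\max_j|\beta_{j,t}|$ and let $E_t$ denote expectation. Finally, say that ${\bf c}>0$ is a Berry–Esseen constant if, for all probability distribution functions $F,G$ with characteristic functions $\phi_F,\phi_G$, $G$ differentiable with $|G'|\le m$, and all $T>0$, $\sup_x|F(x)-G(x)|\le\frac1\pi\int_{-T}^T\left|\frac{\phi_F(\xi)-\phi_G(\xi)}{\xi}\right|d\xi+\frac{{\bf c}\,m}{T}$. Then Berry–Esseen constants exist; for every $\eta\in(0,a_0)$ there are admissible $(d,\rho)$; and for every Berry–Esseen constant ${\bf c}$, every $\eta\in(0,a_0)$, every admissible $(d,\rho)$ and every $t\ge0$, $$\begin{aligned}K(F(\cdot,t),G_\alpha)\le{}&\frac{8}{5\pi}M^2N_{2\alpha}e^{-t(1-2A_4)}+\frac{64}{25\pi}M^4N_{4\alpha}e^{-t(1-2A_6)}+\frac2\pi\rho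 N_{\alpha+\delta}e^{-t(1-2A_{2+2\delta/\alpha})}\\&+2\rho^2N_{2\alpha+2\delta}e^{-t(1-2A_{2+4\delta/\alpha})}+\frac{{\bf c}\|g_\alpha\|}{\tilde d}E_t(\beta_{(\nu_t)})+\frac{e^{-t}}2\sup_{x\in\mathbb R}|F_0(x)+F_0(-x-0)-1|.\end{aligned}$$ Consequently there are positive constants $a_3$ and $b$ such that $K(F(\cdot,t),G_\alpha)\le a_3e^{-bt}$ for every $t\ge0$. -/

import Mathlib

open MeasureTheory ProbabilityTheory Filter Topology Asymptotics

namespace InelasticKac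

noncomputable section

/-! ### Collision coefficients and the kinetic equation in Fourier variables -/

/-- `c(θ) = cos θ |cos θ| ^ p`. -/
def cCoef (p θ : ℝ) : ℝ := Real.cos θ * |Real.cos θ| ^ p

/-- `s(θ) = sin θ |sin θ| ^ p`. -/
def sCoef (p θ : ℝ) : ℝ := Real.sin θ * |Real.sin θ| ^ p

/-- The family `μ t`, `t ≥ 0`, of probability laws on the line solves the inelastic Kac equation
with initial datum `μ₀`: its characteristic functions `φ(ξ, t)` satisfy
`∂ₜ φ(ξ, t) = (1 / 2π) ∫₀^{2π} φ(ξ s(θ), t) φ(ξ c(θ), t) dθ - φ(ξ, t)` for `t > 0`, and are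
continuous in `t` at `t = 0`. The members of the family with `t < 0` play no role. -/
structure IsKacSolution (p : ℝ) (μ₀ : Measure ℝ) (μ : ℝ → Measure ℝ) : Prop where
  isProb : ∀ t, 0 ≤ t → IsProbabilityMeasure (μ t)
  initial : μ 0 = μ₀
  continuous_zero : ∀ ξ : ℝ,
    ContinuousWithinAt (fun t => charFun (μ t) ξ) (Set.Ici 0) 0
  equation : ∀ ξ t : ℝ, 0 < t →
    HasDerivAt (fun τ => charFun (μ τ) ξ)
      ((1 / (2 * (Real.pi : ℂ))) * (∫ θ in (0 : ℝ)..(2 * Real.pi),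
          charFun (μ t) (ξ * sCoef p θ) * charFun (μ t) (ξ * cCoef p θ))
        - charFun (μ t) ξ) t

/-! ### Stable laws and the domain of normal attraction -/

/-- `G` is the symmetric stable law with characteristic function `exp (-a₀ |ξ| ^ α)`. -/
def IsSymmStable (α a₀ : ℝ) (G : Measure ℝ) : Prop :=
  IsProbabilityMeasure G ∧
    ∀ ξ : ℝ, charFun G ξ = ((Real.exp (-a₀ * |ξ| ^ α) : ℝ) : ℂ)

/-- `μ₀` belongs to the domain of normal attraction of `G`: for independent `X₁, X₂, …` with law
`μ₀` and suitable centering constants `m n`, the normed sums `(X₁ + ⋯ + Xₙ) / n ^ (1 / α) - m n`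
converge in distribution to `G`. -/
def InDomainNormalAttraction (α : ℝ) (μ₀ G : Measure ℝ) [IsProbabilityMeasure μ₀]
    [IsProbabilityMeasure G] : Prop :=
  ∃ m : ℕ → ℝ,
    TendstoInDistribution
      (fun (n : ℕ) (x : ℕ → ℝ) => (∑ k ∈ Finset.range n, x k) / (n : ℝ) ^ (1 / α) - m n)
      atTop (id : ℝ → ℝ) (fun _ => Measure.infinitePi (fun _ : ℕ => μ₀)) G

/-! ### Distances and the smoothing inequality -/

/-- Kolmogorov distance between the distribution functions of two probability laws. -/
def kolmogorov (μ ν : Measure ℝ) : ℝ := ⨆ x : ℝ, |cdf μ x - cdf ν x|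

/-- The sup norm of the density of `G` (the derivative of its distribution function). -/
def densitySup (G : Measure ℝ) : ℝ := ⨆ x : ℝ, |deriv (cdf G) x|

/-- `c` is an admissible constant in the Berry-Esseen smoothing inequality
`|F - G| ≤ (1 / π) ∫_{-T}^{T} |(φ_F(ξ) - φ_G(ξ)) / ξ| dξ + c m / T`,
for distribution functions `F`, `G` such that `G` is differentiable with `|G'| ≤ m`
(the inequality being void when the integral diverges). -/
def IsBerryEsseenConst (c : ℝ) : Prop :=
  0 < c ∧ ∀ (μ ν : Measure ℝ), IsProbabilityMeasure μ → IsProbabilityMeasure ν →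
    ∀ m T : ℝ, 0 < T → Differentiable ℝ (cdf ν) → (∀ x, |deriv (cdf ν) x| ≤ m) →
      IntervalIntegrable (fun ξ : ℝ => ‖charFun μ ξ - charFun ν ξ‖ / |ξ|) volume (-T) T →
      ∀ x : ℝ, |cdf μ x - cdf ν x| ≤
        (1 / Real.pi) * (∫ ξ in (-T)..T, ‖charFun μ ξ - charFun ν ξ‖ / |ξ|) + c * m / T

/-! ### Quantities built from the initial datum -/

/-- The function `v₀*` in `1 - Re φ₀(ξ) = (a₀ + v₀*(ξ)) |ξ| ^ α`, with `v₀*(0) = 0`. -/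
def vStar (α a₀ : ℝ) (μ₀ : Measure ℝ) (ξ : ℝ) : ℝ :=
  if ξ = 0 then 0 else (1 - (charFun μ₀ ξ).re) / |ξ| ^ α - a₀

/-- `‖v₀*‖ = sup_{ξ ≥ 0} |v₀*(ξ)|`. -/
def vNorm (α a₀ : ℝ) (μ₀ : Measure ℝ) : ℝ :=
  sSup ((fun ξ => |vStar α a₀ μ₀ ξ|) '' Set.Ici 0)

/-- `M = a₀ + ‖v₀*‖`. -/
def bigM (α a₀ : ℝ) (μ₀ : Measure ℝ) : ℝ := a₀ + vNorm α a₀ μ₀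

/-- `v̄₀*(ξ) = sup_{0 ≤ x ≤ ξ} |v₀*(x)|`. -/
def vBar (α a₀ : ℝ) (μ₀ : Measure ℝ) (ξ : ℝ) : ℝ :=
  sSup ((fun x => |vStar α a₀ μ₀ x|) '' Set.Icc 0 ξ)

/-- `d̃ = (3 d / (8 M)) ^ (1 / α)`. -/
def dTilde (α a₀ : ℝ) (μ₀ : Measure ℝ) (d : ℝ) : ℝ :=
  (3 * d / (8 * bigM α a₀ μ₀)) ^ (1 / α)

/-- The conditions on the auxiliary parameters: `η ∈ (0, a₀)`; `d ∈ (0, 1)` is such that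
`(4 / 5) M² |x| ^ α + v̄₀*(|x|) ≤ η` whenever `|x| ≤ d̃`, and such that
`|v₀*(ξ)| ≤ ρ |ξ| ^ δ` whenever `|ξ| ≤ d̃`. -/
structure IsAdmissible (α a₀ δ : ℝ) (μ₀ : Measure ℝ) (η d ρ : ℝ) : Prop where
  eta_pos : 0 < η
  eta_lt : η < a₀
  d_pos : 0 < d
  d_lt_one : d < 1
  rho_pos : 0 < ρ
  le_eta : ∀ x : ℝ, |x| ≤ dTilde α a₀ μ₀ d →
    4 / 5 * bigM α a₀ μ₀ ^ 2 * |x| ^ α + vBar α a₀ μ₀ |x| ≤ η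
  le_rho : ∀ ξ : ℝ, |ξ| ≤ dTilde α a₀ μ₀ d → |vStar α a₀ μ₀ ξ| ≤ ρ * |ξ| ^ δ

/-- `N_l = ∫₀^∞ exp (-(a₀ - η) ξ ^ α) ξ ^ (l - 1) dξ`. -/
def bigN (α a₀ η l : ℝ) : ℝ :=
  ∫ ξ in Set.Ioi (0 : ℝ), Real.exp (-(a₀ - η) * ξ ^ α) * ξ ^ (l - 1)

/-- `A_m = (1 / 2π) ∫₀^{2π} |sin θ| ^ m dθ`. -/
def bigA (m : ℝ) : ℝ :=
  (1 / (2 * Real.pi)) * ∫ θ in (0 : ℝ)..(2 * Real.pi), |Real.sin θ| ^ m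

/-- `sup_x |F₀(x) + F₀(-x-0) - 1|`. -/
def asymmetry (μ₀ : Measure ℝ) : ℝ :=
  ⨆ x : ℝ, |cdf μ₀ x + Function.leftLim (cdf μ₀) (-x) - 1|

/-! ### McKean's random binary trees -/

/-- Binary trees in which each node has either no child or a left child and a right child. -/
inductive McKeanTree : Type
  | leaf : McKeanTree
  | node : McKeanTree → McKeanTree → McKeanTree

/-- Trees form a countable set, which carries the discrete `σ`-algebra. -/
instance : MeasurableSpace McKeanTree := ⊤

/-- The number of leaves of a tree. -/
def McKeanTree.leaves : McKeanTree → ℕ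
  | .leaf => 1
  | .node l r => l.leaves + r.leaves

/-- The number of internal nodes of a tree. -/
def McKeanTree.nodes : McKeanTree → ℕ
  | .leaf => 0
  | .node l r => 1 + l.nodes + r.nodes

/-- The probability `p_n(g)` of the tree `g` among the trees with `n` leaves: the number of leaves
of the left subtree is uniform on `{1, …, n - 1}` and, given it, the two subtrees are independent
and have the corresponding laws. -/
def McKeanTree.prob : McKeanTree → ℝ
  | .leaf => 1
  | .node l r => l.prob * r.prob / (((l.leaves + r.leaves : ℕ) : ℝ) - 1)

/-- The coefficients `β₁, …, βₙ` attached to the leaves, from left to right: `β_j` is the product,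
along the path from the root to the leaf `j`, of `c(θ_k)` for each step to a left child and of
`s(θ_k)` for each step to a right child, `θ_k` being the angle of the node that the step leaves.
The internal nodes are numbered in preorder: the root, those of the left subtree, those of the
right subtree. -/
def McKeanTree.betas (p : ℝ) : McKeanTree → (ℕ → ℝ) → List ℝ
  | .leaf, _ => [1]
  | .node l r, θ =>
      (l.betas p (fun k => θ (k + 1))).map (fun b => cCoef p (θ 0) * b) ++
      (r.betas p (fun k => θ (k + 1 + l.nodes))).map (fun b => sCoef p (θ 0) * b)

/-- `β_(n) = max {|β₁|, …, |βₙ|}`. -/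
def maxBeta (p : ℝ) (g : McKeanTree) (θ : ℕ → ℝ) : ℝ :=
  ((g.betas p θ).map (fun b => |b|)).foldr max 0

/-- The law of the tree `γ_t`: the number `ν_t` of its leaves equals `n` with probability
`e ^ (-t) (1 - e ^ (-t)) ^ (n - 1)`, and given `ν_t = n` the tree has law `p_n`. -/
def treeLaw (t : ℝ) : Measure McKeanTree :=
  Measure.sum fun g : McKeanTree =>
    ENNReal.ofReal (Real.exp (-t) * (1 - Real.exp (-t)) ^ (g.leaves - 1) * g.prob) •
      Measure.dirac g

/-- The uniform law on `[0, 2π)`. -/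
def angleLaw : Measure ℝ :=
  ENNReal.ofReal (1 / (2 * Real.pi)) • volume.restrict (Set.Ico 0 (2 * Real.pi))

instance : IsProbabilityMeasure angleLaw := by
  constructor
  have h : (0 : ℝ) < 2 * Real.pi := by positivity
  simp only [angleLaw, Measure.smul_apply, Measure.restrict_apply_univ, Real.volume_Ico,
    smul_eq_mul, sub_zero]
  rw [← ENNReal.ofReal_mul (by positivity), one_div, inv_mul_cancel₀ h.ne', ENNReal.ofReal_one]

/-- `E_t(β_(ν_t))`: the tree `γ_t` and the sequence of angles are independent, and the angles are
independent and uniform on `[0, 2π)`. -/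
def meanMaxBeta (p t : ℝ) : ℝ :=
  ∫ ω, maxBeta p ω.1 ω.2 ∂((treeLaw t).prod (Measure.infinitePi fun _ : ℕ => angleLaw))

end

end InelasticKac

open InelasticKac

/-! The solution is the law of a random weighted sum. Multiplied by `e^t`, the equation becomes an
integral recursion whose expansion over binary trees is the Wild series. The truncations by tree
height are Picard iterates, so they converge to any solution (`IsKacSolution.tendsto_wild`). The
coefficient of a tree is the mean over its angles of `∏ φ₀(β_j ξ)`, whence `F(·, t)` is the law of
`∑ β_j X_j` (`IsKacSolution.eq_mckeanLaw`).

The reflections `θ ↦ -θ` and `θ ↦ π - θ` remove the imaginary part of `φ` from the collision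
integral: `Re φ` solves the same equation, while `Im φ(·, t) = e^{-t} Im φ₀`. Passing to the
symmetrized law therefore costs only the asymmetry term, and afterwards `φ₀` may be replaced by `Re
φ₀`.

Now fix the tree and the angles. Since `α (1 + p) = 2`, one has `∑ |β_j| ^ α = 1`, so the leading
terms of `∑ log Re φ₀(β_j ξ)` add up to `-a₀ |ξ| ^ α` exactly. For `|ξ| ≤ d̃ / max |β_j|` every
logarithm can be expanded, and `|e^s - 1| ≤ |s| e^|s|` bounds the difference of characteristic
functions by `e^{-(a₀ - η)|ξ|^α}` times a combination of `∑ |β_j| ^ (2α)` and `∑ |β_j| ^ (α + δ)`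
(`IsAdmissible.abs_prod_sub_exp_le`). The smoothing inequality with `T = d̃ / max |β_j|` turns this
into a bound for distribution functions (`IsAdmissible.abs_cdf_sumLaw_sub_le`).

It remains to take expectations. A node multiplies the mean of `∑ |β_j| ^ m` by `A_{m(1+p)}` in each
subtree, which yields `E ∑ |β_j| ^ m ≤ e^{-t(1 - 2 A_{m(1+p)})}` (`integral_powerSum_le`). This
decays because `A_m < 1/2` for `m > 2`, and so does the mean of `max |β_j|`, by comparison with the
fourth power sum (`meanMaxBeta_le`).

A Berry–Esseen constant, `40 / π`, is obtained by convolution with the Fejér law; Fourier inversion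
makes the distribution function of the stable law differentiable with bounded derivative, as the
smoothing inequality requires. -/

namespace InelasticKac

noncomputable section

/-! ### The Fejér kernel -/

/-- The triangle function `(1 - |ξ| / T)₊`. -/
def triangle (T ξ : ℝ) : ℝ := max 0 (1 - |ξ| / T)

/-- The Fejér density, whose characteristic function is `triangle T`. -/
def fejer (T x : ℝ) : ℝ := T / (2 * Real.pi) * Real.sinc (T * x / 2) ^ 2

lemma continuous_triangle (T : ℝ) : Continuous (triangle T) := by
  unfold triangle; fun_prop

lemma triangle_nonneg (T ξ : ℝ) : 0 ≤ triangle T ξ := le_max_left _ _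

lemma triangle_le_one {T : ℝ} (hT : 0 < T) (ξ : ℝ) : triangle T ξ ≤ 1 := by
  have : 0 ≤ |ξ| / T := by positivity
  exact max_le zero_le_one (by linarith)

lemma triangle_eq_zero {T : ℝ} (hT : 0 < T) {ξ : ℝ} (h : T ≤ |ξ|) : triangle T ξ = 0 := by
  have : 1 ≤ |ξ| / T := (one_le_div hT).2 h
  exact max_eq_left (by linarith)

lemma triangle_neg (T ξ : ℝ) : triangle T (-ξ) = triangle T ξ := by simp [triangle]

lemma hasCompactSupport_triangle {T : ℝ} (hT : 0 < T) : HasCompactSupport (triangle T) := by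
  refine HasCompactSupport.of_support_subset_isCompact (isCompact_Icc (a := -T) (b := T)) ?_
  intro ξ hξ
  by_contra h
  refine hξ (triangle_eq_zero hT ?_)
  by_contra h'
  exact h (abs_le.1 (not_le.1 h').le)

lemma integrable_triangle {T : ℝ} (hT : 0 < T) : Integrable (triangle T) :=
  (continuous_triangle T).integrable_of_hasCompactSupport (hasCompactSupport_triangle hT)

lemma continuous_fejer (T : ℝ) : Continuous (fejer T) := by
  have := Real.continuous_sinc
  unfold fejer; fun_prop

lemma fejer_nonneg {T : ℝ} (hT : 0 < T) (x : ℝ) : 0 ≤ fejer T x := by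
  unfold fejer; positivity

lemma fejer_neg (T x : ℝ) : fejer T (-x) = fejer T x := by
  have : T * -x / 2 = -(T * x / 2) := by ring
  simp only [fejer, this, Real.sinc_neg]

lemma fejer_le_div_sq {T : ℝ} (hT : 0 < T) {x : ℝ} (hx : x ≠ 0) :
    fejer T x ≤ 2 / (Real.pi * T) * (x ^ 2)⁻¹ := by
  have hne : T * x / 2 ≠ 0 := by positivity
  rw [fejer, Real.sinc_of_ne_zero hne, div_pow]
  have h1 : Real.sin (T * x / 2) ^ 2 ≤ 1 := Real.sin_sq_le_one _
  have hx2 : 0 < x ^ 2 := by positivity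
  calc T / (2 * Real.pi) * (Real.sin (T * x / 2) ^ 2 / (T * x / 2) ^ 2)
      ≤ T / (2 * Real.pi) * (1 / (T * x / 2) ^ 2) := by gcongr
    _ = _ := by field_simp

lemma fejer_le {T : ℝ} (hT : 0 < T) (x : ℝ) : fejer T x ≤ T / (2 * Real.pi) := by
  have h1 : Real.sinc (T * x / 2) ^ 2 ≤ 1 := by
    rw [sq_le_one_iff_abs_le_one]; exact Real.abs_sinc_le_one _
  calc fejer T x ≤ T / (2 * Real.pi) * 1 := by unfold fejer; gcongr
    _ = _ := mul_one _

lemma integrable_fejer {T : ℝ} (hT : 0 < T) : Integrable (fejer T) := by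
  refine (integrable_inv_one_add_sq.const_mul (T / (2 * Real.pi) + 2 / (Real.pi * T))).mono'
    (continuous_fejer T).aestronglyMeasurable (Eventually.of_forall fun x => ?_)
  rw [Real.norm_of_nonneg (fejer_nonneg hT x), ← div_eq_mul_inv, le_div_iff₀ (by positivity)]
  have h1 := fejer_le hT x
  have h2 : fejer T x * x ^ 2 ≤ 2 / (Real.pi * T) := by
    rcases eq_or_ne x 0 with rfl | hx
    · simp; positivity
    · rw [← le_div_iff₀ (by positivity), div_eq_mul_inv]; exact fejer_le_div_sq hT hx
  linarith

/-- Evenness reduces the integral to `[0, T]`, where integration by parts gives `(1 - cos (T x)) /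
(T x²)`; the half-angle formula makes a squared sine of it. -/
lemma integral_triangle_mul_cos {T : ℝ} (hT : 0 < T) (x : ℝ) :
    ∫ ξ, triangle T ξ * Real.cos (ξ * x) = 2 * Real.pi * fejer T x := by
  have h1 : (fun ξ => triangle T ξ * Real.cos (ξ * x))
      = fun ξ => (fun y => triangle T y * Real.cos (y * x)) |ξ| := by
    ext ξ
    rcases abs_choice ξ with h | h <;> simp [h, triangle_neg]
  rw [h1, integral_comp_abs (f := fun y => triangle T y * Real.cos (y * x))]
  have h2 : ∫ ξ in Set.Ioi (0 : ℝ), triangle T ξ * Real.cos (ξ * x)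
      = ∫ ξ in (0 : ℝ)..T, (1 - ξ / T) * Real.cos (ξ * x) := by
    rw [intervalIntegral.integral_of_le hT.le, setIntegral_eq_of_subset_of_forall_sdiff_eq_zero
      measurableSet_Ioi (show Set.Ioc 0 T ⊆ Set.Ioi 0 from Set.Ioc_subset_Ioi_self)]
    · refine setIntegral_congr_fun measurableSet_Ioc fun ξ hξ => ?_
      have : ξ / T ≤ 1 := (div_le_one hT).2 hξ.2
      simp only [triangle, abs_of_pos hξ.1]
      rw [max_eq_right (by linarith)]
    · intro ξ hξ
      have h0 : 0 < ξ := hξ.1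
      have : T ≤ |ξ| := by
        rw [abs_of_pos h0]; by_contra h; exact hξ.2 ⟨h0, (not_le.1 h).le⟩
      simp [triangle_eq_zero hT this]
  rw [h2]
  rcases eq_or_ne x 0 with rfl | hx
  · simp only [mul_zero, Real.cos_zero, mul_one, fejer, zero_div, Real.sinc_zero]
    rw [intervalIntegral.integral_sub (by simp) (by simp [intervalIntegral.intervalIntegrable_id])]
    simp
    field_simp
    ring
  · have hd : ∀ ξ ∈ Set.uIcc 0 T, HasDerivAt
        (fun ξ => (1 - ξ / T) * (Real.sin (ξ * x) / x) - Real.cos (ξ * x) / (T * x ^ 2))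
        ((1 - ξ / T) * Real.cos (ξ * x)) ξ := by
      intro ξ _
      have hm : HasDerivAt (fun ξ : ℝ => ξ * x) x ξ := by simpa using (hasDerivAt_id ξ).mul_const x
      have h3 := ((((hasDerivAt_id ξ).div_const T).const_sub 1).mul (hm.sin.div_const x)).sub
        (hm.cos.div_const (T * x ^ 2))
      refine h3.congr_deriv ?_
      simp only [id]
      field_simp
      ring
    rw [intervalIntegral.integral_eq_sub_of_hasDerivAt hd
      (Continuous.intervalIntegrable (by fun_prop) _ _)]
    have hne : T * x / 2 ≠ 0 := by positivity
    have hc : Real.cos (T * x) = 1 - 2 * Real.sin (T * x / 2) ^ 2 := by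
      have := Real.cos_two_mul (T * x / 2)
      rw [show 2 * (T * x / 2) = T * x by ring, Real.cos_sq'] at this
      linarith
    rw [fejer, Real.sinc_of_ne_zero hne, hc]
    simp
    field_simp
    ring

lemma integral_triangle_mul_exp {T : ℝ} (hT : 0 < T) (x : ℝ) :
    ∫ ξ, (triangle T ξ : ℂ) * Complex.exp (((ξ * x : ℝ) : ℂ) * Complex.I)
      = ((2 * Real.pi * fejer T x : ℝ) : ℂ) := by
  set f : ℝ → ℂ := fun ξ => (triangle T ξ : ℂ) * Complex.exp (((ξ * x : ℝ) : ℂ) * Complex.I)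
  have hf : Integrable f := by
    refine ((integrable_triangle hT).ofReal (𝕜 := ℂ)).mul_bdd (c := 1)
      (by fun_prop) (Eventually.of_forall fun ξ => ?_)
    rw [Complex.norm_exp_ofReal_mul_I]
  have h1 : ∫ ξ, f ξ = (1 / 2 : ℂ) * ∫ ξ, (f ξ + f (-ξ)) := by
    rw [integral_add hf hf.comp_neg, integral_neg_eq_self]; ring
  rw [h1, ← integral_triangle_mul_cos hT, ← integral_complex_ofReal, ← integral_const_mul]
  refine integral_congr_ae (Eventually.of_forall fun ξ => ?_)
  simp only [f, triangle_neg, neg_mul, Complex.ofReal_neg, Complex.ofReal_mul, Complex.ofReal_cos,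
    Complex.cos]
  ring

/-- Fourier inversion: the triangle is continuous and its transform, the Fejér density, is
integrable. The scaling by `2π` translates the normalization `e^{-2πi v w}` of
`FourierTransform.fourier`. -/
lemma integral_fejer_mul_exp {T : ℝ} (hT : 0 < T) (ξ : ℝ) :
    ∫ x, (fejer T x : ℂ) * Complex.exp (((x * ξ : ℝ) : ℂ) * Complex.I) = (triangle T ξ : ℂ) := by
  set f : ℝ → ℂ := fun ξ => (triangle T ξ : ℂ)
  have hF : FourierTransform.fourier f
      = fun w => ((2 * Real.pi * fejer T (2 * Real.pi * w) : ℝ) : ℂ) := by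
    ext w
    rw [Real.fourier_real_eq, ← fejer_neg, ← integral_triangle_mul_exp hT]
    refine integral_congr_ae (Eventually.of_forall fun v => ?_)
    simp only [Circle.smul_def, Real.fourierChar_apply, f, smul_eq_mul]
    rw [mul_comm]
    congr 4
    ring
  have hFi : Integrable (FourierTransform.fourier f) := by
    rw [hF]
    exact (((integrable_fejer hT).comp_mul_left' (by positivity : (2 * Real.pi) ≠ 0)).const_mul
      (2 * Real.pi)).ofReal
  have hc : Continuous f := Complex.continuous_ofReal.comp (continuous_triangle T)
  have key := congrFun (hc.fourierInv_fourier_eq (integrable_triangle hT).ofReal hFi) ξ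
  rw [Real.fourierInv_eq', hF] at key
  change _ = (triangle T ξ : ℂ) at key
  rw [← key]
  have h2 := Measure.integral_comp_mul_left
    (fun x : ℝ => (fejer T x : ℂ) * Complex.exp (((x * ξ : ℝ) : ℂ) * Complex.I)) (2 * Real.pi)
  have hpi : 0 < 2 * Real.pi := by positivity
  rw [abs_of_pos (inv_pos.2 hpi)] at h2
  have h3 : (2 * Real.pi) • ∫ x : ℝ, (fejer T (2 * Real.pi * x) : ℂ) *
      Complex.exp (((2 * Real.pi * x * ξ : ℝ) : ℂ) * Complex.I)
      = ∫ x, (fejer T x : ℂ) * Complex.exp (((x * ξ : ℝ) : ℂ) * Complex.I) := by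
    rw [h2, smul_smul, mul_inv_cancel₀ hpi.ne', one_smul]
  rw [← h3, ← integral_smul]
  refine integral_congr_ae (Eventually.of_forall fun v => ?_)
  simp only [smul_eq_mul, Complex.real_smul, Complex.ofReal_mul, RCLike.inner_apply, conj_trivial]
  rw [show ((2 : ℝ) : ℂ) * Real.pi * v * ξ = (2 : ℝ) * Real.pi * (ξ * v) by ring]
  ring

lemma integral_fejer {T : ℝ} (hT : 0 < T) : ∫ x, fejer T x = 1 := by
  have := integral_fejer_mul_exp hT 0
  simp only [mul_zero, Complex.ofReal_zero, zero_mul, Complex.exp_zero, mul_one] at this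
  rw [integral_complex_ofReal] at this
  have h : triangle T 0 = 1 := by simp [triangle]
  rw [h] at this
  exact_mod_cast this

/-- The Fejér probability law. -/
def fejerLaw (T : ℝ) : Measure ℝ := volume.withDensity fun x => ENNReal.ofReal (fejer T x)

lemma isProbabilityMeasure_fejerLaw {T : ℝ} (hT : 0 < T) : IsProbabilityMeasure (fejerLaw T) := by
  constructor
  rw [fejerLaw, withDensity_apply _ .univ, Measure.restrict_univ,
    ← ofReal_integral_eq_lintegral_ofReal (integrable_fejer hT)
      (Eventually.of_forall (fejer_nonneg hT)), integral_fejer hT, ENNReal.ofReal_one]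

lemma measurable_fejer (T : ℝ) : Measurable (fejer T) := (continuous_fejer T).measurable

lemma integral_fejerLaw {E : Type*} [NormedAddCommGroup E] [NormedSpace ℝ E] {T : ℝ} (hT : 0 < T)
    (f : ℝ → E) : ∫ x, f x ∂(fejerLaw T) = ∫ x, fejer T x • f x := by
  rw [fejerLaw, integral_withDensity_eq_integral_toReal_smul
    (measurable_fejer T).ennreal_ofReal (by simp)]
  simp only [ENNReal.toReal_ofReal (fejer_nonneg hT _)]

lemma charFun_fejerLaw {T : ℝ} (hT : 0 < T) (ξ : ℝ) :
    charFun (fejerLaw T) ξ = (triangle T ξ : ℂ) := by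
  rw [charFun_apply_real, integral_fejerLaw hT, ← integral_fejer_mul_exp hT]
  refine integral_congr_ae (Eventually.of_forall fun v => ?_)
  simp only [Complex.real_smul]
  push_cast
  congr 3
  ring

/-! ### Smoothing by the Fejér law -/

/-- The density of `μ ∗ fejerLaw T`. -/
def smoothDensity (T : ℝ) (μ : Measure ℝ) (x : ℝ) : ℝ := ∫ y, fejer T (x - y) ∂μ

lemma conv_fejerLaw {T : ℝ} (hT : 0 < T) (μ : Measure ℝ) [IsProbabilityMeasure μ] :
    μ.conv (fejerLaw T) = volume.withDensity fun x => ENNReal.ofReal (smoothDensity T μ x) := by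
  have := isProbabilityMeasure_fejerLaw hT
  have hm := measurable_fejer T
  ext s hs
  rw [withDensity_apply _ hs, ← lintegral_indicator_one hs,
    Measure.lintegral_conv (measurable_one.indicator hs)]
  have h1 : ∀ y : ℝ, ∫⁻ z, s.indicator 1 (y + z) ∂(fejerLaw T)
      = ∫⁻ x in s, ENNReal.ofReal (fejer T (x - y)) := by
    intro y
    have hg : Measurable fun z : ℝ => s.indicator (1 : ℝ → ENNReal) (y + z) :=
      (measurable_one.indicator hs).comp (measurable_const_add y)
    rw [fejerLaw, lintegral_withDensity_eq_lintegral_mul _ hm.ennreal_ofReal hg,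
      ← lintegral_sub_right_eq_self _ y, ← lintegral_indicator hs]
    refine lintegral_congr fun x => ?_
    by_cases hx : x ∈ s <;> simp [Set.indicator, hx]
  simp_rw [h1]
  rw [lintegral_lintegral_swap (by fun_prop)]
  refine lintegral_congr fun x => ?_
  rw [smoothDensity, ofReal_integral_eq_lintegral_ofReal]
  · refine Integrable.of_bound (hm.comp (measurable_const_sub x)).aestronglyMeasurable
      (T / (2 * Real.pi)) (Eventually.of_forall fun y => ?_)
    rw [Real.norm_of_nonneg (fejer_nonneg hT _)]
    exact fejer_le hT _
  · exact Eventually.of_forall fun y => fejer_nonneg hT _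

lemma smoothDensity_nonneg {T : ℝ} (hT : 0 < T) (μ : Measure ℝ) (x : ℝ) :
    0 ≤ smoothDensity T μ x := integral_nonneg fun _ => fejer_nonneg hT _

/-- An inversion formula for an arbitrary law: the compactly supported factor `triangle T` supplies
the integrability that `charFun μ` may lack, and Fubini does the rest. -/
lemma ofReal_smoothDensity {T : ℝ} (hT : 0 < T) (μ : Measure ℝ) [IsProbabilityMeasure μ] (x : ℝ) :
    (smoothDensity T μ x : ℂ) = 1 / (2 * Real.pi) *
      ∫ ξ, (triangle T ξ : ℂ) * charFun μ ξ * Complex.exp (-(ξ * x : ℝ) * Complex.I) := by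
  have h1 : ∀ y : ℝ, (fejer T (x - y) : ℂ) = 1 / (2 * Real.pi) *
      ∫ ξ, (triangle T ξ : ℂ) * Complex.exp (((ξ * (y - x) : ℝ) : ℂ) * Complex.I) := by
    intro y
    rw [integral_triangle_mul_exp hT, ← fejer_neg, neg_sub]
    push_cast
    field_simp
  rw [smoothDensity, ← integral_complex_ofReal]
  simp_rw [h1]
  rw [integral_const_mul, integral_integral_swap]
  · congr 1
    refine integral_congr_ae (Eventually.of_forall fun ξ => ?_)
    simp only
    rw [charFun_apply_real, mul_assoc, integral_const_mul, ← integral_mul_const]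
    congr 1
    refine integral_congr_ae (Eventually.of_forall fun y => ?_)
    simp only
    rw [← Complex.exp_add]
    congr 1
    push_cast
    ring
  · have hi : Integrable (fun z : ℝ × ℝ => (1 : ℝ) * triangle T z.2) (μ.prod volume) :=
      (integrable_const (1 : ℝ)).mul_prod (integrable_triangle hT)
    refine hi.mono' ?_ (Eventually.of_forall fun z => ?_)
    · have := continuous_triangle T
      exact Continuous.aestronglyMeasurable (by unfold Function.uncurry; fun_prop)
    · simp only [Function.uncurry, norm_mul, Complex.norm_real, Complex.norm_exp_ofReal_mul_I]
      rw [Real.norm_of_nonneg (triangle_nonneg _ _)]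
      simp

/-- A law with an integrable density has the integral of the density as distribution function. -/
lemma cdf_sub_cdf_of_withDensity {P : Measure ℝ} [IsProbabilityMeasure P] {h : ℝ → ℝ}
    (hh : ∀ x, 0 ≤ h x) (hc : Continuous h)
    (hP : P = volume.withDensity fun x => ENNReal.ofReal (h x)) {a b : ℝ} (hab : a ≤ b) :
    cdf P b - cdf P a = ∫ x in a..b, h x := by
  have h1 : P.real (Set.Ioc a b) = ∫ x in a..b, h x := by
    rw [intervalIntegral.integral_of_le hab, measureReal_def, hP,
      withDensity_apply _ measurableSet_Ioc, integral_eq_lintegral_of_nonneg_ae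
        (Eventually.of_forall hh) hc.aestronglyMeasurable]
  rw [← h1, cdf_eq_real, cdf_eq_real, ← Set.Iic_sdiff_Iic, measureReal_sdiff
    (Set.Iic_subset_Iic.2 hab) measurableSet_Iic]

lemma continuous_smoothDensity {T : ℝ} (hT : 0 < T) (μ : Measure ℝ) [IsProbabilityMeasure μ] :
    Continuous (smoothDensity T μ) := by
  have hc := continuous_fejer T
  refine continuous_of_dominated (bound := fun _ => T / (2 * Real.pi))
    (fun x => Continuous.aestronglyMeasurable (by fun_prop))
    (fun x => Eventually.of_forall fun y => ?_) (integrable_const _)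
    (Eventually.of_forall fun y => by fun_prop)
  rw [Real.norm_of_nonneg (fejer_nonneg hT _)]
  exact fejer_le hT _

lemma cdf_conv_fejerLaw_sub {T : ℝ} (hT : 0 < T) (μ : Measure ℝ) [IsProbabilityMeasure μ]
    {a b : ℝ} (hab : a ≤ b) :
    cdf (μ.conv (fejerLaw T)) b - cdf (μ.conv (fejerLaw T)) a
      = ∫ x in a..b, smoothDensity T μ x := by
  have := isProbabilityMeasure_fejerLaw hT
  exact cdf_sub_cdf_of_withDensity (smoothDensity_nonneg hT μ) (continuous_smoothDensity hT μ)
    (conv_fejerLaw hT μ) hab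

lemma cdf_conv_fejerLaw {T : ℝ} (hT : 0 < T) (μ : Measure ℝ) [IsProbabilityMeasure μ] (x : ℝ) :
    cdf (μ.conv (fejerLaw T)) x = ∫ z, fejer T z * cdf μ (x - z) := by
  have := isProbabilityMeasure_fejerLaw hT
  have h1 : ∫ z, fejer T z * cdf μ (x - z) = ∫ z, cdf μ (x - z) ∂(fejerLaw T) := by
    rw [integral_fejerLaw hT]; rfl
  have hmeas : Measurable fun z => cdf μ (x - z) :=
    (monotone_cdf μ).measurable.comp (measurable_const_sub x)
  rw [h1, cdf_eq_real, Measure.conv_comm, measureReal_def, integral_eq_lintegral_of_nonneg_ae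
    (Eventually.of_forall fun z => cdf_nonneg _ _) hmeas.aestronglyMeasurable,
    ← lintegral_indicator_one measurableSet_Iic,
    Measure.lintegral_conv (measurable_one.indicator measurableSet_Iic)]
  congr 1
  refine lintegral_congr fun z => ?_
  rw [ofReal_cdf, ← lintegral_indicator_one measurableSet_Iic]
  refine lintegral_congr fun y => ?_
  have : z + y ≤ x ↔ y ≤ x - z := by constructor <;> intro h <;> linarith
  simp [Set.indicator, this]

/-- Fourier bound of the smoothed difference of two distribution functions. -/
lemma abs_cdf_conv_sub_le {T : ℝ} (hT : 0 < T) (μ ν : Measure ℝ) [IsProbabilityMeasure μ]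
    [IsProbabilityMeasure ν]
    (hint : IntervalIntegrable (fun ξ : ℝ => ‖charFun μ ξ - charFun ν ξ‖ / |ξ|) volume (-T) T)
    (b : ℝ) :
    |cdf (μ.conv (fejerLaw T)) b - cdf (ν.conv (fejerLaw T)) b|
      ≤ 1 / (2 * Real.pi) * ∫ ξ in (-T)..T, ‖charFun μ ξ - charFun ν ξ‖ / |ξ| := by
  set D : ℝ → ℝ := fun x => cdf (μ.conv (fejerLaw T)) x - cdf (ν.conv (fejerLaw T)) x with hD
  set ψ : ℝ → ℂ := fun ξ => (triangle T ξ : ℂ) * (charFun μ ξ - charFun ν ξ) with hψ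
  -- Division by `iξ` corresponds to integration in `x`: `D` will turn out to be `-R`, with `R` the
  -- inverse transform of `χ`. The hypothesis `hint` is what makes `χ` integrable across its
  -- singularity at `0`.
  set χ : ℝ → ℂ := fun ξ => ψ ξ / (ξ * Complex.I) with hχ
  set R : ℝ → ℂ := fun x => 1 / (2 * Real.pi) *
    ∫ ξ, χ ξ * Complex.exp (-(ξ * x : ℝ) * Complex.I) with hR
  have hψc : Continuous ψ := by
    have := continuous_triangle T
    have h1 : Continuous (charFun μ) := continuous_charFun
    have h2 : Continuous (charFun ν) := continuous_charFun
    fun_prop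
  have hψμ : ∀ (P : Measure ℝ) [IsProbabilityMeasure P] (x : ℝ), Integrable fun ξ =>
      (triangle T ξ : ℂ) * charFun P ξ * Complex.exp (-(ξ * x : ℝ) * Complex.I) := by
    intro P _ x
    have h1 : Continuous (charFun P) := continuous_charFun
    have := continuous_triangle T
    refine (integrable_triangle hT).mono' (Continuous.aestronglyMeasurable (by fun_prop))
      (Eventually.of_forall fun ξ => ?_)
    rw [← Complex.ofReal_neg, norm_mul, Complex.norm_exp_ofReal_mul_I, mul_one, norm_mul,
      Complex.norm_real, Real.norm_of_nonneg (triangle_nonneg _ _)]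
    exact mul_le_of_le_one_right (triangle_nonneg _ _) (norm_charFun_le_one _)
  have hψi : Integrable ψ := by
    have h1 := (hψμ μ 0).sub (hψμ ν 0)
    refine h1.congr (Eventually.of_forall fun ξ => ?_)
    simp [hψ]
    ring
  have hint' : IntegrableOn (fun ξ : ℝ => ‖charFun μ ξ - charFun ν ξ‖ / |ξ|) (Set.Ioc (-T) T) :=
    (intervalIntegrable_iff_integrableOn_Ioc_of_le (by linarith)).1 hint
  have hχle : ∀ ξ, ‖χ ξ‖ ≤ (Set.Ioc (-T) T).indicator
      (fun ξ : ℝ => ‖charFun μ ξ - charFun ν ξ‖ / |ξ|) ξ := by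
    intro ξ
    by_cases h : ξ ∈ Set.Ioc (-T) T
    · rw [Set.indicator_of_mem h]
      simp only [hχ, hψ, norm_div, norm_mul, Complex.norm_real, Complex.norm_I, mul_one,
        Real.norm_eq_abs]
      rw [abs_of_nonneg (triangle_nonneg _ _)]
      gcongr
      exact mul_le_of_le_one_left (norm_nonneg _) (triangle_le_one hT _)
    · rw [Set.indicator_of_notMem h]
      have : T ≤ |ξ| := by
        by_contra h'
        have := abs_lt.1 (not_le.1 h')
        exact h ⟨this.1, this.2.le⟩
      simp [hχ, hψ, triangle_eq_zero hT this]
  have hχi : Integrable χ := by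
    refine ((integrable_indicator_iff measurableSet_Ioc).2 hint').mono' ?_
      (Eventually.of_forall hχle)
    exact (hψc.measurable.div (by fun_prop)).aestronglyMeasurable
  have hχe : ∀ x : ℝ, Integrable fun ξ => χ ξ * Complex.exp (-(ξ * x : ℝ) * Complex.I) := by
    intro x
    refine hχi.mul_bdd (c := 1) (by fun_prop) (Eventually.of_forall fun ξ => ?_)
    rw [← Complex.ofReal_neg, Complex.norm_exp_ofReal_mul_I]
  have hRle : ∀ x, ‖R x‖ ≤ 1 / (2 * Real.pi) *
      ∫ ξ in (-T)..T, ‖charFun μ ξ - charFun ν ξ‖ / |ξ| := by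
    intro x
    have hpi := Real.pi_pos
    have hn : ‖(1 / (2 * Real.pi) : ℂ)‖ = 1 / (2 * Real.pi) := by
      rw [norm_div, norm_mul, Complex.norm_real, Real.norm_of_nonneg hpi.le]; simp
    rw [hR, norm_mul, hn, intervalIntegral.integral_of_le (by linarith),
      ← integral_indicator measurableSet_Ioc]
    gcongr
    refine norm_integral_le_of_norm_le ((integrable_indicator_iff measurableSet_Ioc).2 hint')
      (Eventually.of_forall fun ξ => ?_)
    rw [← Complex.ofReal_neg, norm_mul, Complex.norm_exp_ofReal_mul_I, mul_one]
    exact hχle ξ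
  -- Riemann–Lebesgue: since `R` and `D` both vanish at `-∞`, letting `a → -∞` in `hdiff` below
  -- leaves no constant of integration.
  have hRlim : Tendsto R atBot (𝓝 0) := by
    have h1 := (Real.tendsto_integral_exp_smul_cocompact χ).comp
      ((tendsto_id.atBot_mul_const (by positivity : (0 : ℝ) < (2 * Real.pi)⁻¹)).mono_right
        atBot_le_cocompact)
    have h2 := h1.const_mul (1 / (2 * Real.pi) : ℂ)
    rw [mul_zero] at h2
    refine h2.congr fun x => ?_
    simp only [hR, Function.comp]
    congr 1
    refine integral_congr_ae (Eventually.of_forall fun ξ => ?_)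
    simp only [Circle.smul_def, Real.fourierChar_apply, smul_eq_mul, id]
    rw [mul_comm, ← Complex.ofReal_neg]
    congr 4
    field_simp
  have hdiff : ∀ a, a ≤ b → ((D b - D a : ℝ) : ℂ) = R a - R b := by
    intro a hab
    have e1 : D b - D a = ∫ x in a..b, (smoothDensity T μ x - smoothDensity T ν x) := by
      rw [intervalIntegral.integral_sub
        ((continuous_smoothDensity hT μ).intervalIntegrable _ _)
        ((continuous_smoothDensity hT ν).intervalIntegrable _ _),
        ← cdf_conv_fejerLaw_sub hT μ hab, ← cdf_conv_fejerLaw_sub hT ν hab]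
      simp only [hD]
      ring
    have e2 : ∀ x, ((smoothDensity T μ x - smoothDensity T ν x : ℝ) : ℂ) = 1 / (2 * Real.pi) *
        ∫ ξ, ψ ξ * Complex.exp (-(ξ * x : ℝ) * Complex.I) := by
      intro x
      rw [Complex.ofReal_sub, ofReal_smoothDensity hT, ofReal_smoothDensity hT, ← mul_sub,
        ← integral_sub (hψμ μ x) (hψμ ν x)]
      congr 2
      ext ξ
      simp only [hψ]
      ring
    rw [e1, ← intervalIntegral.integral_ofReal]
    simp_rw [e2]
    rw [intervalIntegral.integral_const_mul, intervalIntegral_integral_swap]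
    · simp only [hR]
      rw [← mul_sub, ← integral_sub (hχe a) (hχe b)]
      congr 1
      have hne : ∀ᵐ ξ : ℝ, ξ ≠ 0 := by simp [ae_iff]
      refine integral_congr_ae ?_
      filter_upwards [hne] with ξ hξ
      have hc : (-(ξ * Complex.I) : ℂ) ≠ 0 := by simp [hξ]
      rw [intervalIntegral.integral_const_mul]
      have := integral_exp_mul_complex (a := a) (b := b) hc
      have e3 : ∀ x : ℝ, (-(ξ * x : ℝ) * Complex.I : ℂ) = -(ξ * Complex.I) * x := by
        intro x; push_cast; ring
      simp_rw [e3]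
      rw [this]
      have hξ' : (ξ : ℂ) ≠ 0 := by exact_mod_cast hξ
      simp only [hχ]
      field_simp
      ring
    · have : IsFiniteMeasure (volume.restrict (Set.uIoc a b)) := ⟨by simp [Set.uIoc]⟩
      have hi : Integrable (fun z : ℝ × ℝ => (1 : ℝ) * ‖ψ z.2‖)
          ((volume.restrict (Set.uIoc a b)).prod volume) :=
        (integrable_const (1 : ℝ)).mul_prod hψi.norm
      refine hi.mono' ?_ (Eventually.of_forall fun z => ?_)
      · exact Continuous.aestronglyMeasurable (by unfold Function.uncurry; fun_prop)
      · simp only [Function.uncurry, one_mul]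
        rw [← Complex.ofReal_neg, norm_mul, Complex.norm_exp_ofReal_mul_I, mul_one]
  have hDlim : Tendsto D atBot (𝓝 0) := by
    simpa using (tendsto_cdf_atBot _).sub (tendsto_cdf_atBot _)
  have hDb : ((D b : ℝ) : ℂ) = - R b := by
    have h1 : Tendsto (fun a => ((D b - D a : ℝ) : ℂ)) atBot (𝓝 ((D b - 0 : ℝ) : ℂ)) :=
      (Complex.continuous_ofReal.tendsto _).comp (tendsto_const_nhds.sub hDlim)
    have h2 : Tendsto (fun a => R a - R b) atBot (𝓝 (0 - R b)) := hRlim.sub_const _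
    have h3 : (fun a => ((D b - D a : ℝ) : ℂ)) =ᶠ[atBot] fun a => R a - R b :=
      (eventually_le_atBot b).mono fun a ha => hdiff a ha
    have := tendsto_nhds_unique (h1.congr' h3) h2
    simpa using this
  have : |D b| = ‖R b‖ := by
    rw [← Real.norm_eq_abs, ← Complex.norm_real, hDb, norm_neg]
  rw [show cdf (μ.conv (fejerLaw T)) b - cdf (ν.conv (fejerLaw T)) b = D b from rfl, this]
  exact hRle b

/-! ### Esseen's smoothing inequality -/

lemma integral_fejer_tail_le {T h : ℝ} (hT : 0 < T) (hh : 0 < h) :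
    ∫ z, (Set.Icc (-h) h)ᶜ.indicator (fejer T) z ≤ 4 / (Real.pi * T * h) := by
  have h1 : (Set.Icc (-h) h)ᶜ.indicator (fejer T)
      = fun z => (Set.Ioi h).indicator (fejer T) |z| := by
    ext z
    have e1 : fejer T |z| = fejer T z := by
      rcases abs_choice z with h | h <;> simp [h, fejer_neg]
    have e2 : z ∈ (Set.Icc (-h) h)ᶜ ↔ |z| ∈ Set.Ioi h := by
      rw [Set.mem_compl_iff, Set.mem_Icc, ← abs_le, not_le, Set.mem_Ioi]
    by_cases hz : |z| ∈ Set.Ioi h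
    · rw [Set.indicator_of_mem (e2.2 hz), Set.indicator_of_mem hz, e1]
    · rw [Set.indicator_of_notMem (fun h => hz (e2.1 h)), Set.indicator_of_notMem hz]
  rw [h1, integral_comp_abs (f := (Set.Ioi h).indicator (fejer T)),
    setIntegral_indicator measurableSet_Ioi, Set.Ioi_inter_Ioi, max_eq_right hh.le]
  have h2 : ∫ z in Set.Ioi h, fejer T z ≤ ∫ z in Set.Ioi h, 2 / (Real.pi * T) * z ^ (-2 : ℝ) := by
    refine setIntegral_mono_on (integrable_fejer hT).integrableOn
      ((integrableOn_Ioi_rpow_of_lt (by norm_num) hh).const_mul _) measurableSet_Ioi fun z hz => ?_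
    have hz0 : 0 < z := hh.trans hz
    refine (fejer_le_div_sq hT hz0.ne').trans_eq ?_
    rw [Real.rpow_neg hz0.le]
    norm_num
  rw [integral_const_mul, integral_Ioi_rpow_of_lt (by norm_num) hh] at h2
  have h3 : 2 / (Real.pi * T) * (-h ^ ((-2 : ℝ) + 1) / ((-2 : ℝ) + 1)) = 2 / (Real.pi * T * h) := by
    have : h ^ ((-2 : ℝ) + 1) = h⁻¹ := by
      rw [show (-2 : ℝ) + 1 = -1 by norm_num, Real.rpow_neg_one]
    rw [this]
    have := Real.pi_pos
    field_simp
    norm_num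
  rw [h3] at h2
  calc 2 * ∫ z in Set.Ioi h, fejer T z ≤ 2 * (2 / (Real.pi * T * h)) := by gcongr
    _ = _ := by ring

/-- A function that decreases at most linearly to the right of a point of almost maximal value
keeps a substantial value after smoothing. -/
lemma le_integral_fejer_mul {D : ℝ → ℝ} (hD : Measurable D) {η κ m T x₀ : ℝ} (hη : ∀ x, |D x| ≤ η)
    (hκ : 0 < κ) (hηκ : η ≤ 2 * κ) (hm : 0 < m) (hT : 0 < T)
    (hx₀ : ∀ s, 0 ≤ s → κ - m * s ≤ D (x₀ + s)) :
    κ / 2 - 20 * m / (Real.pi * T) ≤ ∫ z, fejer T z * D (x₀ + κ / (2 * m) - z) := by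
  -- With this shift, `x₀ + h - z` lies to the right of `x₀` for `|z| ≤ h`, and there `D ≥ κ - m (h
  -- - z) = κ / 2 + m z`. The term `m z` integrates to `0` against the even kernel; for `|z| > h`
  -- only `D ≥ -η` is used.
  set h := κ / (2 * m) with hh
  have hh0 : 0 < h := by positivity
  have hmh : m * h = κ / 2 := by rw [hh]; field_simp
  have hpi := Real.pi_pos
  set w : ℝ → ℝ := (Set.Icc (-h) h).indicator (fun z => z * fejer T z) with hw
  set u : ℝ → ℝ := (Set.Icc (-h) h)ᶜ.indicator (fejer T) with hu
  have hc := continuous_fejer T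
  have hwi : Integrable w := by
    refine (integrable_indicator_iff measurableSet_Icc).2 ?_
    exact Continuous.integrableOn_Icc (by fun_prop)
  have hui : Integrable u := (integrable_fejer hT).indicator measurableSet_Icc.compl
  have hw0 : ∫ z, w z = 0 := by
    have h1 : ∀ z, w (-z) = - w z := by
      intro z
      by_cases hz : z ∈ Set.Icc (-h) h
      · have hz' : -z ∈ Set.Icc (-h) h := ⟨by linarith [hz.2], by linarith [hz.1]⟩
        rw [hw, Set.indicator_of_mem hz, Set.indicator_of_mem hz', fejer_neg]; ring
      · have hz' : -z ∉ Set.Icc (-h) h := fun h' => hz ⟨by linarith [h'.2], by linarith [h'.1]⟩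
        rw [hw, Set.indicator_of_notMem hz, Set.indicator_of_notMem hz', neg_zero]
    have h2 := integral_neg_eq_self w volume
    simp_rw [h1] at h2
    rw [integral_neg] at h2
    linarith
  have hvD : Integrable fun z => fejer T z * D (x₀ + h - z) :=
    (integrable_fejer hT).mul_bdd (c := η)
      (hD.comp (measurable_const_sub _)).aestronglyMeasurable
      (Eventually.of_forall fun z => by rw [Real.norm_eq_abs]; exact hη _)
  have hle : ∀ z, fejer T z * (κ / 2) + m * w z - (η + κ / 2) * u z
      ≤ fejer T z * D (x₀ + h - z) := by
    intro z
    have hv := fejer_nonneg hT z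
    by_cases hz : z ∈ Set.Icc (-h) h
    · have hz' : z ∉ (Set.Icc (-h) h)ᶜ := fun h' => h' hz
      rw [hw, hu, Set.indicator_of_mem hz, Set.indicator_of_notMem hz']
      have := hx₀ (h - z) (by linarith [hz.2])
      rw [← add_sub_assoc] at this
      calc _ = fejer T z * (κ - m * (h - z)) := by
            rw [mul_sub m, hmh]; ring
        _ ≤ _ := by gcongr
    · have hz' : z ∈ (Set.Icc (-h) h)ᶜ := hz
      rw [hw, hu, Set.indicator_of_notMem hz, Set.indicator_of_mem hz']
      have := (abs_le.1 (hη (x₀ + h - z))).1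
      calc _ = fejer T z * (-η) := by ring
        _ ≤ _ := by gcongr
  have hvi := (integrable_fejer hT).mul_const (κ / 2)
  have hvw : Integrable fun z => fejer T z * (κ / 2) + m * w z := hvi.add (hwi.const_mul m)
  have hint := integral_mono (hvw.sub (hui.const_mul (η + κ / 2))) hvD hle
  rw [integral_sub' hvw (hui.const_mul (η + κ / 2)), integral_add hvi (hwi.const_mul m),
    integral_mul_const, integral_const_mul, integral_const_mul, hw0, integral_fejer hT] at hint
  have hη0 : 0 ≤ η := (abs_nonneg _).trans (hη 0)
  -- From `η ≤ 2κ` the factor is at most `5κ / 2`, and `4 / (π T h) = 8 m / (π T κ)`: `κ` cancels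
  -- and the constant is `20`.
  have htail : (η + κ / 2) * ∫ z, u z ≤ 20 * m / (Real.pi * T) := by
    calc (η + κ / 2) * ∫ z, u z ≤ (5 / 2 * κ) * (4 / (Real.pi * T * h)) := by
          have := integral_fejer_tail_le hT hh0
          have hu0 : 0 ≤ ∫ z, u z :=
            integral_nonneg fun z => Set.indicator_nonneg (fun z _ => fejer_nonneg hT z) z
          gcongr
          linarith
      _ = _ := by rw [hh]; field_simp; norm_num
  linarith

/-- Otherwise the distribution function would be constant, against its limits `0` and `1`. The
smoothing argument divides by `m`. -/
lemma deriv_bound_pos_of_cdf (ν : Measure ℝ) {m : ℝ} (hd : Differentiable ℝ (cdf ν))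
    (hm : ∀ x, |deriv (cdf ν) x| ≤ m) : 0 < m := by
  by_contra h
  have h0 : ∀ x, deriv (cdf ν) x = 0 := fun x =>
    abs_nonpos_iff.1 ((hm x).trans (not_lt.1 h))
  have hc : ∀ x, cdf ν x = cdf ν 0 := fun x => is_const_of_deriv_eq_zero hd h0 x 0
  have h1 : Tendsto (cdf ν) atTop (𝓝 (cdf ν 0)) :=
    tendsto_const_nhds.congr fun x => (hc x).symm
  have h2 : Tendsto (cdf ν) atBot (𝓝 (cdf ν 0)) :=
    tendsto_const_nhds.congr fun x => (hc x).symm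
  have := tendsto_nhds_unique h1 (tendsto_cdf_atTop ν)
  have := tendsto_nhds_unique h2 (tendsto_cdf_atBot ν)
  linarith

lemma abs_cdf_sub_le_one (μ ν : Measure ℝ) (x : ℝ) : |cdf μ x - cdf ν x| ≤ 1 := by
  have h1 := cdf_nonneg μ x
  have h2 := cdf_nonneg ν x
  have h3 := cdf_le_one μ x
  have h4 := cdf_le_one ν x
  rw [abs_le]; constructor <;> linarith

lemma integrable_fejer_mul_cdf {T : ℝ} (hT : 0 < T) (μ : Measure ℝ) (x : ℝ) :
    Integrable fun z => fejer T z * cdf μ (x - z) :=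
  (integrable_fejer hT).mul_bdd (c := 1)
    ((monotone_cdf μ).measurable.comp (measurable_const_sub _)).aestronglyMeasurable
    (Eventually.of_forall fun z => by
      rw [Real.norm_of_nonneg (cdf_nonneg _ _)]; exact cdf_le_one _ _)

/-- **Esseen's smoothing inequality.** -/
theorem isBerryEsseenConst_esseen : IsBerryEsseenConst (40 / Real.pi) := by
  have hpi := Real.pi_pos
  refine ⟨by positivity, ?_⟩
  intro μ ν _ _ m T hT hd hm hint x
  have hm0 := deriv_bound_pos_of_cdf ν hd hm
  set B := 1 / Real.pi * ∫ ξ in (-T)..T, ‖charFun μ ξ - charFun ν ξ‖ / |ξ| with hB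
  set D : ℝ → ℝ := fun x => cdf μ x - cdf ν x with hD
  have hDm : Measurable D := (monotone_cdf μ).measurable.sub (monotone_cdf ν).measurable
  have hsm : ∀ y, |∫ z, fejer T z * D (y - z)| ≤ B / 2 := by
    intro y
    have h1 := abs_cdf_conv_sub_le hT μ ν hint y
    rw [cdf_conv_fejerLaw hT, cdf_conv_fejerLaw hT, ← integral_sub (integrable_fejer_mul_cdf hT μ y)
      (integrable_fejer_mul_cdf hT ν y)] at h1
    simp only [hD, mul_sub]
    refine h1.trans_eq ?_
    rw [hB]; ring
  have hbdd : BddAbove (Set.range fun y => |D y|) :=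
    ⟨1, by rintro _ ⟨y, rfl⟩; exact abs_cdf_sub_le_one μ ν y⟩
  set η := ⨆ y, |D y| with hη
  have hηle : ∀ y, |D y| ≤ η := fun y => le_ciSup hbdd y
  -- As `cdf μ` is nondecreasing, this bounds the rate at which `D` can decrease to the right by
  -- `m`.
  have hGlip : ∀ a s, 0 ≤ s → cdf ν (a + s) - cdf ν a ≤ m * s := by
    intro a s hs
    have := image_sub_le_mul_sub_of_deriv_le hd (fun y => (abs_le.1 (hm y)).2)
      (show a ≤ a + s by linarith)
    simpa using this
  -- The supremum need not be attained, but a point with half of it is enough.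
  obtain ⟨x₀, h₁, h₂⟩ : ∃ x₀, |D x| ≤ |D x₀| ∧ η ≤ 2 * |D x₀| := by
    by_cases h : η ≤ 2 * |D x|
    · exact ⟨x, le_rfl, h⟩
    · have hlt : η / 2 < η := by linarith [abs_nonneg (D x)]
      obtain ⟨x₀, hx₀⟩ := exists_lt_of_lt_ciSup hlt
      exact ⟨x₀, by linarith, by linarith⟩
  have hfin : |D x₀| / 2 - 20 * m / (Real.pi * T) ≤ B / 2 := by
    rcases eq_or_ne (D x₀) 0 with h0 | h0
    · have : 0 ≤ B / 2 := (abs_nonneg _).trans (hsm 0)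
      have : 0 ≤ 20 * m / (Real.pi * T) := by positivity
      rw [h0, abs_zero]; linarith
    have hκ : 0 < |D x₀| := abs_pos.2 h0
    rcases abs_choice (D x₀) with h | h
    · refine (le_integral_fejer_mul hDm hηle hκ h₂ hm0 hT (x₀ := x₀) fun s hs => ?_).trans
        ((le_abs_self _).trans (hsm _))
      have := hGlip x₀ s hs
      have := monotone_cdf μ (show x₀ ≤ x₀ + s by linarith)
      rw [h]; simp only [hD]; linarith
    -- For negative `D x₀` the slow growth is used to the left of `x₀`; the reflection `y ↦ -D (-y)`
    -- reduces this to the previous case, as the kernel is even.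
    · have hneg := le_integral_fejer_mul (D := fun y => -D (-y)) (x₀ := -x₀)
        (hDm.comp measurable_neg).neg (fun y => by rw [abs_neg]; exact hηle _) hκ h₂ hm0 hT
        fun s hs => by
          have := hGlip (x₀ - s) s hs
          have h3 := monotone_cdf μ (show x₀ - s ≤ x₀ by linarith)
          rw [sub_add_cancel] at this
          rw [h, show -(-x₀ + s) = x₀ - s by ring]; simp only [hD]; linarith
      refine hneg.trans ?_
      set y := -x₀ + |D x₀| / (2 * m)
      have e1 : ∫ z, fejer T z * -D (-(y - z)) = - ∫ z, fejer T z * D (-y - z) := by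
        rw [← integral_neg, ← integral_neg_eq_self]
        refine integral_congr_ae (Eventually.of_forall fun z => ?_)
        simp only [fejer_neg]
        rw [show -(y - -z) = -y - z by ring]; ring
      rw [e1]
      exact (neg_le_abs _).trans (hsm _)
  calc |cdf μ x - cdf ν x| ≤ |D x₀| := h₁
    _ ≤ B + 40 * m / (Real.pi * T) := by
      have : 40 * m / (Real.pi * T) = 2 * (20 * m / (Real.pi * T)) := by ring
      linarith
    _ = _ := by rw [hB]; field_simp

/-! ### Laws with an integrable characteristic function -/

/-- The density given by Fourier inversion. -/
def inversionDensity (μ : Measure ℝ) (x : ℝ) : ℝ :=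
  (1 / (2 * Real.pi) * ∫ ξ, charFun μ ξ * Complex.exp (-(ξ * x : ℝ) * Complex.I) : ℂ).re

lemma continuous_inversionDensity (μ : Measure ℝ) [IsProbabilityMeasure μ]
    (hμ : Integrable (charFun μ)) : Continuous (inversionDensity μ) := by
  have hc : Continuous (charFun μ) := continuous_charFun
  refine Complex.continuous_re.comp (continuous_const.mul ?_)
  refine continuous_of_dominated (bound := fun ξ => ‖charFun μ ξ‖)
    (fun x => Continuous.aestronglyMeasurable (by fun_prop))
    (fun x => Eventually.of_forall fun ξ => ?_) hμ.norm
    (Eventually.of_forall fun ξ => by fun_prop)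
  rw [← Complex.ofReal_neg, norm_mul, Complex.norm_exp_ofReal_mul_I, mul_one]

lemma norm_one_div_two_pi : ‖(1 / (2 * Real.pi) : ℂ)‖ = 1 / (2 * Real.pi) := by
  rw [norm_div, norm_mul, Complex.norm_real, Real.norm_of_nonneg Real.pi_pos.le]; simp

lemma abs_inversionDensity_le (μ : Measure ℝ) (x : ℝ) :
    |inversionDensity μ x| ≤ 1 / (2 * Real.pi) * ∫ ξ, ‖charFun μ ξ‖ := by
  refine (Complex.abs_re_le_norm _).trans ?_
  rw [norm_mul, norm_one_div_two_pi]
  gcongr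
  refine (norm_integral_le_integral_norm _).trans_eq (integral_congr_ae
    (Eventually.of_forall fun ξ => ?_))
  simp only
  rw [← Complex.ofReal_neg, norm_mul, Complex.norm_exp_ofReal_mul_I, mul_one]

/-- The bound does not depend on `T`, so it dominates the densities as `T → ∞`. -/
lemma smoothDensity_le {T : ℝ} (hT : 0 < T) (μ : Measure ℝ) [IsProbabilityMeasure μ]
    (hμ : Integrable (charFun μ)) (x : ℝ) :
    smoothDensity T μ x ≤ 1 / (2 * Real.pi) * ∫ ξ, ‖charFun μ ξ‖ := by
  have h1 : ‖(smoothDensity T μ x : ℂ)‖ ≤ 1 / (2 * Real.pi) * ∫ ξ, ‖charFun μ ξ‖ := by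
    rw [ofReal_smoothDensity hT, norm_mul, norm_one_div_two_pi]
    have := Real.pi_pos
    gcongr
    refine norm_integral_le_of_norm_le hμ.norm (Eventually.of_forall fun ξ => ?_)
    rw [← Complex.ofReal_neg, norm_mul, Complex.norm_exp_ofReal_mul_I, mul_one, norm_mul,
      Complex.norm_real, Real.norm_of_nonneg (triangle_nonneg _ _)]
    exact mul_le_of_le_one_left (norm_nonneg _) (triangle_le_one hT _)
  rw [Complex.norm_real] at h1
  exact (le_abs_self _).trans h1

lemma tendsto_triangle (ξ : ℝ) :
    Tendsto (fun n : ℕ => triangle ((n : ℝ) + 1) ξ) atTop (𝓝 1) := by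
  have h1 : Tendsto (fun n : ℕ => |ξ| / ((n : ℝ) + 1)) atTop (𝓝 0) :=
    tendsto_const_nhds.div_atTop (tendsto_atTop_add_const_right _ _ tendsto_natCast_atTop_atTop)
  have h2 := (tendsto_const_nhds (x := (0 : ℝ))).max (h1.const_sub 1)
  simpa [triangle] using h2

lemma tendsto_smoothDensity (μ : Measure ℝ) [IsProbabilityMeasure μ]
    (hμ : Integrable (charFun μ)) (x : ℝ) :
    Tendsto (fun n : ℕ => smoothDensity ((n : ℝ) + 1) μ x) atTop (𝓝 (inversionDensity μ x)) := by
  have hc : Continuous (charFun μ) := continuous_charFun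
  have h1 : Tendsto (fun n : ℕ => ∫ ξ, (triangle ((n : ℝ) + 1) ξ : ℂ) * charFun μ ξ *
      Complex.exp (-(ξ * x : ℝ) * Complex.I)) atTop
      (𝓝 (∫ ξ, charFun μ ξ * Complex.exp (-(ξ * x : ℝ) * Complex.I))) := by
    refine tendsto_integral_of_dominated_convergence (fun ξ => ‖charFun μ ξ‖) (fun n => ?_)
      hμ.norm (fun n => Eventually.of_forall fun ξ => ?_) (Eventually.of_forall fun ξ => ?_)
    · have := continuous_triangle ((n : ℝ) + 1)
      exact Continuous.aestronglyMeasurable (by fun_prop)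
    · rw [← Complex.ofReal_neg, norm_mul, Complex.norm_exp_ofReal_mul_I, mul_one, norm_mul,
        Complex.norm_real, Real.norm_of_nonneg (triangle_nonneg _ _)]
      exact mul_le_of_le_one_left (norm_nonneg _) (triangle_le_one (by positivity) _)
    · have := (Complex.continuous_ofReal.tendsto _).comp (tendsto_triangle ξ)
      simpa using (this.mul_const (charFun μ ξ)).mul_const
        (Complex.exp (-(ξ * x : ℝ) * Complex.I))
  have h2 := (Complex.continuous_re.tendsto _).comp (h1.const_mul (1 / (2 * Real.pi) : ℂ))
  refine h2.congr fun n => ?_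
  simp only [Function.comp]
  rw [← ofReal_smoothDensity (by positivity) μ x, Complex.ofReal_re]

/-- The convolutions with `fejerLaw (n + 1)` converge weakly to `μ` by Lévy's theorem, so their
distribution functions converge at continuity points, while their densities converge boundedly. -/
lemma cdf_sub_cdf_eq_integral_inversionDensity (μ : Measure ℝ) [IsProbabilityMeasure μ]
    (hμ : Integrable (charFun μ)) {a b : ℝ} (hab : a ≤ b) (ha : ContinuousAt (cdf μ) a)
    (hb : ContinuousAt (cdf μ) b) :
    cdf μ b - cdf μ a = ∫ x in a..b, inversionDensity μ x := by
  have hpr : ∀ n : ℕ, IsProbabilityMeasure (fejerLaw ((n : ℝ) + 1)) := fun n =>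
    isProbabilityMeasure_fejerLaw (by positivity)
  let P : ℕ → ProbabilityMeasure ℝ := fun n => ⟨μ.conv (fejerLaw ((n : ℝ) + 1)), inferInstance⟩
  let P₀ : ProbabilityMeasure ℝ := ⟨μ, inferInstance⟩
  have hweak : Tendsto P atTop (𝓝 P₀) := by
    rw [ProbabilityMeasure.tendsto_iff_tendsto_charFun]
    intro ξ
    have h1 : ∀ n, charFun (P n : Measure ℝ) ξ = charFun μ ξ * (triangle ((n : ℝ) + 1) ξ : ℂ) := by
      intro n
      change charFun (μ.conv (fejerLaw ((n : ℝ) + 1))) ξ = _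
      rw [charFun_conv, charFun_fejerLaw (by positivity)]
    simp_rw [h1]
    have := (Complex.continuous_ofReal.tendsto _).comp (tendsto_triangle ξ)
    have h2 := this.const_mul (charFun μ ξ)
    rw [Complex.ofReal_one, mul_one] at h2
    exact h2
  have hcdf : ∀ x, ContinuousAt (cdf μ) x →
      Tendsto (fun n => cdf (P n : Measure ℝ) x) atTop (𝓝 (cdf μ x)) := by
    intro x hx
    -- Continuity of the distribution function at `x` says that `x` is no atom, which is the
    -- frontier condition of the portmanteau theorem.
    have h0 : (P₀ : Measure ℝ) (frontier (Set.Iic x)) = 0 := by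
      change μ _ = 0
      rw [frontier_Iic, ← measure_cdf μ, StieltjesFunction.measure_singleton,
        ((cdf μ).mono.continuousAt_iff_leftLim_eq_rightLim.1 hx), (cdf μ).rightLim_eq, sub_self,
        ENNReal.ofReal_zero]
    have h1 := ProbabilityMeasure.tendsto_measure_of_null_frontier_of_tendsto' hweak h0
    have h2 := (ENNReal.tendsto_toReal (measure_ne_top μ _)).comp h1
    rw [cdf_eq_real]
    refine h2.congr fun n => ?_
    rw [cdf_eq_real]; rfl
  have hlim1 := (hcdf b hb).sub (hcdf a ha)
  have hlim2 : Tendsto (fun n : ℕ => ∫ x in a..b, smoothDensity ((n : ℝ) + 1) μ x) atTop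
      (𝓝 (∫ x in a..b, inversionDensity μ x)) := by
    refine intervalIntegral.tendsto_integral_filter_of_dominated_convergence
      (fun _ => 1 / (2 * Real.pi) * ∫ ξ, ‖charFun μ ξ‖)
      (Eventually.of_forall fun n =>
        (continuous_smoothDensity (by positivity) μ).aestronglyMeasurable)
      (Eventually.of_forall fun n => Eventually.of_forall fun x _ => ?_) (by simp)
      (Eventually.of_forall fun x _ => tendsto_smoothDensity μ hμ x)
    rw [Real.norm_of_nonneg (smoothDensity_nonneg (by positivity) μ x)]
    exact smoothDensity_le (by positivity) μ hμ x
  refine tendsto_nhds_unique hlim1 (hlim2.congr fun n => ?_)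
  exact (cdf_conv_fejerLaw_sub (by positivity) μ hab).symm

/-- A law with an integrable characteristic function has a differentiable distribution function. -/
theorem hasDerivAt_cdf_of_integrable_charFun (μ : Measure ℝ) [IsProbabilityMeasure μ]
    (hμ : Integrable (charFun μ)) (x : ℝ) :
    HasDerivAt (cdf μ) (inversionDensity μ x) x := by
  have hc := continuous_inversionDensity μ hμ
  have hi : ∀ a b, IntervalIntegrable (inversionDensity μ) volume a b := fun a b =>
    hc.intervalIntegrable a b
  have hdense : Dense {y | ContinuousAt (cdf μ) y} := by
    have := (monotone_cdf μ).countable_not_continuousAt.dense_compl ℝ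
    convert this using 1
    ext y; simp
  obtain ⟨c, hcc⟩ := hdense.nonempty
  have hΦ : ∀ y, ContinuousAt (cdf μ) y →
      cdf μ y - ∫ z in (0 : ℝ)..y, inversionDensity μ z
        = cdf μ c - ∫ z in (0 : ℝ)..c, inversionDensity μ z := by
    intro y hy
    rcases le_total c y with h | h
    · have := cdf_sub_cdf_eq_integral_inversionDensity μ hμ h hcc hy
      rw [← intervalIntegral.integral_add_adjacent_intervals (hi 0 c) (hi c y)]
      linarith
    · have := cdf_sub_cdf_eq_integral_inversionDensity μ hμ h hy hcc
      rw [← intervalIntegral.integral_add_adjacent_intervals (hi 0 y) (hi y c)]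
      linarith
  have hprim : Continuous fun y => ∫ z in (0 : ℝ)..y, inversionDensity μ z :=
    intervalIntegral.continuous_primitive hi 0
  -- The identity holds at continuity points, which are dense; right continuity carries it to every
  -- `y` along such points decreasing to `y`.
  have hall : ∀ y, cdf μ y = (cdf μ c - ∫ z in (0 : ℝ)..c, inversionDensity μ z)
      + ∫ z in (0 : ℝ)..y, inversionDensity μ z := by
    intro y
    obtain ⟨u, -, hu, hlim⟩ := hdense.exists_seq_strictAnti_tendsto y
    have h1 : Tendsto u atTop (𝓝[≥] y) :=
      tendsto_nhdsWithin_iff.2 ⟨hlim, Eventually.of_forall fun n => le_of_lt (Set.mem_Ioi.1 (hu n).1)⟩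
    have h2 := ((cdf μ).right_continuous y).tendsto.comp h1
    have h3 := (hprim.tendsto y).comp hlim
    have h4 := tendsto_nhds_unique ((h2.sub h3).congr fun n => hΦ (u n) (hu n).2)
      tendsto_const_nhds
    linarith
  have hd := (intervalIntegral.integral_hasDerivAt_right (hi 0 x)
    hc.aestronglyMeasurable.stronglyMeasurableAtFilter hc.continuousAt).const_add
      (cdf μ c - ∫ z in (0 : ℝ)..c, inversionDensity μ z)
  exact hd.congr_of_eventuallyEq (Eventually.of_forall hall)

lemma differentiable_cdf_of_integrable_charFun (μ : Measure ℝ) [IsProbabilityMeasure μ]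
    (hμ : Integrable (charFun μ)) : Differentiable ℝ (cdf μ) := fun x =>
  (hasDerivAt_cdf_of_integrable_charFun μ hμ x).differentiableAt

lemma abs_deriv_cdf_le_densitySup (μ : Measure ℝ) [IsProbabilityMeasure μ]
    (hμ : Integrable (charFun μ)) (x : ℝ) : |deriv (cdf μ) x| ≤ densitySup μ := by
  refine le_ciSup (f := fun x => |deriv (cdf μ) x|)
    ⟨1 / (2 * Real.pi) * ∫ ξ, ‖charFun μ ξ‖, ?_⟩ x
  rintro _ ⟨y, rfl⟩
  simp only
  rw [(hasDerivAt_cdf_of_integrable_charFun μ hμ y).deriv]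
  exact abs_inversionDensity_le μ y

/-! ### The weights of the trees and the Wild sum -/

lemma McKeanTree.leaves_pos (g : McKeanTree) : 1 ≤ g.leaves := by
  induction g with
  | leaf => exact le_rfl
  | node l r hl hr => simp only [McKeanTree.leaves]; omega

lemma McKeanTree.prob_nonneg (g : McKeanTree) : 0 ≤ g.prob := by
  induction g with
  | leaf => exact zero_le_one
  | node l r hl hr =>
    have h : (1 : ℝ) ≤ ((l.leaves + r.leaves : ℕ) : ℝ) := by
      exact_mod_cast l.leaves_pos.trans (Nat.le_add_right _ _)
    exact div_nonneg (mul_nonneg hl hr) (by linarith)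

/-- The probability of the tree `g` under `treeLaw t`. -/
def treeWeight (t : ℝ) (g : McKeanTree) : ℝ :=
  Real.exp (-t) * (1 - Real.exp (-t)) ^ (g.leaves - 1) * g.prob

lemma treeWeight_nonneg {t : ℝ} (ht : 0 ≤ t) (g : McKeanTree) : 0 ≤ treeWeight t g := by
  have h : Real.exp (-t) ≤ 1 := Real.exp_le_one_iff.2 (by linarith)
  have := g.prob_nonneg
  have h2 : 0 ≤ 1 - Real.exp (-t) := by linarith
  unfold treeWeight; positivity

lemma exp_mul_treeWeight_leaf (t : ℝ) : Real.exp t * treeWeight t .leaf = 1 := by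
  simp [treeWeight, McKeanTree.leaves, McKeanTree.prob, ← Real.exp_add]

lemma treeWeight_zero_leaf : treeWeight 0 .leaf = 1 := by
  simpa using exp_mul_treeWeight_leaf 0

lemma treeWeight_zero_node (l r : McKeanTree) : treeWeight 0 (.node l r) = 0 := by
  have h : (McKeanTree.node l r).leaves - 1 ≠ 0 := by
    have := l.leaves_pos
    have := r.leaves_pos
    simp only [McKeanTree.leaves]; omega
  simp [treeWeight, h]

/-- With `n` leaves, `e^t` times the weight is `(1 - e^{-t}) ^ (n - 1)` times the product of the two
probabilities over `n - 1`; differentiation cancels `n - 1`. This is where the uniform split of the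
leaves matters: the weights obey the same quadratic evolution as the Kac equation. -/
lemma hasDerivAt_exp_mul_treeWeight_node (l r : McKeanTree) (t : ℝ) :
    HasDerivAt (fun t => Real.exp t * treeWeight t (.node l r))
      (Real.exp t * (treeWeight t l * treeWeight t r)) t := by
  obtain ⟨a, ha⟩ := Nat.exists_eq_add_of_le' l.leaves_pos
  obtain ⟨b, hb⟩ := Nat.exists_eq_add_of_le' r.leaves_pos
  have e1 : (fun t => Real.exp t * treeWeight t (.node l r))
      = fun t => (1 - Real.exp (-t)) ^ (a + b + 1) * (l.prob * r.prob / ((a : ℝ) + b + 1)) := by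
    ext t
    have : a + 1 + (b + 1) - 1 = a + b + 1 := by omega
    simp only [treeWeight, McKeanTree.leaves, McKeanTree.prob, ha, hb, this]
    rw [← mul_assoc, ← mul_assoc, ← Real.exp_add, add_neg_cancel, Real.exp_zero, one_mul]
    push_cast
    congr 2
    ring
  rw [e1]
  have hd : HasDerivAt (fun t => 1 - Real.exp (-t)) (Real.exp (-t)) t := by
    simpa using ((hasDerivAt_neg t).exp).const_sub 1
  refine ((hd.pow (a + b + 1)).mul_const _).congr_deriv ?_
  have : (0 : ℝ) < (a : ℝ) + b + 1 := by positivity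
  simp only [treeWeight, ha, hb, add_tsub_cancel_right]
  push_cast
  have h2 : Real.exp t * Real.exp (-t) = 1 := by rw [← Real.exp_add]; simp
  calc _ = (1 - Real.exp (-t)) ^ (a + b) * Real.exp (-t) * (l.prob * r.prob) := by
        field_simp
    _ = (Real.exp t * Real.exp (-t)) * Real.exp (-t) * (1 - Real.exp (-t)) ^ (a + b)
          * (l.prob * r.prob) := by rw [h2]; ring
    _ = _ := by rw [pow_add]; ring

open scoped Classical in
/-- The trees of height less than `N`. -/
def treesBelow : ℕ → Finset McKeanTree
  | 0 => ∅
  | N + 1 => insert .leaf ((treesBelow N ×ˢ treesBelow N).image fun q => .node q.1 q.2)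

lemma leaf_mem_treesBelow (N : ℕ) : .leaf ∈ treesBelow (N + 1) := by simp [treesBelow]

lemma node_mem_treesBelow {N : ℕ} {l r : McKeanTree} :
    .node l r ∈ treesBelow (N + 1) ↔ l ∈ treesBelow N ∧ r ∈ treesBelow N := by
  simp [treesBelow]

lemma monotone_treesBelow : Monotone treesBelow := by
  refine monotone_nat_of_le_succ fun N => ?_
  induction N with
  | zero => simp [treesBelow]
  | succ N ih =>
    intro g hg
    cases g with
    | leaf => exact leaf_mem_treesBelow _
    | node l r =>
      obtain ⟨hl, hr⟩ := node_mem_treesBelow.1 hg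
      exact node_mem_treesBelow.2 ⟨ih hl, ih hr⟩

lemma exists_mem_treesBelow (g : McKeanTree) : ∃ N, g ∈ treesBelow N := by
  induction g with
  | leaf => exact ⟨1, leaf_mem_treesBelow 0⟩
  | node l r hl hr =>
    obtain ⟨a, ha⟩ := hl
    obtain ⟨b, hb⟩ := hr
    exact ⟨max a b + 1, node_mem_treesBelow.2 ⟨monotone_treesBelow (le_max_left a b) ha,
      monotone_treesBelow (le_max_right a b) hb⟩⟩

instance : Countable McKeanTree := by
  have h : (Set.univ : Set McKeanTree) = ⋃ N, (treesBelow N : Set McKeanTree) := by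
    ext g
    simpa using exists_mem_treesBelow g
  exact Set.countable_univ_iff.1 (h ▸ Set.countable_iUnion fun N => Finset.countable_toSet _)

instance : DiscreteMeasurableSpace McKeanTree := ⟨fun _ => trivial⟩

lemma tendsto_treesBelow : Tendsto treesBelow atTop atTop :=
  monotone_treesBelow.tendsto_atTop_finset exists_mem_treesBelow

/-- The reason for truncating by height and not by number of leaves: the double sum runs over a full
square, so bilinear expressions factor and the truncated sums are Picard iterates starting from `0`.
-/
lemma sum_treesBelow_succ {E : Type*} [AddCommMonoid E] (f : McKeanTree → E) (N : ℕ) :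
    ∑ g ∈ treesBelow (N + 1), f g
      = f .leaf + ∑ l ∈ treesBelow N, ∑ r ∈ treesBelow N, f (.node l r) := by
  classical
  rw [treesBelow, Finset.sum_insert, Finset.sum_image, Finset.sum_product]
  · rintro ⟨a, b⟩ - ⟨a', b'⟩ - h
    simpa using h
  · simp

section Sums

variable {E : Type*} [NormedAddCommGroup E] [NormedSpace ℝ E]

/-- A comparison principle on the half line, without derivative at the origin. -/
lemma norm_le_of_norm_hasDerivAt_le {f f' : ℝ → E} {B B' : ℝ → ℝ}
    (hf0 : ContinuousWithinAt f (Set.Ici 0) 0) (hf : ∀ t, 0 < t → HasDerivAt f (f' t) t)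
    (hB : ∀ t, HasDerivAt B (B' t) t) (h0 : ‖f 0‖ ≤ B 0) (hle : ∀ t, 0 < t → ‖f' t‖ ≤ B' t)
    {t : ℝ} (ht : 0 ≤ t) : ‖f t‖ ≤ B t := by
  rcases ht.eq_or_lt with rfl | ht
  · exact h0
  -- The comparison is started at `ε > 0`, where derivatives exist, with a boundary function shifted
  -- to agree at `ε`; continuity at `0` then permits `ε → 0`.
  have h1 : ∀ ε ∈ Set.Ioo 0 t, ‖f t‖ ≤ B t + (‖f ε‖ - B ε) := by
    intro ε hε
    refine image_norm_le_of_norm_deriv_right_le_deriv_boundary (a := ε) (b := t) (f := f) (f' := f')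
      (B := fun s => B s + (‖f ε‖ - B ε)) (B' := B')
      (fun s hs => (hf s (hε.1.trans_le hs.1)).continuousAt.continuousWithinAt)
      (fun s hs => (hf s (hε.1.trans_le hs.1)).hasDerivWithinAt) (by simp)
      (fun s => (hB s).add_const _) (fun s hs => hle s (hε.1.trans_le hs.1))
      (Set.right_mem_Icc.2 hε.2.le)
  have h2 : Tendsto (fun ε => B t + (‖f ε‖ - B ε)) (𝓝[>] 0) (𝓝 (B t + (‖f 0‖ - B 0))) :=
    ((hf0.mono_left (nhdsWithin_mono _ Set.Ioi_subset_Ici_self)).norm.sub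
      ((hB 0).continuousAt.tendsto.mono_left nhdsWithin_le_nhds)).const_add _
  have h3 := ge_of_tendsto h2 (eventually_of_mem (Ioo_mem_nhdsGT ht) h1)
  linarith

lemma hasDerivAt_exp_smul_sum_treesBelow (w : McKeanTree → E) (N : ℕ) (t : ℝ) :
    HasDerivAt (fun t => Real.exp t • ∑ g ∈ treesBelow (N + 1), treeWeight t g • w g)
      (Real.exp t • ∑ l ∈ treesBelow N, ∑ r ∈ treesBelow N,
        (treeWeight t l * treeWeight t r) • w (.node l r)) t := by
  have e1 : (fun t => Real.exp t • ∑ g ∈ treesBelow (N + 1), treeWeight t g • w g)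
      = fun t => w .leaf + ∑ l ∈ treesBelow N, ∑ r ∈ treesBelow N,
        (Real.exp t * treeWeight t (.node l r)) • w (.node l r) := by
    ext t
    rw [sum_treesBelow_succ, smul_add, smul_smul, exp_mul_treeWeight_leaf, one_smul]
    simp only [Finset.smul_sum, smul_smul]
  rw [e1]
  simp only [Finset.smul_sum, smul_smul]
  exact (HasDerivAt.fun_sum fun l _ => HasDerivAt.fun_sum fun r _ =>
    (hasDerivAt_exp_mul_treeWeight_node l r t).smul_const _).const_add _

lemma sum_treeWeight_zero_smul (w : McKeanTree → E) (N : ℕ) :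
    ∑ g ∈ treesBelow (N + 1), treeWeight 0 g • w g = w .leaf := by
  rw [sum_treesBelow_succ]
  simp [treeWeight_zero_leaf, treeWeight_zero_node]

end Sums

lemma sum_treeWeight_nonneg {t : ℝ} (ht : 0 ≤ t) (N : ℕ) :
    0 ≤ ∑ g ∈ treesBelow N, treeWeight t g :=
  Finset.sum_nonneg fun g _ => treeWeight_nonneg ht g

/-- If `S_N` is the sum, then `e^t S_{N+1}` equals `1` at `0` and has derivative `e^t S_N² ≤ e^t`;
compare with `e^t`. -/
lemma sum_treeWeight_le_one (N : ℕ) {t : ℝ} (ht : 0 ≤ t) :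
    ∑ g ∈ treesBelow N, treeWeight t g ≤ 1 := by
  induction N generalizing t with
  | zero => simp [treesBelow]
  | succ N ih =>
    have hd := hasDerivAt_exp_smul_sum_treesBelow (fun _ => (1 : ℝ)) N
    have h1 := norm_le_of_norm_hasDerivAt_le (hd 0).continuousAt.continuousWithinAt
      (fun t _ => hd t) Real.hasDerivAt_exp (by rw [sum_treeWeight_zero_smul]; simp)
      (fun t ht => ?_) ht
    · simp only [smul_eq_mul, mul_one, norm_mul, Real.norm_eq_abs, Real.abs_exp] at h1
      exact (le_abs_self _).trans
        (le_of_mul_le_mul_left (h1.trans_eq (mul_one _).symm) (Real.exp_pos t))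
    · have h0 := sum_treeWeight_nonneg ht.le N
      have h1 := ih ht.le
      have e : ∑ l ∈ treesBelow N, ∑ r ∈ treesBelow N, (treeWeight t l * treeWeight t r) • (1 : ℝ)
          = (∑ g ∈ treesBelow N, treeWeight t g) * ∑ g ∈ treesBelow N, treeWeight t g := by
        rw [Finset.sum_mul_sum]; simp
      rw [e, norm_smul, Real.norm_eq_abs, Real.abs_exp, Real.norm_of_nonneg (mul_nonneg h0 h0)]
      exact mul_le_of_le_one_right (Real.exp_pos _).le (mul_le_one₀ h1 h0 h1)

/-- Exponential evolution of an additive functional of the tree. -/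
lemma sum_treeWeight_mul_le {e : McKeanTree → ℝ} {A : ℝ} (hA : 0 ≤ A) (he : ∀ g, 0 ≤ e g)
    (hleaf : e .leaf = 1) (hnode : ∀ l r, e (.node l r) = A * (e l + e r)) (N : ℕ) {t : ℝ}
    (ht : 0 ≤ t) :
    ∑ g ∈ treesBelow N, treeWeight t g * e g ≤ Real.exp (-t * (1 - 2 * A)) := by
  induction N generalizing t with
  | zero => simp [treesBelow, Real.exp_nonneg]
  | succ N ih =>
    have hd := hasDerivAt_exp_smul_sum_treesBelow e N
    have hB : ∀ t : ℝ, HasDerivAt (fun t => Real.exp (2 * A * t))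
        (Real.exp (2 * A * t) * (2 * A)) t := fun t => by
      simpa using ((hasDerivAt_id t).const_mul (2 * A)).exp
    have h1 := norm_le_of_norm_hasDerivAt_le (hd 0).continuousAt.continuousWithinAt
      (fun t _ => hd t) hB (by rw [sum_treeWeight_zero_smul, hleaf]; simp) (fun t ht => ?_) ht
    · simp only [smul_eq_mul, norm_mul, Real.norm_eq_abs, Real.abs_exp] at h1
      have e1 : Real.exp (2 * A * t) = Real.exp t * Real.exp (-t * (1 - 2 * A)) := by
        rw [← Real.exp_add]; congr 1; ring
      rw [e1] at h1
      exact (le_abs_self _).trans (le_of_mul_le_mul_left h1 (Real.exp_pos t))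
    · set m := ∑ g ∈ treesBelow N, treeWeight t g with hm
      set f := ∑ g ∈ treesBelow N, treeWeight t g * e g with hf
      have hm0 : 0 ≤ m := sum_treeWeight_nonneg ht.le N
      have hf0 : 0 ≤ f := Finset.sum_nonneg fun g _ => mul_nonneg (treeWeight_nonneg ht.le g) (he g)
      -- Additivity splits the double sum into `2 A f m`. As `m ≤ 1`, the growth is at most that of
      -- `e^{2At}`, which is `e^t` times the claimed bound.
      have e1 : ∑ l ∈ treesBelow N, ∑ r ∈ treesBelow N,
          (treeWeight t l * treeWeight t r) • e (.node l r) = A * (f * m + m * f) := by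
        rw [hm, hf, Finset.sum_mul_sum, Finset.sum_mul_sum, ← Finset.sum_add_distrib,
          Finset.mul_sum]
        refine Finset.sum_congr rfl fun l _ => ?_
        rw [← Finset.sum_add_distrib, Finset.mul_sum]
        refine Finset.sum_congr rfl fun r _ => ?_
        rw [hnode, smul_eq_mul]; ring
      rw [e1, norm_smul, Real.norm_eq_abs, Real.abs_exp, Real.norm_of_nonneg (by positivity)]
      have h2 : f * m ≤ f := mul_le_of_le_one_right hf0 (sum_treeWeight_le_one N ht.le)
      calc Real.exp t * (A * (f * m + m * f)) ≤ Real.exp t * (A * (2 * f)) := by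
            gcongr; linarith
        _ ≤ Real.exp t * (A * (2 * Real.exp (-t * (1 - 2 * A)))) := by
            gcongr; exact ih ht.le
        _ = (Real.exp t * Real.exp (-t * (1 - 2 * A))) * (2 * A) := by ring
        _ = Real.exp (2 * A * t) * (2 * A) := by
            rw [← Real.exp_add]; congr 2; ring

lemma summable_treeWeight {t : ℝ} (ht : 0 ≤ t) : Summable (treeWeight t) := by
  refine summable_of_sum_le (treeWeight_nonneg ht) (c := 1) fun s => ?_
  obtain ⟨N, hN⟩ := (tendsto_treesBelow.eventually_ge_atTop s).exists
  exact (Finset.sum_le_sum_of_subset_of_nonneg hN fun g _ _ => treeWeight_nonneg ht g).trans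
    (sum_treeWeight_le_one N ht)

lemma summable_treeWeight_mul {e : McKeanTree → ℝ} {A : ℝ} (hA : 0 ≤ A) (he : ∀ g, 0 ≤ e g)
    (hleaf : e .leaf = 1) (hnode : ∀ l r, e (.node l r) = A * (e l + e r)) {t : ℝ}
    (ht : 0 ≤ t) : Summable fun g => treeWeight t g * e g := by
  refine summable_of_sum_le (fun g => mul_nonneg (treeWeight_nonneg ht g) (he g))
    (c := Real.exp (-t * (1 - 2 * A))) fun s => ?_
  obtain ⟨N, hN⟩ := (tendsto_treesBelow.eventually_ge_atTop s).exists
  exact (Finset.sum_le_sum_of_subset_of_nonneg hN fun g _ _ =>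
    mul_nonneg (treeWeight_nonneg ht g) (he g)).trans
    (sum_treeWeight_mul_le hA he hleaf hnode N ht)

lemma tsum_treeWeight_mul_le {e : McKeanTree → ℝ} {A : ℝ} (hA : 0 ≤ A) (he : ∀ g, 0 ≤ e g)
    (hleaf : e .leaf = 1) (hnode : ∀ l r, e (.node l r) = A * (e l + e r)) {t : ℝ}
    (ht : 0 ≤ t) : ∑' g, treeWeight t g * e g ≤ Real.exp (-t * (1 - 2 * A)) :=
  le_of_tendsto ((summable_treeWeight_mul hA he hleaf hnode ht).hasSum.comp tendsto_treesBelow)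
    (Eventually.of_forall fun N => sum_treeWeight_mul_le hA he hleaf hnode N ht)

/-! ### The Wild representation of the solution -/

lemma continuous_cCoef {p : ℝ} (hp : 0 ≤ p) : Continuous (cCoef p) :=
  Real.continuous_cos.mul (Real.continuous_cos.abs.rpow_const fun _ => Or.inr hp)

lemma continuous_sCoef {p : ℝ} (hp : 0 ≤ p) : Continuous (sCoef p) :=
  Real.continuous_sin.mul (Real.continuous_sin.abs.rpow_const fun _ => Or.inr hp)

/-- The collision operator of the Kac equation, in Fourier variables. -/
def collision (p : ℝ) (f : ℝ → ℂ) (g : ℝ → ℂ) (ξ : ℝ) : ℂ :=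
  1 / (2 * (Real.pi : ℂ)) * ∫ θ in (0 : ℝ)..(2 * Real.pi), f (ξ * sCoef p θ) * g (ξ * cCoef p θ)

lemma norm_collision_sub_le {p : ℝ} (hp : 0 ≤ p) {f g : ℝ → ℂ} (hf : Continuous f)
    (hg : Continuous g) (hf1 : ∀ ξ, ‖f ξ‖ ≤ 1) (hg1 : ∀ ξ, ‖g ξ‖ ≤ 1) {B : ℝ}
    (hB : ∀ ξ, ‖f ξ - g ξ‖ ≤ B) (ξ : ℝ) : ‖collision p f f ξ - collision p g g ξ‖ ≤ 2 * B := by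
  have hc := continuous_cCoef hp
  have hs := continuous_sCoef hp
  have hpi := Real.pi_pos
  rw [collision, collision, ← mul_sub, ← intervalIntegral.integral_sub
    (Continuous.intervalIntegrable (by fun_prop) _ _)
    (Continuous.intervalIntegrable (by fun_prop) _ _), norm_mul, norm_one_div_two_pi]
  have h1 := intervalIntegral.norm_integral_le_of_norm_le_const (a := 0) (b := 2 * Real.pi)
    (f := fun θ => f (ξ * sCoef p θ) * f (ξ * cCoef p θ) - g (ξ * sCoef p θ) * g (ξ * cCoef p θ))
    (C := 2 * B) fun θ _ => by
      set a := ξ * sCoef p θ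
      set b := ξ * cCoef p θ
      have e : f a * f b - g a * g b = (f a - g a) * f b + g a * (f b - g b) := by ring
      rw [e]
      refine (norm_add_le _ _).trans ?_
      rw [norm_mul, norm_mul]
      have h1 := mul_le_mul (hB a) (hf1 b) (norm_nonneg _) ((norm_nonneg _).trans (hB a))
      have h2 := mul_le_mul (hg1 a) (hB b) (norm_nonneg _) zero_le_one
      linarith
  rw [sub_zero, abs_of_pos (by positivity)] at h1
  calc _ ≤ 1 / (2 * Real.pi) * (2 * B * (2 * Real.pi)) := by gcongr
    _ = _ := by field_simp

lemma collision_sum {p : ℝ} (hp : 0 ≤ p) {c : McKeanTree → ℝ → ℂ} (hc : ∀ g, Continuous (c g))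
    (s : Finset McKeanTree) (q : McKeanTree → ℝ) (ξ : ℝ) :
    collision p (fun ξ => ∑ g ∈ s, q g • c g ξ) (fun ξ => ∑ g ∈ s, q g • c g ξ) ξ
      = ∑ l ∈ s, ∑ r ∈ s, (q l * q r) • collision p (c r) (c l) ξ := by
  have hcc := continuous_cCoef hp
  have hs := continuous_sCoef hp
  have e : ∀ θ, (∑ g ∈ s, q g • c g (ξ * sCoef p θ)) * (∑ g ∈ s, q g • c g (ξ * cCoef p θ))
      = ∑ l ∈ s, ∑ r ∈ s, (q l * q r) • (c r (ξ * sCoef p θ) * c l (ξ * cCoef p θ)) := by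
    intro θ
    rw [Finset.sum_mul_sum, Finset.sum_comm]
    refine Finset.sum_congr rfl fun l _ => Finset.sum_congr rfl fun r _ => ?_
    simp only [Complex.real_smul]; push_cast; ring
  have hci : ∀ l r, IntervalIntegrable (fun θ => (q l * q r) •
      (c r (ξ * sCoef p θ) * c l (ξ * cCoef p θ))) volume 0 (2 * Real.pi) := fun l r => by
    have := hc l
    have := hc r
    exact Continuous.intervalIntegrable (by fun_prop) _ _
  simp only [collision]
  simp_rw [e]
  rw [intervalIntegral.integral_finsetSum fun l _ => by
    have := fun r => hc r
    exact Continuous.intervalIntegrable (by fun_prop) _ _, Finset.mul_sum]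
  refine Finset.sum_congr rfl fun l _ => ?_
  rw [intervalIntegral.integral_finsetSum fun r _ => hci l r, Finset.mul_sum]
  refine Finset.sum_congr rfl fun r _ => ?_
  rw [intervalIntegral.integral_smul, mul_smul_comm]

/-- The truncated Wild sums converge to every solution of the Kac equation. -/
theorem IsKacSolution.tendsto_wild {p : ℝ} (hp : 0 ≤ p) {μ₀ : Measure ℝ}
    {μ : ℝ → Measure ℝ} (hμ : IsKacSolution p μ₀ μ) {c : McKeanTree → ℝ → ℂ}
    (hc : ∀ g, Continuous (c g)) (hc1 : ∀ g ξ, ‖c g ξ‖ ≤ 1) (hleaf : c .leaf = charFun μ₀)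
    (hnode : ∀ l r, c (.node l r) = collision p (c r) (c l)) {t : ℝ} (ht : 0 ≤ t) (ξ : ℝ) :
    Tendsto (fun N => ∑ g ∈ treesBelow N, treeWeight t g • c g ξ) atTop
      (𝓝 (charFun (μ t) ξ)) := by
  set φ : ℕ → ℝ → ℝ → ℂ := fun N t ξ => ∑ g ∈ treesBelow N, treeWeight t g • c g ξ with hφ
  have hφc : ∀ N t, Continuous (φ N t) := fun N t => by
    simp only [hφ]; fun_prop
  have hφ1 : ∀ N t, 0 ≤ t → ∀ ξ, ‖φ N t ξ‖ ≤ 1 := fun N t ht ξ => by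
    refine (norm_sum_le _ _).trans ((Finset.sum_le_sum fun g _ => ?_).trans
      (sum_treeWeight_le_one N ht))
    rw [norm_smul, Real.norm_of_nonneg (treeWeight_nonneg ht g)]
    exact mul_le_of_le_one_right (treeWeight_nonneg ht g) (hc1 g ξ)
  -- The usual Picard estimate: the factor `e^t` absorbs the loss term, and the collision operator
  -- is 2-Lipschitz on functions bounded by `1`, so each step integrates twice the previous error.
  -- The factor `e^t` on the right is carried along by monotonicity.
  have key : ∀ N t, 0 ≤ t → ∀ ξ, ‖Real.exp t • (charFun (μ t) ξ - φ N t ξ)‖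
      ≤ (2 * t) ^ N / (N.factorial : ℝ) * Real.exp t := by
    intro N
    induction N with
    | zero =>
      intro t ht ξ
      have := hμ.isProb t ht
      rw [norm_smul, Real.norm_eq_abs, Real.abs_exp]
      simpa [hφ, treesBelow] using mul_le_of_le_one_right (Real.exp_pos t).le
        (norm_charFun_le_one (μ := μ t) ξ)
    | succ N ih =>
      intro t ht ξ
      have hB : ∀ s : ℝ, HasDerivAt (fun s => (2 * s) ^ (N + 1) / ((N + 1).factorial : ℝ) *
          Real.exp s) (2 * ((2 * s) ^ N / (N.factorial : ℝ)) * Real.exp s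
            + (2 * s) ^ (N + 1) / ((N + 1).factorial : ℝ) * Real.exp s) s := by
        intro s
        have h1 : HasDerivAt (fun s : ℝ => 2 * s) 2 s := by
          simpa using (hasDerivAt_id s).const_mul 2
        refine ((((h1.pow (N + 1)).div_const _).mul (Real.hasDerivAt_exp s))).congr_deriv ?_
        have : (N.factorial : ℝ) ≠ 0 := by positivity
        rw [Nat.factorial_succ]
        push_cast
        simp only [Pi.pow_apply]
        field_simp
      have hderiv : ∀ s, 0 < s → HasDerivAt (fun s => Real.exp s • (charFun (μ s) ξ - φ (N + 1) s ξ))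
          (Real.exp s • (collision p (charFun (μ s)) (charFun (μ s)) ξ
            - collision p (φ N s) (φ N s) ξ)) s := by
        intro s hs
        have h1 := (Real.hasDerivAt_exp s).smul (hμ.equation ξ s hs)
        have h2 := hasDerivAt_exp_smul_sum_treesBelow (fun g => c g ξ) N s
        have h3 := h1.sub h2
        have e1 : collision p (φ N s) (φ N s) ξ = ∑ l ∈ treesBelow N, ∑ r ∈ treesBelow N,
            (treeWeight s l * treeWeight s r) • c (.node l r) ξ := by
          rw [collision_sum hp hc]; simp_rw [hnode]
        rw [e1]
        refine (h3.congr_deriv ?_).congr_of_eventuallyEq (Eventually.of_forall fun s => ?_)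
        · rw [smul_sub _ (collision p _ _ _), collision, smul_sub]; simp only [Complex.real_smul]; ring
        · simp only [hφ, smul_sub, Pi.sub_apply, Pi.smul_apply']
      refine norm_le_of_norm_hasDerivAt_le ?_ hderiv hB ?_ ?_ ht
      · refine Real.continuous_exp.continuousWithinAt.smul ((hμ.continuous_zero ξ).sub ?_)
        have h2 := (hasDerivAt_exp_smul_sum_treesBelow (fun g => c g ξ) N 0).continuousAt
        have h3 := (Real.continuous_exp.continuousAt.comp continuous_neg.continuousAt).smul h2
        refine (h3.congr (Eventually.of_forall fun s => ?_)).continuousWithinAt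
        simp only [hφ, Function.comp, Pi.smul_apply', smul_smul _ (Real.exp s), ← Real.exp_add,
          neg_add_cancel, Real.exp_zero, one_smul]
      · have : φ (N + 1) 0 ξ = charFun μ₀ ξ := by
          simp only [hφ]; rw [sum_treeWeight_zero_smul, hleaf]
        simp [this, hμ.initial]
      · intro s hs
        have := hμ.isProb s hs.le
        rw [norm_smul, Real.norm_eq_abs, Real.abs_exp]
        have h1 := norm_collision_sub_le hp continuous_charFun (hφc N s)
          (fun ξ => norm_charFun_le_one (μ := μ s) ξ) (hφ1 N s hs.le)
          (B := (2 * s) ^ N / (N.factorial : ℝ)) (fun ξ => by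
            have := ih s hs.le ξ
            rw [norm_smul, Real.norm_eq_abs, Real.abs_exp, mul_comm] at this
            exact le_of_mul_le_mul_right this (Real.exp_pos s)) ξ
        have h2 : 0 ≤ (2 * s) ^ (N + 1) / ((N + 1).factorial : ℝ) * Real.exp s := by positivity
        calc _ ≤ Real.exp s * (2 * ((2 * s) ^ N / (N.factorial : ℝ))) := by gcongr
          _ ≤ _ := by linarith
  rw [← tendsto_sub_nhds_zero_iff, tendsto_zero_iff_norm_tendsto_zero]
  refine squeeze_zero (fun _ => norm_nonneg _) (fun N => ?_)
    (FloorSemiring.tendsto_pow_div_factorial_atTop (2 * t))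
  have := key N t ht ξ
  rw [norm_smul, Real.norm_eq_abs, Real.abs_exp, mul_comm] at this
  rw [norm_sub_rev]
  exact le_of_mul_le_mul_right this (Real.exp_pos t)

lemma isKacSolution_dirac (p : ℝ) :
    IsKacSolution p (Measure.dirac 0) (fun _ => Measure.dirac 0) where
  isProb _ _ := inferInstance
  initial := rfl
  continuous_zero _ := continuousWithinAt_const
  equation ξ t _ := by
    have hpi : (Real.pi : ℂ) ≠ 0 := by exact_mod_cast Real.pi_ne_zero
    refine (hasDerivAt_const t _).congr_deriv ?_
    simp only [charFun_dirac, inner_zero_left, Complex.ofReal_zero, zero_mul, Complex.exp_zero,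
      mul_one, intervalIntegral.integral_const, sub_zero, Complex.real_smul]
    push_cast
    field_simp
    ring

lemma collision_one (p : ℝ) : collision p (fun _ => 1) (fun _ => 1) = fun _ => 1 := by
  have hpi : (Real.pi : ℂ) ≠ 0 := by exact_mod_cast Real.pi_ne_zero
  ext ξ
  simp only [collision, mul_one, intervalIntegral.integral_const, sub_zero, Complex.real_smul]
  push_cast
  field_simp

/-- The total mass is read off from the Wild series of the stationary solution `δ₀`: all its
coefficients are `1`, and it converges to the characteristic function `1`. -/
lemma hasSum_treeWeight {t : ℝ} (ht : 0 ≤ t) : HasSum (treeWeight t) 1 := by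
  have h1 := (isKacSolution_dirac 0).tendsto_wild le_rfl (c := fun _ _ => 1)
    (fun _ => continuous_const) (fun _ _ => by simp) (by ext ξ; simp) (fun _ _ => (collision_one 0).symm)
    ht 0
  have h2 := (Complex.continuous_re.tendsto _).comp h1
  simp only [charFun_dirac, inner_zero_left, Complex.ofReal_zero, zero_mul, Complex.exp_zero,
    Complex.one_re] at h2
  have h3 := (summable_treeWeight ht).hasSum
  have h4 := tendsto_nhds_unique (h3.comp tendsto_treesBelow) (h2.congr fun N => by simp)
  rwa [h4] at h3

/-! ### Splicing sequences of independent variables -/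

/-- The first `n` terms of `a`, followed by the terms of `b`. -/
def appendSeq (n : ℕ) (a b : ℕ → ℝ) (k : ℕ) : ℝ := if k < n then a k else b (k - n)

lemma appendSeq_add (n : ℕ) (a b : ℕ → ℝ) (k : ℕ) : appendSeq n a b (k + n) = b k := by
  simp [appendSeq]

lemma appendSeq_of_lt {n k : ℕ} (h : k < n) (a b : ℕ → ℝ) : appendSeq n a b k = a k := by
  simp [appendSeq, h]

lemma measurable_appendSeq (n : ℕ) :
    Measurable fun z : (ℕ → ℝ) × (ℕ → ℝ) => appendSeq n z.1 z.2 := by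
  refine measurable_pi_lambda _ fun k => ?_
  by_cases h : k < n <;> simp only [appendSeq, h, if_true, if_false] <;> fun_prop

lemma map_appendSeq (P : Measure ℝ) [IsProbabilityMeasure P] (n : ℕ) :
    ((Measure.infinitePi fun _ : ℕ => P).prod (Measure.infinitePi fun _ : ℕ => P)).map
      (fun z => appendSeq n z.1 z.2) = Measure.infinitePi fun _ : ℕ => P := by
  classical
  refine Measure.eq_infinitePi _ fun s t ht => ?_
  rw [Measure.map_apply (measurable_appendSeq n)
    (MeasurableSet.pi s.countable_toSet fun i _ => ht i)]
  have e1 : (fun z : (ℕ → ℝ) × (ℕ → ℝ) => appendSeq n z.1 z.2) ⁻¹' Set.pi s t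
      = Set.pi (s.filter (· < n) : Finset ℕ) t ×ˢ
        Set.pi ((s.filter (¬ · < n)).image (· - n) : Finset ℕ) (fun j => t (j + n)) := by
    ext z
    simp only [Set.mem_preimage, Set.mem_pi, Set.mem_prod, Finset.mem_coe, Finset.mem_filter,
      Finset.mem_image]
    constructor
    · intro h
      refine ⟨fun i hi => ?_, ?_⟩
      · simpa [appendSeq, hi.2] using h i hi.1
      · rintro j ⟨i, hi, rfl⟩
        have := h i hi.1
        rw [Nat.sub_add_cancel (not_lt.1 hi.2)]
        simpa [appendSeq, hi.2] using this
    · rintro ⟨h1, h2⟩ i hi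
      by_cases hin : i < n
      · simpa [appendSeq, hin] using h1 i ⟨hi, hin⟩
      · have := h2 (i - n) ⟨i, ⟨hi, hin⟩, rfl⟩
        rw [Nat.sub_add_cancel (not_lt.1 hin)] at this
        simpa [appendSeq, hin] using this
  rw [e1, Measure.prod_prod, Measure.infinitePi_pi _ fun i _ => ht i,
    Measure.infinitePi_pi _ fun i _ => ht _, Finset.prod_image,
    ← Finset.prod_filter_mul_prod_filter_not s (· < n)]
  · congr 1
    refine Finset.prod_congr rfl fun i hi => ?_
    rw [Nat.sub_add_cancel (not_lt.1 (Finset.mem_filter.1 hi).2)]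
  · intro i hi j hj h
    have hi := (Finset.mem_filter.1 (Finset.mem_coe.1 hi)).2
    have hj := (Finset.mem_filter.1 (Finset.mem_coe.1 hj)).2
    simp only at h
    omega

/-- The sequence `x, a 0, …, a (n - 1), b 0, b 1, …`. -/
def spliceSeq (n : ℕ) (z : ℝ × (ℕ → ℝ) × (ℕ → ℝ)) : ℕ → ℝ :=
  appendSeq 1 (fun _ => z.1) (appendSeq n z.2.1 z.2.2)

lemma measurable_spliceSeq (n : ℕ) : Measurable (spliceSeq n) :=
  (measurable_appendSeq 1).comp ((measurable_pi_lambda _ fun _ => measurable_fst).prodMk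
    ((measurable_appendSeq n).comp measurable_snd))

/-- With `n` the number of nodes of the left subtree, this matches the preorder numbering: the root
angle and the angles of the two subtrees can be taken as three independent objects. -/
lemma map_spliceSeq (P : Measure ℝ) [IsProbabilityMeasure P] (n : ℕ) :
    (P.prod ((Measure.infinitePi fun _ : ℕ => P).prod (Measure.infinitePi fun _ : ℕ => P))).map
      (spliceSeq n) = Measure.infinitePi fun _ : ℕ => P := by
  set Q := Measure.infinitePi fun _ : ℕ => P
  have h0 : Q.map (fun a => a 0) = P := Measure.infinitePi_map_eval (fun _ : ℕ => P) 0
  have h1 : (Q.prod (Q.prod Q)).map (Prod.map (fun a : ℕ → ℝ => a 0) id) = P.prod (Q.prod Q) := by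
    rw [← Measure.map_prod_map _ _ (by fun_prop) measurable_id, h0, Measure.map_id]
  have h2 : (Q.prod (Q.prod Q)).map (Prod.map id fun z : (ℕ → ℝ) × (ℕ → ℝ) => appendSeq n z.1 z.2)
      = Q.prod Q := by
    rw [← Measure.map_prod_map _ _ measurable_id (measurable_appendSeq n), map_appendSeq,
      Measure.map_id]
  rw [← h1, Measure.map_map (measurable_spliceSeq n) (by fun_prop)]
  have h3 : (Q.prod Q).map (fun z => appendSeq 1 z.1 z.2) = Q := map_appendSeq P 1
  conv_rhs => rw [← h3, ← h2]
  rw [Measure.map_map (measurable_appendSeq 1) (measurable_id.prodMap (measurable_appendSeq n))]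
  congr 1
  ext z k
  simp only [Function.comp, spliceSeq, Prod.map, id, appendSeq]
  by_cases hk : k < 1
  · obtain rfl : k = 0 := by omega
    simp
  · simp [hk]

/-! ### The coefficients of the leaves -/

/-- Needed because, after the root entry, a spliced sequence agrees with the angles of the left
subtree only for its first `l.nodes` terms. -/
lemma betas_congr (p : ℝ) (g : McKeanTree) {θ θ' : ℕ → ℝ} (h : ∀ k < g.nodes, θ k = θ' k) :
    g.betas p θ = g.betas p θ' := by
  induction g generalizing θ θ' with
  | leaf => rfl
  | node l r hl hr =>
    simp only [McKeanTree.nodes] at h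
    simp only [McKeanTree.betas]
    rw [h 0 (by omega), hl (fun k hk => h (k + 1) (by omega)),
      hr (fun k hk => h (k + 1 + l.nodes) (by omega))]

lemma betas_node_spliceSeq (p : ℝ) (l r : McKeanTree) (z : ℝ × (ℕ → ℝ) × (ℕ → ℝ)) :
    (McKeanTree.node l r).betas p (spliceSeq l.nodes z)
      = (l.betas p z.2.1).map (fun b => cCoef p z.1 * b) ++
        (r.betas p z.2.2).map (fun b => sCoef p z.1 * b) := by
  have h0 : spliceSeq l.nodes z 0 = z.1 := by simp [spliceSeq, appendSeq]
  have h1 : ∀ k, spliceSeq l.nodes z (k + 1) = appendSeq l.nodes z.2.1 z.2.2 k := fun k => by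
    simp only [spliceSeq, appendSeq_add]
  have h2 : ∀ k, spliceSeq l.nodes z (k + 1 + l.nodes) = z.2.2 k := fun k => by
    rw [add_right_comm, h1, appendSeq_add]
  simp only [McKeanTree.betas, h0, h2]
  rw [betas_congr p l (θ' := z.2.1) fun k hk => by rw [h1, appendSeq_of_lt hk]]

lemma length_betas (p : ℝ) (g : McKeanTree) (θ : ℕ → ℝ) : (g.betas p θ).length = g.leaves := by
  induction g generalizing θ with
  | leaf => rfl
  | node l r hl hr => simp [McKeanTree.betas, McKeanTree.leaves, hl, hr]

lemma measurable_cCoef (p : ℝ) : Measurable (cCoef p) :=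
  Real.measurable_cos.mul (Real.measurable_cos.abs.pow_const p)

lemma measurable_sCoef (p : ℝ) : Measurable (sCoef p) :=
  Real.measurable_sin.mul (Real.measurable_sin.abs.pow_const p)

/-- The coefficients are measurable functions of the angles. -/
lemma exists_measurable_betas (p : ℝ) (g : McKeanTree) :
    ∃ fs : List ((ℕ → ℝ) → ℝ), (∀ f ∈ fs, Measurable f) ∧
      ∀ θ, g.betas p θ = fs.map fun f => f θ := by
  induction g with
  | leaf => exact ⟨[fun _ => 1], by simp, fun θ => rfl⟩
  | node l r hl hr =>
    obtain ⟨fl, hfl, el⟩ := hl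
    obtain ⟨fr, hfr, er⟩ := hr
    refine ⟨fl.map (fun f θ => cCoef p (θ 0) * f fun k => θ (k + 1)) ++
      fr.map (fun f θ => sCoef p (θ 0) * f fun k => θ (k + 1 + l.nodes)), ?_, fun θ => ?_⟩
    · intro f hf
      have hc := measurable_cCoef p
      have hs := measurable_sCoef p
      rcases List.mem_append.1 hf with h | h
      · obtain ⟨f, hf', rfl⟩ := List.mem_map.1 h
        exact (hc.comp (measurable_pi_apply 0)).mul ((hfl f hf').comp (by fun_prop))
      · obtain ⟨f, hf', rfl⟩ := List.mem_map.1 h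
        exact (hs.comp (measurable_pi_apply 0)).mul ((hfr f hf').comp (by fun_prop))
    · simp [McKeanTree.betas, el, er, Function.comp_def]

lemma measurable_prod_map_betas {M : Type*} [MeasurableSpace M] [CommMonoid M] [MeasurableMul₂ M]
    (p : ℝ) (g : McKeanTree) {f : ℝ → M} (hf : Measurable f) :
    Measurable fun θ => ((g.betas p θ).map f).prod := by
  obtain ⟨fs, hfs, e⟩ := exists_measurable_betas p g
  have h : (fun θ => ((g.betas p θ).map f).prod)
      = fun θ => ((fs.map fun F θ => f (F θ)).map fun F => F θ).prod := by
    ext θ; simp [e, Function.comp_def]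
  rw [h]
  refine List.measurable_fun_prod _ fun F hF => ?_
  obtain ⟨F, hF', rfl⟩ := List.mem_map.1 hF
  exact hf.comp (hfs F hF')

lemma measurable_sum_map_betas (p : ℝ) (g : McKeanTree) {f : ℝ → ℝ} (hf : Measurable f) :
    Measurable fun θ => ((g.betas p θ).map f).sum := by
  obtain ⟨fs, hfs, e⟩ := exists_measurable_betas p g
  have h : (fun θ => ((g.betas p θ).map f).sum)
      = fun θ => ((fs.map fun F θ => f (F θ)).map fun F => F θ).sum := by
    ext θ; simp [e, Function.comp_def]
  rw [h]
  refine List.measurable_fun_sum _ fun F hF => ?_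
  obtain ⟨F, hF', rfl⟩ := List.mem_map.1 hF
  exact hf.comp (hfs F hF')

lemma measurable_maxBeta (p : ℝ) (g : McKeanTree) : Measurable (maxBeta p g) := by
  obtain ⟨fs, hfs, e⟩ := exists_measurable_betas p g
  have h : maxBeta p g = fun θ => ((fs.map fun F => F θ).map fun b => |b|).foldr max 0 := by
    ext θ; simp [maxBeta, e]
  rw [h]
  clear e h
  induction fs with
  | nil => simp
  | cons F fs ih =>
    simp only [List.map_cons, List.foldr_cons]
    exact (hfs F (by simp)).abs.max (ih fun f hf => hfs f (List.mem_cons_of_mem _ hf))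

lemma measurable_getD_betas (p : ℝ) (g : McKeanTree) (j : ℕ) :
    Measurable fun θ => (g.betas p θ).getD j 0 := by
  obtain ⟨fs, hfs, e⟩ := exists_measurable_betas p g
  by_cases hj : j < fs.length
  · have h : (fun θ => (g.betas p θ).getD j 0) = fs[j] := by
      ext θ; simp [e, hj]
    rw [h]
    exact hfs _ (List.getElem_mem hj)
  · have h : (fun θ => (g.betas p θ).getD j 0) = fun _ => 0 := by
      ext θ; simp [e, not_lt.1 hj]
    rw [h]
    exact measurable_const

lemma abs_cCoef_le_one {p : ℝ} (hp : 0 ≤ p) (θ : ℝ) : |cCoef p θ| ≤ 1 := by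
  have h := Real.abs_cos_le_one θ
  rw [cCoef, abs_mul, abs_of_nonneg (Real.rpow_nonneg (abs_nonneg _) _)]
  exact mul_le_one₀ h (by positivity) (Real.rpow_le_one (abs_nonneg _) h hp)

lemma abs_sCoef_le_one {p : ℝ} (hp : 0 ≤ p) (θ : ℝ) : |sCoef p θ| ≤ 1 := by
  have h := Real.abs_sin_le_one θ
  rw [sCoef, abs_mul, abs_of_nonneg (Real.rpow_nonneg (abs_nonneg _) _)]
  exact mul_le_one₀ h (by positivity) (Real.rpow_le_one (abs_nonneg _) h hp)

lemma abs_le_one_of_mem_betas {p : ℝ} (hp : 0 ≤ p) (g : McKeanTree) (θ : ℕ → ℝ) :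
    ∀ b ∈ g.betas p θ, |b| ≤ 1 := by
  induction g generalizing θ with
  | leaf => simp [McKeanTree.betas]
  | node l r hl hr =>
    intro b hb
    simp only [McKeanTree.betas, List.mem_append, List.mem_map] at hb
    rcases hb with ⟨a, ha, rfl⟩ | ⟨a, ha, rfl⟩
    · rw [abs_mul]
      exact mul_le_one₀ (abs_cCoef_le_one hp _) (abs_nonneg _) (hl _ a ha)
    · rw [abs_mul]
      exact mul_le_one₀ (abs_sCoef_le_one hp _) (abs_nonneg _) (hr _ a ha)

lemma abs_le_maxBeta (p : ℝ) (g : McKeanTree) (θ : ℕ → ℝ) :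
    ∀ b ∈ g.betas p θ, |b| ≤ maxBeta p g θ := by
  rw [maxBeta]
  induction g.betas p θ with
  | nil => simp
  | cons a L ih =>
    intro b hb
    simp only [List.map_cons, List.foldr_cons]
    rcases List.mem_cons.1 hb with rfl | hb
    · exact le_max_left _ _
    · exact (ih b hb).trans (le_max_right _ _)

lemma maxBeta_nonneg (p : ℝ) (g : McKeanTree) (θ : ℕ → ℝ) : 0 ≤ maxBeta p g θ := by
  rw [maxBeta]
  induction g.betas p θ with
  | nil => simp
  | cons a L ih => exact (abs_nonneg a).trans (le_max_left _ _)

lemma maxBeta_eq_zero_or (p : ℝ) (g : McKeanTree) (θ : ℕ → ℝ) :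
    maxBeta p g θ = 0 ∨ ∃ b ∈ g.betas p θ, maxBeta p g θ = |b| := by
  rw [maxBeta]
  induction g.betas p θ with
  | nil => simp
  | cons a L ih =>
    simp only [List.map_cons, List.foldr_cons]
    rcases le_total |a| ((L.map fun b => |b|).foldr max 0) with h | h
    · rw [max_eq_right h]
      exact ih.imp_right fun ⟨b, hb, e⟩ => ⟨b, List.mem_cons_of_mem _ hb, e⟩
    · rw [max_eq_left h]
      exact Or.inr ⟨a, by simp, rfl⟩

lemma maxBeta_le_one {p : ℝ} (hp : 0 ≤ p) (g : McKeanTree) (θ : ℕ → ℝ) : maxBeta p g θ ≤ 1 := by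
  rcases maxBeta_eq_zero_or p g θ with h | ⟨b, hb, h⟩ <;> rw [h]
  · exact zero_le_one
  · exact abs_le_one_of_mem_betas hp g θ b hb

/-- The sum `∑ |β_j| ^ m`. -/
def powerSum (m : ℝ) (L : List ℝ) : ℝ := (L.map fun b => |b| ^ m).sum

lemma powerSum_nonneg (m : ℝ) (L : List ℝ) : 0 ≤ powerSum m L := by
  refine List.sum_nonneg fun x hx => ?_
  obtain ⟨b, -, rfl⟩ := List.mem_map.1 hx
  positivity

lemma powerSum_append (m : ℝ) (L L' : List ℝ) :
    powerSum m (L ++ L') = powerSum m L + powerSum m L' := by simp [powerSum]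

lemma powerSum_map_mul (m k : ℝ) (L : List ℝ) :
    powerSum m (L.map fun b => k * b) = |k| ^ m * powerSum m L := by
  simp only [powerSum, List.map_map, Function.comp_def, abs_mul,
    Real.mul_rpow (abs_nonneg k) (abs_nonneg _), List.sum_map_mul_left]

lemma powerSum_le_length {m : ℝ} (hm : 0 ≤ m) {L : List ℝ} (hL : ∀ b ∈ L, |b| ≤ 1) :
    powerSum m L ≤ L.length := by
  have h := List.sum_le_card_nsmul (L.map fun b => |b| ^ m) 1 fun x hx => by
    obtain ⟨b, hb, rfl⟩ := List.mem_map.1 hx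
    exact Real.rpow_le_one (abs_nonneg _) (hL b hb) hm
  simpa [powerSum] using h

lemma rpow_le_powerSum (m : ℝ) {L : List ℝ} {b : ℝ} (hb : b ∈ L) : |b| ^ m ≤ powerSum m L := by
  refine List.single_le_sum (fun x hx => ?_) _ (List.mem_map.2 ⟨b, hb, rfl⟩)
  obtain ⟨b, -, rfl⟩ := List.mem_map.1 hx
  positivity

lemma abs_cCoef_rpow {p : ℝ} (hp : 0 < p) (θ m : ℝ) :
    |cCoef p θ| ^ m = |Real.cos θ| ^ (m * (1 + p)) := by
  have h : |cCoef p θ| = |Real.cos θ| ^ (1 + p) := by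
    rw [cCoef, abs_mul, abs_of_nonneg (Real.rpow_nonneg (abs_nonneg _) _),
      Real.rpow_add_of_nonneg (abs_nonneg _) zero_le_one hp.le, Real.rpow_one]
  rw [h, ← Real.rpow_mul (abs_nonneg _), mul_comm]

lemma abs_sCoef_rpow {p : ℝ} (hp : 0 < p) (θ m : ℝ) :
    |sCoef p θ| ^ m = |Real.sin θ| ^ (m * (1 + p)) := by
  have h : |sCoef p θ| = |Real.sin θ| ^ (1 + p) := by
    rw [sCoef, abs_mul, abs_of_nonneg (Real.rpow_nonneg (abs_nonneg _) _),
      Real.rpow_add_of_nonneg (abs_nonneg _) zero_le_one hp.le, Real.rpow_one]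
  rw [h, ← Real.rpow_mul (abs_nonneg _), mul_comm]

/-- At each node `|c| ^ α + |s| ^ α = cos² + sin² = 1`: this conservation law is why the stable law
of index `α` is the limit. -/
lemma powerSum_betas_eq_one {p α : ℝ} (hp : 0 < p) (hα : α * (1 + p) = 2) (g : McKeanTree)
    (θ : ℕ → ℝ) : powerSum α (g.betas p θ) = 1 := by
  induction g generalizing θ with
  | leaf => simp [powerSum, McKeanTree.betas]
  | node l r hl hr =>
    rw [McKeanTree.betas, powerSum_append, powerSum_map_mul, powerSum_map_mul, hl, hr,
      abs_cCoef_rpow hp, abs_sCoef_rpow hp, hα, mul_one, mul_one, Real.rpow_two, Real.rpow_two,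
      sq_abs, sq_abs, add_comm, Real.sin_sq_add_cos_sq]

/-- Not all weights vanish, since a power sum equals `1`. The frequency cutoff will be `d̃` divided
by this maximum. -/
lemma maxBeta_pos {p : ℝ} (hp : 0 < p) (g : McKeanTree) (θ : ℕ → ℝ) : 0 < maxBeta p g θ := by
  have hα : 2 / (1 + p) * (1 + p) = 2 := by field_simp
  have h1 := powerSum_betas_eq_one hp hα g θ
  refine (maxBeta_nonneg p g θ).lt_of_ne fun h0 => ?_
  have hb : ∀ b ∈ g.betas p θ, |b| ^ (2 / (1 + p)) = 0 := fun b hb => by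
    have := abs_le_maxBeta p g θ b hb
    rw [← h0] at this
    rw [le_antisymm this (abs_nonneg b), Real.zero_rpow (by positivity)]
  have : powerSum (2 / (1 + p)) (g.betas p θ) = 0 :=
    List.sum_eq_zero fun x hx => by
      obtain ⟨b, hb', rfl⟩ := List.mem_map.1 hx
      exact hb b hb'
  linarith

/-! ### Expectations over the angles -/

/-- The law of the sequence of angles. -/
def anglesLaw : Measure (ℕ → ℝ) := Measure.infinitePi fun _ : ℕ => angleLaw

instance : IsProbabilityMeasure anglesLaw := by unfold anglesLaw; infer_instance

lemma integral_anglesLaw_node {E : Type*} [NormedAddCommGroup E] [NormedSpace ℝ E] (n : ℕ)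
    {F : (ℕ → ℝ) → E} (hF : StronglyMeasurable F) :
    ∫ θ, F θ ∂anglesLaw
      = ∫ z, F (spliceSeq n z) ∂(angleLaw.prod (anglesLaw.prod anglesLaw)) := by
  conv_lhs => rw [anglesLaw, ← map_spliceSeq angleLaw n]
  rw [integral_map (measurable_spliceSeq n).aemeasurable hF.aestronglyMeasurable]
  rfl

lemma integral_angleLaw {E : Type*} [NormedAddCommGroup E] [NormedSpace ℝ E] (f : ℝ → E) :
    ∫ θ, f θ ∂angleLaw = (1 / (2 * Real.pi)) • ∫ θ in (0 : ℝ)..(2 * Real.pi), f θ := by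
  have hpi := Real.pi_pos
  rw [angleLaw, integral_smul_measure, intervalIntegral.integral_of_le (by positivity),
    integral_Ico_eq_integral_Ioc, ENNReal.toReal_ofReal (by positivity)]

lemma integral_abs_sCoef_rpow {p : ℝ} (hp : 0 < p) (m : ℝ) :
    ∫ θ, |sCoef p θ| ^ m ∂angleLaw = bigA (m * (1 + p)) := by
  rw [integral_angleLaw, bigA, smul_eq_mul]
  simp_rw [abs_sCoef_rpow hp]

lemma integral_abs_cCoef_rpow {p : ℝ} (hp : 0 < p) (m : ℝ) :
    ∫ θ, |cCoef p θ| ^ m ∂angleLaw = bigA (m * (1 + p)) := by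
  rw [integral_angleLaw, bigA, smul_eq_mul]
  simp_rw [abs_cCoef_rpow hp]
  congr 1
  -- A shift by `π / 2` over a full period changes sine into cosine.
  have hper : Function.Periodic (fun θ => |Real.sin θ| ^ (m * (1 + p))) (2 * Real.pi) := fun θ => by
    simp only [Real.sin_add_two_pi]
  have h1 := hper.intervalIntegral_add_eq (Real.pi / 2) 0
  rw [zero_add] at h1
  rw [← h1, show Real.pi / 2 + 2 * Real.pi = 2 * Real.pi + Real.pi / 2 by ring]
  have h2 := intervalIntegral.integral_comp_add_right (a := 0) (b := 2 * Real.pi)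
    (fun θ => |Real.sin θ| ^ (m * (1 + p))) (Real.pi / 2)
  rw [zero_add] at h2
  rw [← h2]
  simp only [Real.sin_add_pi_div_two]

lemma bigA_nonneg (m : ℝ) : 0 ≤ bigA m := by
  have hpi := Real.pi_pos
  refine mul_nonneg (by positivity) (intervalIntegral.integral_nonneg (by positivity)
    fun θ _ => by positivity)

/-- The expectation of `∑ |β_j| ^ m` for a given tree. -/
def meanPowerSum (p m : ℝ) (g : McKeanTree) : ℝ := ∫ θ, powerSum m (g.betas p θ) ∂anglesLaw

lemma measurable_powerSum_betas (p m : ℝ) (g : McKeanTree) :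
    Measurable fun θ => powerSum m (g.betas p θ) :=
  measurable_sum_map_betas p g (by fun_prop)

lemma powerSum_betas_le {p m : ℝ} (hp : 0 < p) (hm : 0 ≤ m) (g : McKeanTree) (θ : ℕ → ℝ) :
    powerSum m (g.betas p θ) ≤ g.leaves := by
  rw [← length_betas p g θ]
  exact powerSum_le_length hm (abs_le_one_of_mem_betas hp.le g θ)

lemma integrable_powerSum_betas {p m : ℝ} (hp : 0 < p) (hm : 0 ≤ m) (g : McKeanTree) :
    Integrable (fun θ => powerSum m (g.betas p θ)) anglesLaw := by
  refine Integrable.of_bound (measurable_powerSum_betas p m g).aestronglyMeasurable g.leaves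
    (Eventually.of_forall fun θ => ?_)
  rw [Real.norm_of_nonneg (powerSum_nonneg _ _)]
  exact powerSum_betas_le hp hm g θ

/-- The root angle is independent of both subtrees, and its two moments coincide. This is the
additive recursion that `tsum_treeWeight_mul_le` asks for. -/
lemma meanPowerSum_node {p m : ℝ} (hp : 0 < p) (hm : 0 ≤ m) (l r : McKeanTree) :
    meanPowerSum p m (.node l r)
      = bigA (m * (1 + p)) * (meanPowerSum p m l + meanPowerSum p m r) := by
  rw [meanPowerSum, integral_anglesLaw_node l.nodes
    (measurable_powerSum_betas p m _).stronglyMeasurable]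
  simp only [betas_node_spliceSeq, powerSum_append, powerSum_map_mul]
  have hcI : Integrable (fun θ => |cCoef p θ| ^ m) angleLaw := by
    refine Integrable.of_bound ((measurable_cCoef p).abs.pow_const m).aestronglyMeasurable 1
      (Eventually.of_forall fun θ => ?_)
    rw [Real.norm_of_nonneg (by positivity)]
    exact Real.rpow_le_one (abs_nonneg _) (abs_cCoef_le_one hp.le θ) hm
  have hsI : Integrable (fun θ => |sCoef p θ| ^ m) angleLaw := by
    refine Integrable.of_bound ((measurable_sCoef p).abs.pow_const m).aestronglyMeasurable 1
      (Eventually.of_forall fun θ => ?_)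
    rw [Real.norm_of_nonneg (by positivity)]
    exact Real.rpow_le_one (abs_nonneg _) (abs_sCoef_le_one hp.le θ) hm
  have hl := integrable_powerSum_betas hp hm l
  have hr := integrable_powerSum_betas hp hm r
  rw [integral_add (hcI.mul_prod (hl.comp_fst anglesLaw)) (hsI.mul_prod (hr.comp_snd anglesLaw)),
    integral_prod_mul (fun θ => |cCoef p θ| ^ m) fun z : (ℕ → ℝ) × (ℕ → ℝ) =>
      powerSum m (l.betas p z.1),
    integral_prod_mul (fun θ => |sCoef p θ| ^ m) fun z : (ℕ → ℝ) × (ℕ → ℝ) =>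
      powerSum m (r.betas p z.2),
    integral_abs_cCoef_rpow hp, integral_abs_sCoef_rpow hp,
    integral_fun_fst (fun θ => powerSum m (l.betas p θ)),
    integral_fun_snd (fun θ => powerSum m (r.betas p θ))]
  simp [meanPowerSum]
  ring

lemma meanPowerSum_nonneg (p m : ℝ) (g : McKeanTree) : 0 ≤ meanPowerSum p m g :=
  integral_nonneg fun _ => powerSum_nonneg _ _

lemma meanPowerSum_leaf (p m : ℝ) : meanPowerSum p m .leaf = 1 := by
  simp [meanPowerSum, powerSum, McKeanTree.betas]

/-! ### Weighted sums of independent variables -/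

/-- The weighted sum `∑ β_j x_j`. -/
def weightedSum (L : List ℝ) (x : ℕ → ℝ) : ℝ := ∑ j ∈ Finset.range L.length, L.getD j 0 * x j

lemma measurable_weightedSum (L : List ℝ) : Measurable (weightedSum L) := by
  unfold weightedSum; fun_prop

lemma prod_range_getD {M : Type*} [CommMonoid M] (L : List ℝ) (f : ℝ → M) :
    ∏ j ∈ Finset.range L.length, f (L.getD j 0) = (L.map f).prod := by
  induction L with
  | nil => simp
  | cons a L ih =>
    rw [List.length_cons, Finset.prod_range_succ', List.map_cons, List.prod_cons, ← ih, mul_comm]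
    simp

/-- The law of `∑ β_j X_j` for independent `X_j` with law `μ`. -/
def sumLaw (μ : Measure ℝ) [IsProbabilityMeasure μ] (L : List ℝ) : Measure ℝ :=
  (Measure.infinitePi fun _ : ℕ => μ).map (weightedSum L)

section SumLaw

variable (μ : Measure ℝ) [IsProbabilityMeasure μ]

instance (L : List ℝ) : IsProbabilityMeasure (sumLaw μ L) :=
  Measure.isProbabilityMeasure_map (measurable_weightedSum L).aemeasurable

lemma charFun_sumLaw (L : List ℝ) (ξ : ℝ) :
    charFun (sumLaw μ L) ξ = (L.map fun b => charFun μ (b * ξ)).prod := by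
  have hind : iIndepFun (fun j (x : ℕ → ℝ) => L.getD j 0 * x j)
      (Measure.infinitePi fun _ : ℕ => μ) :=
    iIndepFun_infinitePi (X := fun j y => L.getD j 0 * y) fun j => by fun_prop
  have h := (hind.restrict (Finset.range L.length)).charFun_map_fun_finsetSum_eq_prod
    (fun j _ => ((measurable_pi_apply j).const_mul _).aemeasurable)
  have h1 := congrFun h ξ
  rw [Finset.prod_apply] at h1
  change charFun (Measure.map (fun x : ℕ → ℝ => ∑ j ∈ Finset.range L.length, L.getD j 0 * x j) _) ξ
    = _
  rw [h1, ← prod_range_getD L fun b => charFun μ (b * ξ)]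
  refine Finset.prod_congr rfl fun j _ => ?_
  rw [charFun_map_mul_comp (measurable_pi_apply j).aemeasurable, Measure.infinitePi_map_eval (fun _ : ℕ => μ) j]

end SumLaw

/-! ### The law of the random tree -/

lemma treeLaw_eq (t : ℝ) : treeLaw t
    = Measure.sum fun g => ENNReal.ofReal (treeWeight t g) • Measure.dirac g := rfl

lemma isProbabilityMeasure_treeLaw {t : ℝ} (ht : 0 ≤ t) : IsProbabilityMeasure (treeLaw t) := by
  constructor
  rw [treeLaw_eq, Measure.sum_apply _ .univ]
  simp only [Measure.smul_apply, measure_univ, smul_eq_mul, mul_one]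
  rw [← ENNReal.ofReal_tsum_of_nonneg (treeWeight_nonneg ht) (summable_treeWeight ht),
    (hasSum_treeWeight ht).tsum_eq, ENNReal.ofReal_one]

lemma hasSum_integral_treeLaw {E : Type*} [NormedAddCommGroup E] [NormedSpace ℝ E]
    [CompleteSpace E] {t : ℝ} (ht : 0 ≤ t) {f : McKeanTree → E} (hf : Integrable f (treeLaw t)) :
    HasSum (fun g => treeWeight t g • f g) (∫ g, f g ∂treeLaw t) := by
  have h := hasSum_integral_measure (f := f) (treeLaw_eq t ▸ hf)
  rw [← treeLaw_eq] at h
  refine h.congr_fun fun g => ?_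
  rw [integral_smul_measure, integral_dirac, ENNReal.toReal_ofReal (treeWeight_nonneg ht g)]

/-- The law of the random tree together with its angles. -/
def treeAnglesLaw (t : ℝ) : Measure (McKeanTree × (ℕ → ℝ)) := (treeLaw t).prod anglesLaw

lemma isProbabilityMeasure_treeAnglesLaw {t : ℝ} (ht : 0 ≤ t) :
    IsProbabilityMeasure (treeAnglesLaw t) := by
  have := isProbabilityMeasure_treeLaw ht
  unfold treeAnglesLaw; infer_instance

lemma hasSum_integral_treeAnglesLaw {E : Type*} [NormedAddCommGroup E] [NormedSpace ℝ E]
    [CompleteSpace E] {t : ℝ} (ht : 0 ≤ t) {f : McKeanTree × (ℕ → ℝ) → E}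
    (hf : Integrable f (treeAnglesLaw t)) :
    HasSum (fun g => treeWeight t g • ∫ θ, f (g, θ) ∂anglesLaw) (∫ ω, f ω ∂treeAnglesLaw t) := by
  have := isProbabilityMeasure_treeLaw ht
  rw [treeAnglesLaw] at hf ⊢
  rw [integral_prod _ hf]
  exact hasSum_integral_treeLaw ht hf.integral_prod_left

lemma measurable_of_forall_tree {β γ : Type*} [MeasurableSpace β] [MeasurableSpace γ]
    {f : McKeanTree × β → γ} (hf : ∀ g, Measurable fun b => f (g, b)) : Measurable f :=
  measurable_from_prod_countable_right hf

/-- The source of all the rates. For `m ≥ α` the power sum is at most `1`, its value at `α`, because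
the weights are at most `1` in modulus; hence integrability. -/
lemma integral_powerSum_le {p α m t : ℝ} (hp : 0 < p) (hα : α * (1 + p) = 2) (hm : α ≤ m)
    (ht : 0 ≤ t) :
    Integrable (fun ω => powerSum m (ω.1.betas p ω.2)) (treeAnglesLaw t) ∧
    ∫ ω, powerSum m (ω.1.betas p ω.2) ∂treeAnglesLaw t
      ≤ Real.exp (-t * (1 - 2 * bigA (m * (1 + p)))) := by
  have := isProbabilityMeasure_treeAnglesLaw ht
  have hα0 : 0 < α := by
    by_contra h
    have := mul_nonpos_of_nonpos_of_nonneg (not_lt.1 h) (by linarith : 0 ≤ 1 + p)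
    linarith
  have hint : Integrable (fun ω : McKeanTree × (ℕ → ℝ) => powerSum m (ω.1.betas p ω.2))
      (treeAnglesLaw t) := by
    refine Integrable.of_bound
      (measurable_of_forall_tree fun g => measurable_powerSum_betas p m g).aestronglyMeasurable 1
      (Eventually.of_forall fun ω => ?_)
    rw [Real.norm_of_nonneg (powerSum_nonneg _ _), ← powerSum_betas_eq_one hp hα ω.1 ω.2]
    refine List.sum_le_sum fun b hb => ?_
    have hb1 := abs_le_one_of_mem_betas hp.le _ _ b hb
    rcases (abs_nonneg b).eq_or_lt with h0 | h0
    · rw [← h0, Real.zero_rpow hα0.ne', Real.zero_rpow (hα0.trans_le hm).ne']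
    · exact Real.rpow_le_rpow_of_exponent_ge h0 hb1 hm
  refine ⟨hint, ?_⟩
  rw [← (hasSum_integral_treeAnglesLaw ht hint).tsum_eq]
  exact tsum_treeWeight_mul_le (bigA_nonneg _) (meanPowerSum_nonneg p m) (meanPowerSum_leaf p m)
    (meanPowerSum_node hp (hα0.le.trans hm)) ht

lemma measurable_maxBeta_uncurry (p : ℝ) :
    Measurable fun ω : McKeanTree × (ℕ → ℝ) => maxBeta p ω.1 ω.2 :=
  measurable_of_forall_tree fun g => measurable_maxBeta p g

lemma integrable_maxBeta {p t : ℝ} (hp : 0 ≤ p) (ht : 0 ≤ t) :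
    Integrable (fun ω : McKeanTree × (ℕ → ℝ) => maxBeta p ω.1 ω.2) (treeAnglesLaw t) := by
  have := isProbabilityMeasure_treeAnglesLaw ht
  refine Integrable.of_bound (measurable_maxBeta_uncurry p).aestronglyMeasurable 1
    (Eventually.of_forall fun ω => ?_)
  rw [Real.norm_of_nonneg (maxBeta_nonneg _ _ _)]
  exact maxBeta_le_one hp _ _

/-! ### McKean's representation of the solution -/

section McKean

variable (p : ℝ) (μ : Measure ℝ)

/-- The Fourier coefficient of a tree in the Wild sum. -/
def wildChar (g : McKeanTree) (ξ : ℝ) : ℂ :=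
  ∫ θ, ((g.betas p θ).map fun b => charFun μ (b * ξ)).prod ∂anglesLaw

lemma wildChar_leaf : wildChar p μ .leaf = charFun μ := by
  ext ξ
  simp [wildChar, McKeanTree.betas]

variable [IsProbabilityMeasure μ]

lemma norm_prod_charFun_le_one (L : List ℝ) (ξ : ℝ) :
    ‖(L.map fun b => charFun μ (b * ξ)).prod‖ ≤ 1 := by
  rw [← charFun_sumLaw]
  exact norm_charFun_le_one _

lemma measurable_prod_charFun (g : McKeanTree) (ξ : ℝ) :
    Measurable fun θ => ((g.betas p θ).map fun b => charFun μ (b * ξ)).prod :=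
  measurable_prod_map_betas p g ((continuous_charFun (μ := μ)).measurable.comp
    (measurable_mul_const ξ))

lemma continuous_wildChar (g : McKeanTree) : Continuous (wildChar p μ g) := by
  refine continuous_of_dominated (bound := fun _ => 1)
    (fun ξ => (measurable_prod_charFun p μ g ξ).aestronglyMeasurable)
    (fun ξ => Eventually.of_forall fun θ => norm_prod_charFun_le_one μ _ ξ) (integrable_const _)
    (Eventually.of_forall fun θ => ?_)
  exact continuous_list_prod _ fun b _ => continuous_charFun.comp (continuous_const_mul b)

lemma norm_wildChar_le_one (g : McKeanTree) (ξ : ℝ) : ‖wildChar p μ g ξ‖ ≤ 1 := by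
  have h := norm_integral_le_of_norm_le_const (μ := anglesLaw)
    (f := fun θ => ((g.betas p θ).map fun b => charFun μ (b * ξ)).prod) (C := 1)
    (Eventually.of_forall fun θ => norm_prod_charFun_le_one μ _ ξ)
  exact h.trans_eq (by simp)

/-- Given the root angle, the weights of the two subtrees are independent and the product splits.
The right subtree carries `sCoef`, hence comes first in `collision`. -/
lemma wildChar_node (l r : McKeanTree) :
    wildChar p μ (.node l r) = collision p (wildChar p μ r) (wildChar p μ l) := by
  ext ξ
  rw [wildChar, integral_anglesLaw_node l.nodes
    (measurable_prod_charFun p μ _ ξ).stronglyMeasurable]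
  have e : ∀ z : ℝ × (ℕ → ℝ) × (ℕ → ℝ), (((McKeanTree.node l r).betas p
      (spliceSeq l.nodes z)).map fun b => charFun μ (b * ξ)).prod
      = ((l.betas p z.2.1).map fun b => charFun μ (b * (ξ * cCoef p z.1))).prod *
        ((r.betas p z.2.2).map fun b => charFun μ (b * (ξ * sCoef p z.1))).prod := by
    intro z
    rw [betas_node_spliceSeq, List.map_append, List.prod_append, List.map_map, List.map_map]
    have h1 : ∀ k b : ℝ, k * b * ξ = b * (ξ * k) := fun k b => by ring
    simp only [Function.comp_def, h1]
  rw [integral_prod]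
  · simp_rw [e]
    rw [integral_angleLaw, collision, Complex.real_smul]
    push_cast
    congr 1
    refine intervalIntegral.integral_congr fun θ _ => ?_
    rw [integral_prod_mul (fun a => ((l.betas p a).map fun b =>
      charFun μ (b * (ξ * cCoef p θ))).prod) (fun a => ((r.betas p a).map fun b =>
      charFun μ (b * (ξ * sCoef p θ))).prod), mul_comm]
    rfl
  · exact Integrable.of_bound ((measurable_prod_charFun p μ _ ξ).comp
      (measurable_spliceSeq _)).aestronglyMeasurable 1
      (Eventually.of_forall fun z => norm_prod_charFun_le_one μ _ ξ)

/-- The law of McKean's random sum `∑ β_{j,t} X_j`. -/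
def mckeanLaw (t : ℝ) : Measure ℝ :=
  ((treeAnglesLaw t).prod (Measure.infinitePi fun _ : ℕ => μ)).map
    fun z => weightedSum (z.1.1.betas p z.1.2) z.2

lemma measurable_mckeanSum : Measurable fun z : (McKeanTree × (ℕ → ℝ)) × (ℕ → ℝ) =>
    weightedSum (z.1.1.betas p z.1.2) z.2 := by
  have h : Measurable fun z : McKeanTree × (ℕ → ℝ) × (ℕ → ℝ) =>
      weightedSum (z.1.betas p z.2.1) z.2.2 := by
    refine measurable_of_forall_tree fun g => ?_
    simp only [weightedSum, length_betas]
    refine Finset.measurable_fun_sum _ fun j _ => ?_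
    exact ((measurable_getD_betas p g j).comp measurable_fst).mul (by fun_prop)
  exact h.comp MeasurableEquiv.prodAssoc.measurable

lemma isProbabilityMeasure_mckeanLaw {t : ℝ} (ht : 0 ≤ t) :
    IsProbabilityMeasure (mckeanLaw p μ t) := by
  have := isProbabilityMeasure_treeAnglesLaw ht
  exact Measure.isProbabilityMeasure_map (measurable_mckeanSum p).aemeasurable

/-- Conditioning on tree and angles: the smoothing inequality can then be applied to each
conditional law with its own cutoff. -/
lemma cdf_mckeanLaw {t : ℝ} (ht : 0 ≤ t) (x : ℝ) :
    Integrable (fun ω => cdf (sumLaw μ (ω.1.betas p ω.2)) x) (treeAnglesLaw t) ∧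
    cdf (mckeanLaw p μ t) x = ∫ ω, cdf (sumLaw μ (ω.1.betas p ω.2)) x ∂treeAnglesLaw t := by
  have := isProbabilityMeasure_treeAnglesLaw ht
  have := isProbabilityMeasure_mckeanLaw p μ ht
  set S : Set ((McKeanTree × (ℕ → ℝ)) × (ℕ → ℝ)) :=
    (fun z => weightedSum (z.1.1.betas p z.1.2) z.2) ⁻¹' Set.Iic x with hSdef
  have hS : MeasurableSet S := measurable_mckeanSum p measurableSet_Iic
  have h1 : ∀ ω : McKeanTree × (ℕ → ℝ), ENNReal.ofReal (cdf (sumLaw μ (ω.1.betas p ω.2)) x)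
      = (Measure.infinitePi fun _ : ℕ => μ) (Prod.mk ω ⁻¹' S) := fun ω => by
    rw [ofReal_cdf, sumLaw, Measure.map_apply (measurable_weightedSum _) measurableSet_Iic]
    rfl
  have hm : Measurable fun ω : McKeanTree × (ℕ → ℝ) => cdf (sumLaw μ (ω.1.betas p ω.2)) x := by
    have h2 := (measurable_measure_prodMk_left (ν := Measure.infinitePi fun _ : ℕ => μ)
      hS).ennreal_toReal
    have h3 : (fun ω : McKeanTree × (ℕ → ℝ) => cdf (sumLaw μ (ω.1.betas p ω.2)) x)
        = fun ω => ((Measure.infinitePi fun _ : ℕ => μ) (Prod.mk ω ⁻¹' S)).toReal := by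
      ext ω
      rw [← h1, ENNReal.toReal_ofReal (cdf_nonneg _ _)]
    rw [h3]
    exact h2
  refine ⟨Integrable.of_bound hm.aestronglyMeasurable 1 (Eventually.of_forall fun ω => ?_), ?_⟩
  · rw [Real.norm_of_nonneg (cdf_nonneg _ _)]
    exact cdf_le_one _ _
  · rw [cdf_eq_real, measureReal_def, mckeanLaw, Measure.map_apply (measurable_mckeanSum p)
      measurableSet_Iic, Measure.prod_apply hS, integral_eq_lintegral_of_nonneg_ae
      (Eventually.of_forall fun ω => cdf_nonneg _ _) hm.aestronglyMeasurable]
    simp_rw [h1]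

lemma measurable_prod_charFun_uncurry (ξ : ℝ) : Measurable fun ω : McKeanTree × (ℕ → ℝ) =>
    ((ω.1.betas p ω.2).map fun b => charFun μ (b * ξ)).prod :=
  measurable_of_forall_tree fun g => measurable_prod_charFun p μ g ξ

lemma charFun_mckeanLaw_eq_integral {t : ℝ} (ht : 0 ≤ t) (ξ : ℝ) :
    charFun (mckeanLaw p μ t) ξ
      = ∫ ω, ((ω.1.betas p ω.2).map fun b => charFun μ (b * ξ)).prod ∂treeAnglesLaw t := by
  have := isProbabilityMeasure_treeAnglesLaw ht
  have hmeas := measurable_mckeanSum p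
  have hm : Measurable fun z : (McKeanTree × (ℕ → ℝ)) × (ℕ → ℝ) =>
      Complex.exp (ξ * (weightedSum (z.1.1.betas p z.1.2) z.2 : ℝ) * Complex.I) :=
    (((Complex.measurable_ofReal.comp hmeas).const_mul _).mul_const _).cexp
  rw [charFun_apply_real, mckeanLaw, integral_map hmeas.aemeasurable (by fun_prop), integral_prod]
  · refine integral_congr_ae (Eventually.of_forall fun ω => ?_)
    simp only
    rw [← charFun_sumLaw, charFun_apply_real, sumLaw,
      integral_map (measurable_weightedSum _).aemeasurable (by fun_prop)]
  · refine Integrable.of_bound hm.aestronglyMeasurable 1 (Eventually.of_forall fun z => ?_)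
    rw [← Complex.ofReal_mul, Complex.norm_exp_ofReal_mul_I]

lemma integrable_prod_charFun {t : ℝ} (ht : 0 ≤ t) (ξ : ℝ) :
    Integrable (fun ω : McKeanTree × (ℕ → ℝ) =>
      ((ω.1.betas p ω.2).map fun b => charFun μ (b * ξ)).prod) (treeAnglesLaw t) := by
  have := isProbabilityMeasure_treeAnglesLaw ht
  exact Integrable.of_bound (measurable_prod_charFun_uncurry p μ ξ).aestronglyMeasurable 1
    (Eventually.of_forall fun ω => norm_prod_charFun_le_one μ _ ξ)

lemma hasSum_charFun_mckeanLaw {t : ℝ} (ht : 0 ≤ t) (ξ : ℝ) :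
    HasSum (fun g => treeWeight t g • wildChar p μ g ξ) (charFun (mckeanLaw p μ t) ξ) := by
  have h := hasSum_integral_treeAnglesLaw ht (integrable_prod_charFun p μ ht ξ)
  rw [← charFun_mckeanLaw_eq_integral p μ ht] at h
  exact h

end McKean

/-- **McKean's representation**: a solution of the Kac equation is the law of the random sum. -/
theorem IsKacSolution.eq_mckeanLaw {p : ℝ} (hp : 0 ≤ p) {μ₀ : Measure ℝ} [IsProbabilityMeasure μ₀]
    {μ : ℝ → Measure ℝ} (hμ : IsKacSolution p μ₀ μ) {t : ℝ} (ht : 0 ≤ t) :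
    μ t = mckeanLaw p μ₀ t := by
  have := hμ.isProb t ht
  have := isProbabilityMeasure_mckeanLaw p μ₀ ht
  refine Measure.ext_of_charFun (funext fun ξ => ?_)
  exact tendsto_nhds_unique (hμ.tendsto_wild hp (continuous_wildChar p μ₀)
    (norm_wildChar_le_one p μ₀) (wildChar_leaf p μ₀) (wildChar_node p μ₀) ht ξ)
    ((hasSum_charFun_mckeanLaw p μ₀ ht ξ).comp tendsto_treesBelow)

/-! ### Symmetrization -/

/-- The symmetrized law, whose characteristic function is the real part of that of `μ`. -/
def symmetrize (μ : Measure ℝ) : Measure ℝ := (2⁻¹ : ENNReal) • (μ + μ.map fun x => -x)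

instance (μ : Measure ℝ) [IsProbabilityMeasure μ] : IsProbabilityMeasure (symmetrize μ) := by
  have : IsProbabilityMeasure (μ.map fun x => -x) :=
    Measure.isProbabilityMeasure_map measurable_neg.aemeasurable
  constructor
  simp only [symmetrize, Measure.smul_apply, Measure.add_apply, measure_univ, smul_eq_mul]
  rw [one_add_one_eq_two, ENNReal.inv_mul_cancel (by simp) (by simp)]

lemma charFun_add_measure (μ ν : Measure ℝ) [IsFiniteMeasure μ] [IsFiniteMeasure ν] (ξ : ℝ) :
    charFun (μ + ν) ξ = charFun μ ξ + charFun ν ξ := by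
  have h : ∀ P : Measure ℝ, IsFiniteMeasure P →
      Integrable (fun x : ℝ => Complex.exp (ξ * x * Complex.I)) P := fun P _ =>
    Integrable.of_bound (by fun_prop) 1 (Eventually.of_forall fun x => by
      rw [← Complex.ofReal_mul, Complex.norm_exp_ofReal_mul_I])
  simp only [charFun_apply_real]
  exact integral_add_measure (h μ inferInstance) (h ν inferInstance)

lemma charFun_smul_measure (c : ENNReal) (μ : Measure ℝ) (ξ : ℝ) :
    charFun (c • μ) ξ = c.toReal • charFun μ ξ := by
  simp only [charFun_apply_real]
  exact integral_smul_measure _ _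

lemma charFun_map_neg (μ : Measure ℝ) (ξ : ℝ) :
    charFun (μ.map fun x => -x) ξ = (starRingEnd ℂ) (charFun μ ξ) := by
  rw [← charFun_neg]
  have h := charFun_map_mul (μ := μ) (-1) ξ
  simpa using h

lemma charFun_symmetrize (μ : Measure ℝ) [IsProbabilityMeasure μ] (ξ : ℝ) :
    charFun (symmetrize μ) ξ = ((charFun μ ξ).re : ℂ) := by
  have : IsProbabilityMeasure (μ.map fun x => -x) :=
    Measure.isProbabilityMeasure_map measurable_neg.aemeasurable
  rw [symmetrize, charFun_smul_measure, charFun_add_measure, charFun_map_neg, Complex.add_conj,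
    Complex.real_smul]
  simp

lemma intervalIntegral_comp_sub_of_periodic {f : ℝ → ℂ} (hf : Function.Periodic f (2 * Real.pi))
    (d : ℝ) : ∫ θ in (0 : ℝ)..(2 * Real.pi), f (d - θ) = ∫ θ in (0 : ℝ)..(2 * Real.pi), f θ := by
  rw [intervalIntegral.integral_comp_sub_left, sub_zero]
  have h := hf.intervalIntegral_add_eq (d - 2 * Real.pi) 0
  rwa [zero_add, sub_add_cancel] at h

lemma cCoef_periodic (p : ℝ) : Function.Periodic (cCoef p) (2 * Real.pi) := fun θ => by
  simp only [cCoef, Real.cos_add_two_pi]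

lemma sCoef_periodic (p : ℝ) : Function.Periodic (sCoef p) (2 * Real.pi) := fun θ => by
  simp only [sCoef, Real.sin_add_two_pi]

/-- The collision operator only sees the real part of a characteristic function. -/
lemma collision_charFun_eq {p : ℝ} (hp : 0 ≤ p) (μ : Measure ℝ) [IsProbabilityMeasure μ] (ξ : ℝ) :
    collision p (charFun μ) (charFun μ) ξ
      = collision p (charFun (symmetrize μ)) (charFun (symmetrize μ)) ξ := by
  have hcc := continuous_cCoef hp
  have hsc := continuous_sCoef hp
  set f := charFun μ with hf
  set R := charFun (symmetrize μ) with hR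
  have hfc : Continuous f := continuous_charFun
  have hRc : Continuous R := continuous_charFun
  have hfR : ∀ x, f x + f (-x) = 2 * R x := fun x => by
    rw [hf, hR, charFun_neg, charFun_symmetrize, Complex.add_conj]; push_cast; ring
  -- The map `θ ↦ -θ` changes the sign of `s` alone and `θ ↦ π - θ` that of `c` alone. Averaging
  -- over each in turn replaces one factor `f` by its real part.
  have hs1 : ∀ θ, sCoef p (0 - θ) = -sCoef p θ := fun θ => by simp [sCoef]
  have hc1 : ∀ θ, cCoef p (0 - θ) = cCoef p θ := fun θ => by simp [cCoef]
  have hs2 : ∀ θ, sCoef p (Real.pi - θ) = sCoef p θ := fun θ => by simp [sCoef]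
  have hc2 : ∀ θ, cCoef p (Real.pi - θ) = -cCoef p θ := fun θ => by simp [cCoef]
  have h1 : ∫ θ in (0 : ℝ)..(2 * Real.pi), f (ξ * sCoef p θ) * f (ξ * cCoef p θ)
      = ∫ θ in (0 : ℝ)..(2 * Real.pi), R (ξ * sCoef p θ) * f (ξ * cCoef p θ) := by
    have h := intervalIntegral_comp_sub_of_periodic
      (f := fun θ => f (ξ * sCoef p θ) * f (ξ * cCoef p θ)) (fun θ => by
        simp only [cCoef_periodic p θ, sCoef_periodic p θ]) 0
    simp only [hs1, hc1] at h
    have e : ∫ θ in (0 : ℝ)..(2 * Real.pi), (f (ξ * sCoef p θ) * f (ξ * cCoef p θ)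
        + f (ξ * -sCoef p θ) * f (ξ * cCoef p θ))
        = ∫ θ in (0 : ℝ)..(2 * Real.pi), 2 * (R (ξ * sCoef p θ) * f (ξ * cCoef p θ)) := by
      refine intervalIntegral.integral_congr fun θ _ => ?_
      rw [← add_mul, mul_neg, hfR, mul_assoc]
    rw [intervalIntegral.integral_add (Continuous.intervalIntegrable (by fun_prop) _ _)
      (Continuous.intervalIntegrable (by fun_prop) _ _), h,
      intervalIntegral.integral_const_mul, ← two_mul] at e
    exact mul_left_cancel₀ two_ne_zero e
  have h2 : ∫ θ in (0 : ℝ)..(2 * Real.pi), R (ξ * sCoef p θ) * f (ξ * cCoef p θ)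
      = ∫ θ in (0 : ℝ)..(2 * Real.pi), R (ξ * sCoef p θ) * R (ξ * cCoef p θ) := by
    have h := intervalIntegral_comp_sub_of_periodic
      (f := fun θ => R (ξ * sCoef p θ) * f (ξ * cCoef p θ)) (fun θ => by
        simp only [cCoef_periodic p θ, sCoef_periodic p θ]) Real.pi
    simp only [hs2, hc2] at h
    have e : ∫ θ in (0 : ℝ)..(2 * Real.pi), (R (ξ * sCoef p θ) * f (ξ * cCoef p θ)
        + R (ξ * sCoef p θ) * f (ξ * -cCoef p θ))
        = ∫ θ in (0 : ℝ)..(2 * Real.pi), 2 * (R (ξ * sCoef p θ) * R (ξ * cCoef p θ)) := by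
      refine intervalIntegral.integral_congr fun θ _ => ?_
      rw [← mul_add, mul_neg, hfR]; ring
    rw [intervalIntegral.integral_add (Continuous.intervalIntegrable (by fun_prop) _ _)
      (Continuous.intervalIntegrable (by fun_prop) _ _), h,
      intervalIntegral.integral_const_mul, ← two_mul] at e
    exact mul_left_cancel₀ two_ne_zero e
  rw [collision, collision, h1, h2]

lemma collision_charFun_symmetrize_im {p : ℝ} (μ : Measure ℝ) [IsProbabilityMeasure μ]
    (ξ : ℝ) : ∃ r : ℝ,
      collision p (charFun (symmetrize μ)) (charFun (symmetrize μ)) ξ = (r : ℂ) := by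
  refine ⟨1 / (2 * Real.pi) * ∫ θ in (0 : ℝ)..(2 * Real.pi),
    (charFun μ (ξ * sCoef p θ)).re * (charFun μ (ξ * cCoef p θ)).re, ?_⟩
  rw [collision]
  push_cast
  rw [← intervalIntegral.integral_ofReal]
  simp only [charFun_symmetrize, Complex.ofReal_mul]

/-- The symmetrization of a solution is a solution. -/
lemma IsKacSolution.symmetrize {p : ℝ} (hp : 0 ≤ p) {μ₀ : Measure ℝ} {μ : ℝ → Measure ℝ}
    (hμ : IsKacSolution p μ₀ μ) :
    IsKacSolution p (symmetrize μ₀) (fun t => symmetrize (μ t)) where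
  isProb t ht := by have := hμ.isProb t ht; infer_instance
  initial := by rw [hμ.initial]
  continuous_zero ξ := by
    have h := (Complex.continuous_ofReal.comp Complex.continuous_re).continuousAt.comp_continuousWithinAt
      (hμ.continuous_zero ξ)
    have h0 := hμ.isProb 0 le_rfl
    refine h.congr (fun t ht => ?_) ?_
    · have := hμ.isProb t ht
      exact charFun_symmetrize _ ξ
    · exact charFun_symmetrize _ ξ
  equation ξ t ht := by
    have := hμ.isProb t ht.le
    have h1 := (Complex.ofRealCLM.comp Complex.reCLM).hasFDerivAt.comp_hasDerivAt t
      (hμ.equation ξ t ht)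
    have h2 : (fun τ => charFun (InelasticKac.symmetrize (μ τ)) ξ) =ᶠ[𝓝 t]
        (Complex.ofRealCLM.comp Complex.reCLM) ∘ fun τ => charFun (μ τ) ξ := by
      filter_upwards [Ioi_mem_nhds ht] with s hs
      have := hμ.isProb s (le_of_lt hs)
      exact charFun_symmetrize _ ξ
    refine (h1.congr_of_eventuallyEq h2).congr_deriv ?_
    obtain ⟨r, hr⟩ := collision_charFun_symmetrize_im (p := p) (μ t) ξ
    have h3 := collision_charFun_eq hp (μ t) ξ
    change (((collision p (charFun (μ t)) (charFun (μ t)) ξ - charFun (μ t) ξ).re : ℝ) : ℂ)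
      = collision p (charFun (InelasticKac.symmetrize (μ t)))
        (charFun (InelasticKac.symmetrize (μ t))) ξ - charFun (InelasticKac.symmetrize (μ t)) ξ
    rw [h3, hr, charFun_symmetrize, Complex.sub_re, Complex.ofReal_re, Complex.ofReal_sub]

/-- The imaginary part of the characteristic function decays exponentially. -/
lemma IsKacSolution.im_charFun {p : ℝ} (hp : 0 ≤ p) {μ₀ : Measure ℝ} {μ : ℝ → Measure ℝ}
    (hμ : IsKacSolution p μ₀ μ) {t : ℝ} (ht : 0 ≤ t) (ξ : ℝ) :
    (charFun (μ t) ξ).im = Real.exp (-t) * (charFun μ₀ ξ).im := by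
  have hd : ∀ t, 0 < t → HasDerivAt
      (fun t => Real.exp t * (charFun (μ t) ξ).im - (charFun μ₀ ξ).im) 0 t := by
    intro t ht
    have := hμ.isProb t ht.le
    have h1 := Complex.imCLM.hasFDerivAt.comp_hasDerivAt t (hμ.equation ξ t ht)
    obtain ⟨r, hr⟩ := collision_charFun_symmetrize_im (p := p) (μ t) ξ
    have h3 := collision_charFun_eq hp (μ t) ξ
    -- The collision term is real, so only the loss term contributes and `e^t Im φ` is constant.
    have h4 : Complex.imCLM (1 / (2 * (Real.pi : ℂ)) * (∫ θ in (0 : ℝ)..(2 * Real.pi),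
          charFun (μ t) (ξ * sCoef p θ) * charFun (μ t) (ξ * cCoef p θ)) - charFun (μ t) ξ)
        = -(charFun (μ t) ξ).im := by
      change (collision p (charFun (μ t)) (charFun (μ t)) ξ - charFun (μ t) ξ).im = _
      rw [h3, hr, Complex.sub_im, Complex.ofReal_im, zero_sub]
    rw [h4] at h1
    refine (((Real.hasDerivAt_exp t).mul h1).sub_const _).congr_deriv ?_
    simp
  have h := norm_le_of_norm_hasDerivAt_le (B := fun _ => 0) (B' := fun _ => 0) ?_ hd
    (fun t => hasDerivAt_const t 0) (by simp [hμ.initial]) (fun t _ => by simp) ht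
  · have h2 := norm_le_zero_iff.1 h
    rw [Real.exp_neg]
    field_simp
    linarith
  · exact (Real.continuous_exp.continuousWithinAt.mul
      (Complex.continuous_im.continuousAt.comp_continuousWithinAt
        (hμ.continuous_zero ξ))).sub continuousWithinAt_const

lemma leftLim_cdf (μ : Measure ℝ) [IsProbabilityMeasure μ] (x : ℝ) :
    Function.leftLim (cdf μ) x = μ.real (Set.Iio x) := by
  have h := (cdf μ).measure_Iio (tendsto_cdf_atBot μ) x
  rw [measure_cdf, sub_zero] at h
  rw [measureReal_def, h, ENNReal.toReal_ofReal]
  exact ge_of_tendsto ((monotone_cdf μ).tendsto_leftLim x)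
    (Eventually.of_forall fun y => cdf_nonneg μ y)

lemma real_map_neg_Iic (μ : Measure ℝ) [IsProbabilityMeasure μ] (x : ℝ) :
    (μ.map fun x => -x).real (Set.Iic x) = 1 - Function.leftLim (cdf μ) (-x) := by
  have h : (fun x : ℝ => -x) ⁻¹' Set.Iic x = (Set.Iio (-x))ᶜ := by
    ext y; simp only [Set.mem_preimage, Set.mem_Iic, Set.mem_compl_iff, Set.mem_Iio, not_lt]
    exact neg_le
  rw [map_measureReal_apply measurable_neg measurableSet_Iic, h,
    probReal_compl_eq_one_sub measurableSet_Iio, leftLim_cdf]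

lemma cdf_symmetrize (μ : Measure ℝ) [IsProbabilityMeasure μ] (x : ℝ) :
    cdf (symmetrize μ) x = (cdf μ x + 1 - Function.leftLim (cdf μ) (-x)) / 2 := by
  have : IsProbabilityMeasure (μ.map fun x => -x) :=
    Measure.isProbabilityMeasure_map measurable_neg.aemeasurable
  rw [cdf_eq_real, symmetrize, measureReal_ennreal_smul_apply, measureReal_add_apply,
    real_map_neg_Iic, cdf_eq_real]
  simp
  ring

/-- The distance of the solution to the symmetrized solution. -/
lemma IsKacSolution.abs_cdf_sub_cdf_symmetrize_le {p : ℝ} (hp : 0 ≤ p) {μ₀ : Measure ℝ}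
    [IsProbabilityMeasure μ₀] {μ : ℝ → Measure ℝ} (hμ : IsKacSolution p μ₀ μ) {t : ℝ} (ht : 0 ≤ t)
    (x : ℝ) :
    |cdf (μ t) x - cdf (InelasticKac.symmetrize (μ t)) x| ≤ Real.exp (-t) / 2 * asymmetry μ₀ := by
  have := hμ.isProb t ht
  have hr : ∀ P : Measure ℝ, IsProbabilityMeasure P →
      IsProbabilityMeasure (P.map fun x => -x) := fun P _ =>
    Measure.isProbabilityMeasure_map measurable_neg.aemeasurable
  have := hr (μ t) inferInstance
  have := hr μ₀ inferInstance
  set k : ENNReal := ENNReal.ofReal (Real.exp (-t)) with hk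
  have hkr : k.toReal = Real.exp (-t) := ENNReal.toReal_ofReal (Real.exp_pos _).le
  have hkfin : ∀ P : Measure ℝ, IsProbabilityMeasure P → IsFiniteMeasure (k • P) := fun P _ =>
    Measure.smul_finite P ENNReal.ofReal_ne_top
  have := hkfin μ₀ inferInstance
  have := hkfin (μ₀.map fun x => -x) inferInstance
  -- The relation `Im φ_t = e^{-t} Im φ₀` as an identity between positive measures, arranged without
  -- subtraction; evaluating it on a half-line gives the exact value of the difference of the
  -- distribution functions.
  have key : μ t + k • (μ₀.map fun x => -x) = ((μ t).map fun x => -x) + k • μ₀ := by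
    refine Measure.ext_of_charFun (funext fun ξ => ?_)
    rw [charFun_add_measure, charFun_add_measure, charFun_smul_measure, charFun_smul_measure,
      charFun_map_neg, charFun_map_neg, hkr]
    have him := hμ.im_charFun hp ht ξ
    apply Complex.ext
    · simp only [Complex.add_re, Complex.smul_re, Complex.conj_re]
    · simp only [Complex.add_im, Complex.smul_im, Complex.conj_im, him, smul_eq_mul]; ring
  have h1 := congrArg (fun P : Measure ℝ => P.real (Set.Iic x)) key
  rw [measureReal_add_apply, measureReal_add_apply, measureReal_ennreal_smul_apply,
    measureReal_ennreal_smul_apply, real_map_neg_Iic, real_map_neg_Iic, hkr, ← cdf_eq_real,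
    ← cdf_eq_real] at h1
  have h2 : cdf (μ t) x - cdf (InelasticKac.symmetrize (μ t)) x
      = Real.exp (-t) / 2 * (cdf μ₀ x + Function.leftLim (cdf μ₀) (-x) - 1) := by
    rw [cdf_symmetrize]
    linarith
  have hbdd : BddAbove (Set.range fun x : ℝ =>
      |cdf μ₀ x + Function.leftLim (cdf μ₀) (-x) - 1|) := by
    refine ⟨1, ?_⟩
    rintro _ ⟨y, rfl⟩
    simp only
    rw [leftLim_cdf]
    have := cdf_nonneg μ₀ y
    have := cdf_le_one μ₀ y
    have := measureReal_nonneg (μ := μ₀) (s := Set.Iio (-y))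
    have := measureReal_le_one (μ := μ₀) (s := Set.Iio (-y))
    rw [abs_le]; constructor <;> linarith
  rw [h2, abs_mul, abs_of_pos (by positivity)]
  have := le_ciSup hbdd x
  rw [asymmetry]
  gcongr

/-! ### The remainder `v₀*` -/

section VStar

variable {α a₀ δ : ℝ} {μ₀ : Measure ℝ}

lemma vStar_neg (ξ : ℝ) : vStar α a₀ μ₀ (-ξ) = vStar α a₀ μ₀ ξ := by
  simp only [vStar, neg_eq_zero, abs_neg, charFun_neg, Complex.conj_re]

lemma vStar_abs (ξ : ℝ) : vStar α a₀ μ₀ |ξ| = vStar α a₀ μ₀ ξ := by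
  rcases abs_choice ξ with h | h <;> rw [h]
  exact vStar_neg ξ

lemma exists_abs_vStar_le
    (hv : (fun ξ : ℝ => vStar α a₀ μ₀ ξ) =O[𝓝 0] (fun ξ : ℝ => |ξ| ^ δ)) :
    ∃ C ε : ℝ, 0 < C ∧ 0 < ε ∧ ∀ ξ, |ξ| < ε → |vStar α a₀ μ₀ ξ| ≤ C * |ξ| ^ δ := by
  obtain ⟨C, hC, h⟩ := hv.exists_pos
  obtain ⟨ε, hε, h2⟩ := Metric.eventually_nhds_iff.1 h.bound
  refine ⟨C, ε, hC, hε, fun ξ hξ => ?_⟩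
  have h3 := h2 (y := ξ) (by simpa using hξ)
  rwa [Real.norm_eq_abs, Real.norm_of_nonneg (by positivity)] at h3

lemma vNorm_nonneg : 0 ≤ vNorm α a₀ μ₀ := by
  refine Real.sSup_nonneg ?_
  rintro _ ⟨x, -, rfl⟩
  exact abs_nonneg _

lemma bigM_pos (ha₀ : 0 < a₀) : 0 < bigM α a₀ μ₀ := by
  have := vNorm_nonneg (α := α) (a₀ := a₀) (μ₀ := μ₀)
  rw [bigM]; linarith

lemma abs_vStar_le_vNorm (hb : BddAbove (Set.range fun ξ => |vStar α a₀ μ₀ ξ|)) (ξ : ℝ) :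
    |vStar α a₀ μ₀ ξ| ≤ vNorm α a₀ μ₀ :=
  le_csSup (hb.mono (Set.image_subset_range _ _)) ⟨|ξ|, abs_nonneg ξ, by simp only [vStar_abs]⟩

lemma abs_vStar_le_vBar (hb : BddAbove (Set.range fun ξ => |vStar α a₀ μ₀ ξ|)) (ξ : ℝ) :
    |vStar α a₀ μ₀ ξ| ≤ vBar α a₀ μ₀ |ξ| :=
  le_csSup (hb.mono (Set.image_subset_range _ _))
    ⟨|ξ|, ⟨abs_nonneg ξ, le_rfl⟩, by simp only [vStar_abs]⟩

lemma dTilde_pos (ha₀ : 0 < a₀) {d : ℝ} (hd : 0 < d) : 0 < dTilde α a₀ μ₀ d := by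
  have := bigM_pos (α := α) (μ₀ := μ₀) ha₀
  unfold dTilde; positivity

lemma bigM_mul_dTilde_rpow (ha₀ : 0 < a₀) (hα : 0 < α) {d : ℝ} (hd : 0 < d) :
    bigM α a₀ μ₀ * dTilde α a₀ μ₀ d ^ α = 3 * d / 8 := by
  have := bigM_pos (α := α) (μ₀ := μ₀) ha₀
  rw [dTilde, ← Real.rpow_mul (by positivity), one_div_mul_cancel hα.ne', Real.rpow_one]
  field_simp

/-- Admissible parameters exist. -/
lemma exists_isAdmissible (ha₀ : 0 < a₀) (hα : 0 < α) (hδ : 0 < δ)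
    (hv : (fun ξ : ℝ => vStar α a₀ μ₀ ξ) =O[𝓝 0] (fun ξ : ℝ => |ξ| ^ δ)) {η : ℝ} (hη : 0 < η)
    (hηa : η < a₀) : ∃ d ρ : ℝ, IsAdmissible α a₀ δ μ₀ η d ρ := by
  obtain ⟨C, ε, hC, hε, h⟩ := exists_abs_vStar_le hv
  set M := bigM α a₀ μ₀ with hM
  have hM0 : 0 < M := bigM_pos ha₀
  have hlim : Tendsto (fun y : ℝ => 4 / 5 * M ^ 2 * y ^ α + C * y ^ δ) (𝓝 0) (𝓝 0) := by
    have h1 : Tendsto (fun y : ℝ => y ^ α) (𝓝 0) (𝓝 0) := by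
      simpa [Real.zero_rpow hα.ne'] using (Real.continuous_rpow_const hα.le).tendsto 0
    have h2 : Tendsto (fun y : ℝ => y ^ δ) (𝓝 0) (𝓝 0) := by
      simpa [Real.zero_rpow hδ.ne'] using (Real.continuous_rpow_const hδ.le).tendsto 0
    simpa using (h1.const_mul (4 / 5 * M ^ 2)).add (h2.const_mul C)
  -- Both conditions concern only `|x| ≤ d̃`, so a small `d` secures them; `ρ` is the constant of
  -- the `O` hypothesis.
  have hdlim : Tendsto (fun d : ℝ => dTilde α a₀ μ₀ d) (𝓝[>] 0) (𝓝 0) := by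
    have hα' : 0 < 1 / α := by positivity
    have hc : Continuous fun d : ℝ => dTilde α a₀ μ₀ d := by
      unfold dTilde
      exact (Real.continuous_rpow_const hα'.le).comp (by fun_prop)
    have h0 : dTilde α a₀ μ₀ 0 = 0 := by simp [dTilde, Real.zero_rpow (inv_ne_zero hα.ne')]
    have := hc.tendsto 0
    rw [h0] at this
    exact this.mono_left nhdsWithin_le_nhds
  have e1 := (hlim.comp hdlim).eventually (gt_mem_nhds hη)
  have e2 := hdlim.eventually (gt_mem_nhds hε)
  have e3 : ∀ᶠ d : ℝ in 𝓝[>] 0, d ∈ Set.Ioo (0 : ℝ) 1 := Ioo_mem_nhdsGT one_pos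
  obtain ⟨d, h1, h2, h3⟩ := (e1.and (e2.and e3)).exists
  refine ⟨d, C, hη, hηa, h3.1, h3.2, hC, fun x hx => ?_, fun ξ hξ => h ξ (hξ.trans_lt h2)⟩
  refine le_trans ?_ h1.le
  have hb : vBar α a₀ μ₀ |x| ≤ C * dTilde α a₀ μ₀ d ^ δ := by
    refine csSup_le ⟨_, ⟨0, ⟨le_rfl, abs_nonneg x⟩, rfl⟩⟩ ?_
    rintro _ ⟨y, hy, rfl⟩
    have hy' : |y| ≤ dTilde α a₀ μ₀ d := by rw [abs_of_nonneg hy.1]; exact hy.2.trans hx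
    refine (h y (hy'.trans_lt h2)).trans ?_
    gcongr
  simp only [Function.comp]
  gcongr

variable [IsProbabilityMeasure μ₀]

lemma one_sub_re_charFun (hα : 0 < α) (ξ : ℝ) :
    1 - (charFun μ₀ ξ).re = (a₀ + vStar α a₀ μ₀ ξ) * |ξ| ^ α := by
  rcases eq_or_ne ξ 0 with rfl | h
  · simp [Real.zero_rpow hα.ne']
  · have : |ξ| ^ α ≠ 0 := (Real.rpow_pos_of_pos (abs_pos.2 h) α).ne'
    rw [vStar, if_neg h]
    field_simp
    ring

lemma abs_re_charFun_le_one (μ : Measure ℝ) [IsProbabilityMeasure μ] (ξ : ℝ) :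
    |(charFun μ ξ).re| ≤ 1 := (Complex.abs_re_le_norm _).trans (norm_charFun_le_one _)

/-- Near `0` by the `O` hypothesis; elsewhere the numerator is at most `2` and `|ξ| ^ α` is bounded
below. It makes `vNorm` and `vBar` genuine suprema, as `sSup` of an unbounded set of reals is `0`.
-/
lemma bddAbove_vStar (ha₀ : 0 < a₀) (hα : 0 < α) (hδ : 0 < δ)
    (hv : (fun ξ : ℝ => vStar α a₀ μ₀ ξ) =O[𝓝 0] (fun ξ : ℝ => |ξ| ^ δ)) :
    BddAbove (Set.range fun ξ => |vStar α a₀ μ₀ ξ|) := by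
  obtain ⟨C, ε, hC, hε, h⟩ := exists_abs_vStar_le hv
  refine ⟨max (C * ε ^ δ) (2 / ε ^ α + a₀), ?_⟩
  rintro _ ⟨ξ, rfl⟩
  rcases lt_or_ge |ξ| ε with h1 | h1
  · refine le_max_of_le_left ((h ξ h1).trans ?_)
    gcongr
  · refine le_max_of_le_right ?_
    have hξ : ξ ≠ 0 := abs_pos.1 (hε.trans_le h1)
    simp only [vStar, if_neg hξ]
    have h2 := abs_le.1 (abs_re_charFun_le_one μ₀ ξ)
    refine (abs_sub _ _).trans (add_le_add ?_ (abs_of_pos ha₀).le)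
    rw [abs_of_nonneg (div_nonneg (by linarith) (by positivity))]
    gcongr
    linarith

/-! ### Comparison of characteristic functions -/

/-- The derivative of `log (1 - y) + y + (4/5) y²` is `y (3/5 - (8/5) y) / (1 - y)`, nonnegative
exactly up to `y = 3/8` on `[0, 1)`. This links the `4/5` in the bounds to the `3/8` in `dTilde`. -/
lemma abs_log_one_sub_add_le {x : ℝ} (h0 : 0 ≤ x) (h1 : x ≤ 3 / 8) :
    |Real.log (1 - x) + x| ≤ 4 / 5 * x ^ 2 := by
  have hup : Real.log (1 - x) ≤ -x := by
    have := Real.log_le_sub_one_of_pos (show 0 < 1 - x by linarith)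
    linarith
  have hd : ∀ y ∈ Set.Icc (0 : ℝ) (3 / 8), HasDerivAt
      (fun y => Real.log (1 - y) + y + 4 / 5 * y ^ 2) (-1 / (1 - y) + 1 + 4 / 5 * (2 * y)) y := by
    intro y hy
    have h2 : HasDerivAt (fun y : ℝ => 1 - y) (-1) y := by
      simpa using (hasDerivAt_id y).const_sub 1
    have h3 : HasDerivAt (fun y : ℝ => 4 / 5 * y ^ 2) (4 / 5 * (2 * y)) y := by
      simpa using (hasDerivAt_pow 2 y).const_mul (4 / 5)
    exact ((h2.log (by linarith [hy.2])).add (hasDerivAt_id y)).add h3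
  have hmono : MonotoneOn (fun y => Real.log (1 - y) + y + 4 / 5 * y ^ 2)
      (Set.Icc (0 : ℝ) (3 / 8)) := by
    refine monotoneOn_of_deriv_nonneg (convex_Icc _ _)
      (fun y hy => (hd y hy).continuousAt.continuousWithinAt)
      (fun y hy => (hd y (interior_subset hy)).differentiableAt.differentiableWithinAt)
      fun y hy => ?_
    have hy := interior_subset hy
    rw [(hd y hy).deriv]
    have h2 : 0 < 1 - y := by linarith [hy.2]
    have h3 : -1 / (1 - y) + 1 + 4 / 5 * (2 * y) = y * (3 / 5 - 8 / 5 * y) / (1 - y) := by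
      field_simp
      ring
    rw [h3]
    exact div_nonneg (mul_nonneg hy.1 (by linarith [hy.2])) h2.le
  have h2 := hmono (Set.left_mem_Icc.2 (by norm_num)) ⟨h0, h1⟩ h0
  simp at h2
  rw [abs_le]
  constructor <;> nlinarith

lemma abs_exp_sub_one_le_mul_exp (s : ℝ) : |Real.exp s - 1| ≤ |s| * Real.exp |s| := by
  rcases le_total 0 s with h | h
  · have h1 := Real.add_one_le_exp (-s)
    have h2 : Real.exp s * Real.exp (-s) = 1 := by rw [← Real.exp_add]; simp
    rw [abs_of_nonneg h, abs_of_nonneg (by linarith [Real.one_le_exp h])]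
    nlinarith [Real.exp_pos s]
  · have h1 := Real.add_one_le_exp s
    rw [abs_of_nonpos h, abs_of_nonpos (by linarith [Real.exp_le_one_iff.2 h])]
    have := Real.one_le_exp (neg_nonneg.2 h)
    nlinarith

variable {η d ρ : ℝ}

/-- The logarithm of the real part of the characteristic function near the origin. -/
lemma IsAdmissible.exists_exp_eq (ha₀ : 0 < a₀) (hα : 0 < α)
    (hb : BddAbove (Set.range fun ξ => |vStar α a₀ μ₀ ξ|))
    (hadm : IsAdmissible α a₀ δ μ₀ η d ρ) {y : ℝ} (hy : |y| ≤ dTilde α a₀ μ₀ d) :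
    ∃ s : ℝ, (charFun μ₀ y).re = Real.exp (s - a₀ * |y| ^ α) ∧ |s| ≤ η * |y| ^ α ∧
      |s| ≤ 4 / 5 * bigM α a₀ μ₀ ^ 2 * |y| ^ (2 * α) + ρ * |y| ^ (α + δ) := by
  set M := bigM α a₀ μ₀ with hM
  set v := vStar α a₀ μ₀ y with hv
  have hM0 : 0 < M := bigM_pos ha₀
  have hyα : 0 ≤ |y| ^ α := by positivity
  set x := 1 - (charFun μ₀ y).re with hx
  have hxv : x = (a₀ + v) * |y| ^ α := one_sub_re_charFun hα y
  have hx0 : 0 ≤ x := by linarith [(abs_le.1 (abs_re_charFun_le_one μ₀ y)).2]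
  have hxM : x ≤ M * |y| ^ α := by
    rw [hxv]
    have : v ≤ vNorm α a₀ μ₀ := (le_abs_self _).trans (abs_vStar_le_vNorm hb y)
    rw [hM, bigM]
    gcongr
  -- The definition of `d̃` amounts to `M d̃ ^ α = 3 d / 8`, and `d < 1`.
  have hx38 : x ≤ 3 / 8 := by
    refine hxM.trans ?_
    have h1 : M * |y| ^ α ≤ M * dTilde α a₀ μ₀ d ^ α := by gcongr
    rw [bigM_mul_dTilde_rpow ha₀ hα hadm.d_pos] at h1
    linarith [hadm.d_lt_one]
  have hre : (charFun μ₀ y).re = 1 - x := by rw [hx]; ring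
  have hlog := abs_log_one_sub_add_le hx0 hx38
  have hs : |Real.log (1 - x) + a₀ * |y| ^ α|
      ≤ 4 / 5 * M ^ 2 * |y| ^ α * |y| ^ α + |v| * |y| ^ α := by
    have e : Real.log (1 - x) + a₀ * |y| ^ α = (Real.log (1 - x) + x) - v * |y| ^ α := by
      rw [hxv]; ring
    rw [e]
    refine (abs_sub _ _).trans (add_le_add (hlog.trans ?_) ?_)
    · have : x ^ 2 ≤ (M * |y| ^ α) ^ 2 := by gcongr
      nlinarith
    · rw [abs_mul, abs_of_nonneg hyα]
  refine ⟨Real.log (1 - x) + a₀ * |y| ^ α, ?_, hs.trans ?_, hs.trans ?_⟩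
  · rw [add_sub_cancel_right, Real.exp_log (by linarith), hre]
  · rw [← add_mul]
    gcongr
    exact (add_le_add_right (abs_vStar_le_vBar hb y) _).trans (hadm.le_eta y hy)
  · have h1 : |y| ^ (2 * α) = |y| ^ α * |y| ^ α := by
      rw [two_mul, Real.rpow_add_of_nonneg (abs_nonneg _) hα.le hα.le]
    have h2 : ρ * |y| ^ (α + δ) ≥ |v| * |y| ^ α := by
      rcases eq_or_ne y 0 with rfl | hy0
      · have : v = 0 := by simp [hv, vStar]
        have := hadm.rho_pos
        rw [‹v = 0›, abs_zero, zero_mul]; positivity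
      · rw [Real.rpow_add (abs_pos.2 hy0)]
        have := mul_le_mul_of_nonneg_right (hadm.le_rho y hy) hyα
        linarith
    rw [h1, ← mul_assoc]
    linarith

lemma powerSum_cons (m b : ℝ) (L : List ℝ) : powerSum m (b :: L) = |b| ^ m + powerSum m L := by
  simp [powerSum]

/-- The exponents add along the list, and every bound on an exponent is homogeneous in the weight,
so only power sums of the weights appear. -/
lemma IsAdmissible.exists_prod_eq (ha₀ : 0 < a₀) (hα : 0 < α)
    (hb : BddAbove (Set.range fun ξ => |vStar α a₀ μ₀ ξ|))
    (hadm : IsAdmissible α a₀ δ μ₀ η d ρ) {ξ : ℝ} {L : List ℝ}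
    (hL : ∀ b ∈ L, |b * ξ| ≤ dTilde α a₀ μ₀ d) :
    ∃ s : ℝ, (L.map fun b => (charFun μ₀ (b * ξ)).re).prod
        = Real.exp (s - a₀ * (powerSum α L * |ξ| ^ α)) ∧ |s| ≤ η * (powerSum α L * |ξ| ^ α) ∧
      |s| ≤ 4 / 5 * bigM α a₀ μ₀ ^ 2 * (powerSum (2 * α) L * |ξ| ^ (2 * α))
        + ρ * (powerSum (α + δ) L * |ξ| ^ (α + δ)) := by
  induction L with
  | nil => exact ⟨0, by simp [powerSum], by simp [powerSum], by simp [powerSum]⟩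
  | cons b L ih =>
    obtain ⟨s, h1, h2, h3⟩ := ih fun a ha => hL a (List.mem_cons_of_mem _ ha)
    obtain ⟨r, k1, k2, k3⟩ := hadm.exists_exp_eq ha₀ hα hb (hL b (by simp))
    have e : ∀ m : ℝ, |b * ξ| ^ m = |b| ^ m * |ξ| ^ m := fun m => by
      rw [abs_mul, Real.mul_rpow (abs_nonneg _) (abs_nonneg _)]
    simp only [e] at k1 k2 k3
    refine ⟨r + s, ?_, ?_, ?_⟩
    · rw [List.map_cons, List.prod_cons, h1, k1, ← Real.exp_add, powerSum_cons]
      congr 1; ring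
    · rw [powerSum_cons]
      refine (abs_add_le _ _).trans ((add_le_add k2 h2).trans_eq ?_)
      ring
    · rw [powerSum_cons, powerSum_cons]
      refine (abs_add_le _ _).trans ((add_le_add k3 h3).trans_eq ?_)
      ring

/-- In `|e^s - 1| ≤ |s| e^|s|` the two bounds on `s` play different roles: `|s| ≤ η |ξ| ^ α` only
weakens the Gaussian-like decay from `a₀` to `a₀ - η`, whereas the other, in `|s|` itself, gives the
smallness. -/
lemma IsAdmissible.abs_prod_sub_exp_le (ha₀ : 0 < a₀) (hα : 0 < α)
    (hb : BddAbove (Set.range fun ξ => |vStar α a₀ μ₀ ξ|))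
    (hadm : IsAdmissible α a₀ δ μ₀ η d ρ) {ξ : ℝ} {L : List ℝ} (hL1 : powerSum α L = 1)
    (hL : ∀ b ∈ L, |b * ξ| ≤ dTilde α a₀ μ₀ d) :
    |(L.map fun b => (charFun μ₀ (b * ξ)).re).prod - Real.exp (-a₀ * |ξ| ^ α)|
      ≤ Real.exp (-(a₀ - η) * |ξ| ^ α) *
        (4 / 5 * bigM α a₀ μ₀ ^ 2 * (powerSum (2 * α) L * |ξ| ^ (2 * α))
        + ρ * (powerSum (α + δ) L * |ξ| ^ (α + δ))) := by
  obtain ⟨s, h1, h2, h3⟩ := hadm.exists_prod_eq ha₀ hα hb hL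
  rw [hL1, one_mul] at h1 h2
  have e : Real.exp (s - a₀ * |ξ| ^ α) - Real.exp (-a₀ * |ξ| ^ α)
      = Real.exp (-a₀ * |ξ| ^ α) * (Real.exp s - 1) := by
    rw [mul_sub, ← Real.exp_add, mul_one]; congr 2; ring
  rw [h1, e, abs_mul, Real.abs_exp]
  have e2 : Real.exp (-(a₀ - η) * |ξ| ^ α)
      = Real.exp (-a₀ * |ξ| ^ α) * Real.exp (η * |ξ| ^ α) := by
    rw [← Real.exp_add]; congr 1; ring
  rw [e2, mul_assoc]
  gcongr
  refine (abs_exp_sub_one_le_mul_exp s).trans ?_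
  rw [mul_comm]
  gcongr

end VStar

/-! ### Integrals of stretched exponentials -/

lemma integrable_comp_abs {f : ℝ → ℝ} (hf : IntegrableOn f (Set.Ioi 0)) :
    Integrable fun x : ℝ => f |x| := by
  have h1 : IntegrableOn (fun x : ℝ => f |x|) (Set.Ioi 0) :=
    hf.congr_fun (fun x hx => by simp only [abs_of_pos (Set.mem_Ioi.1 hx)]) measurableSet_Ioi
  have h2 : IntegrableOn (fun x : ℝ => f |x|) (Set.Iic 0) := by
    rw [← Measure.map_neg_eq_self (volume : Measure ℝ)]
    have m : MeasurableEmbedding fun x : ℝ => -x := (Homeomorph.neg ℝ).measurableEmbedding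
    rw [m.integrableOn_map_iff]
    simp_rw [Function.comp_def, abs_neg, Set.neg_preimage, Set.neg_Iic, neg_zero]
    exact Iff.mpr integrableOn_Ici_iff_integrableOn_Ioi h1
  rw [← integrableOn_univ, ← Set.Iic_union_Ioi (a := (0 : ℝ))]
  exact h2.union h1

lemma integrable_exp_mul_abs_rpow {α b l : ℝ} (hα : 0 < α) (hb : 0 < b) (hl : 0 < l) :
    Integrable fun ξ : ℝ => Real.exp (-b * |ξ| ^ α) * |ξ| ^ (l - 1) := by
  refine integrable_comp_abs (f := fun ξ => Real.exp (-b * ξ ^ α) * ξ ^ (l - 1)) ?_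
  simp_rw [mul_comm]
  have := integrableOn_rpow_mul_exp_neg_mul_rpow (s := l - 1) (by linarith) hα hb
  simpa only [mul_comm] using this

lemma integral_exp_mul_abs_rpow (α a₀ η l : ℝ) :
    ∫ ξ : ℝ, Real.exp (-(a₀ - η) * |ξ| ^ α) * |ξ| ^ (l - 1) = 2 * bigN α a₀ η l :=
  integral_comp_abs (f := fun ξ => Real.exp (-(a₀ - η) * ξ ^ α) * ξ ^ (l - 1))

lemma bigN_nonneg (α a₀ η l : ℝ) : 0 ≤ bigN α a₀ η l :=
  setIntegral_nonneg measurableSet_Ioi fun _ hξ =>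
    mul_nonneg (Real.exp_pos _).le (Real.rpow_nonneg (Set.mem_Ioi.1 hξ).le _)

lemma IsSymmStable.integrable_charFun {α a₀ : ℝ} {G : Measure ℝ} (hG : IsSymmStable α a₀ G)
    (hα : 0 < α) (ha₀ : 0 < a₀) : Integrable (charFun G) := by
  have h : charFun G = fun ξ => ((Real.exp (-a₀ * |ξ| ^ α) : ℝ) : ℂ) := funext hG.2
  rw [h]
  have := integrable_exp_mul_abs_rpow hα ha₀ one_pos
  simp only [sub_self, Real.rpow_zero, mul_one] at this
  exact this.ofReal

lemma densitySup_nonneg (G : Measure ℝ) : 0 ≤ densitySup G :=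
  Real.iSup_nonneg fun _ => abs_nonneg _

lemma asymmetry_nonneg (μ₀ : Measure ℝ) : 0 ≤ asymmetry μ₀ :=
  Real.iSup_nonneg fun _ => abs_nonneg _

/-! ### The rate of convergence -/

section Rate

variable {α a₀ δ η d ρ c : ℝ} {μ₀ G : Measure ℝ} [IsProbabilityMeasure μ₀]
  [IsProbabilityMeasure G]

lemma charFun_sumLaw_symmetrize (L : List ℝ) (ξ : ℝ) :
    charFun (sumLaw (symmetrize μ₀) L) ξ
      = (((L.map fun b => (charFun μ₀ (b * ξ)).re).prod : ℝ) : ℂ) := by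
  rw [charFun_sumLaw]
  simp only [charFun_symmetrize]
  induction L with
  | nil => simp
  | cons b L ih => simp [ih]

/-- The law of a weighted sum of symmetrized variables is close to the stable law. -/
lemma IsAdmissible.abs_cdf_sumLaw_sub_le (hα : 0 < α) (ha₀ : 0 < a₀) (hδ : 0 < δ)
    (hb : BddAbove (Set.range fun ξ => |vStar α a₀ μ₀ ξ|))
    (hadm : IsAdmissible α a₀ δ μ₀ η d ρ) (hG : IsSymmStable α a₀ G) (hc : IsBerryEsseenConst c)
    {L : List ℝ} {B : ℝ} (hB : 0 < B) (hL1 : powerSum α L = 1) (hL : ∀ b ∈ L, |b| ≤ B) (x : ℝ) :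
    |cdf (sumLaw (symmetrize μ₀) L) x - cdf G x| ≤
      8 / (5 * Real.pi) * bigM α a₀ μ₀ ^ 2 * bigN α a₀ η (2 * α) * powerSum (2 * α) L
        + 2 / Real.pi * ρ * bigN α a₀ η (α + δ) * powerSum (α + δ) L
        + c * densitySup G / dTilde α a₀ μ₀ d * B := by
  set D := dTilde α a₀ μ₀ d with hD
  set M := bigM α a₀ μ₀
  have hD0 : 0 < D := dTilde_pos ha₀ hadm.d_pos
  have hρ := hadm.rho_pos
  have hGi := hG.integrable_charFun hα ha₀
  -- The cutoff `T = D / B` is the largest that keeps every `|b ξ|` below `D` when only `|b| ≤ B` is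
  -- known.
  have hT : 0 < D / B := by positivity
  set w : ℝ → ℝ → ℝ := fun l ξ => Real.exp (-(a₀ - η) * |ξ| ^ α) * |ξ| ^ (l - 1) with hw
  have hwi : ∀ l, 0 < l → Integrable (w l) := fun l hl =>
    integrable_exp_mul_abs_rpow hα (by linarith [hadm.eta_lt]) hl
  set C₁ := 4 / 5 * M ^ 2 * powerSum (2 * α) L
  set C₂ := ρ * powerSum (α + δ) L
  have hC₁ : 0 ≤ C₁ := mul_nonneg (by positivity) (powerSum_nonneg _ _)
  have hC₂ : 0 ≤ C₂ := mul_nonneg hρ.le (powerSum_nonneg _ _)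
  set k : ℝ → ℝ := fun ξ => C₁ * w (2 * α) ξ + C₂ * w (α + δ) ξ with hk
  have hki : Integrable k :=
    ((hwi _ (by linarith)).const_mul C₁).add ((hwi _ (by linarith)).const_mul C₂)
  have hk0 : ∀ ξ, 0 ≤ k ξ := fun ξ => by simp only [hk, hw]; positivity
  set f : ℝ → ℝ := fun ξ => ‖charFun (sumLaw (symmetrize μ₀) L) ξ - charFun G ξ‖ / |ξ| with hf
  have hfm : Measurable f :=
    ((measurable_charFun.sub measurable_charFun).norm).div measurable_id.abs
  have hf0 : ∀ ξ, 0 ≤ f ξ := fun ξ => by positivity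
  have hfk : ∀ ξ, |ξ| ≤ D / B → f ξ ≤ k ξ := by
    intro ξ hξ
    -- At `ξ = 0` the quotient `f` is `0` by the convention on division by zero.
    rcases eq_or_ne ξ 0 with rfl | h0
    · simpa [hf] using hk0 0
    have hξ0 : 0 < |ξ| := abs_pos.2 h0
    have h1 := hadm.abs_prod_sub_exp_le ha₀ hα hb (ξ := ξ) hL1 fun b hbL => by
      rw [abs_mul]
      calc |b| * |ξ| ≤ B * (D / B) := by gcongr; exact hL b hbL
        _ = D := by field_simp
    simp only [hf, charFun_sumLaw_symmetrize, hG.2]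
    rw [← Complex.ofReal_sub, Complex.norm_real, Real.norm_eq_abs, div_le_iff₀ hξ0]
    refine h1.trans_eq ?_
    have e : ∀ l : ℝ, |ξ| ^ l = |ξ| ^ (l - 1) * |ξ| := fun l => by
      rw [← Real.rpow_add_one hξ0.ne', sub_add_cancel]
    simp only [hk, hw]
    rw [e (2 * α), e (α + δ)]
    ring
  have hfk' : ∀ ξ ∈ Set.Ioc (-(D / B)) (D / B), f ξ ≤ k ξ := fun ξ hξ =>
    hfk ξ (abs_le.2 ⟨hξ.1.le, hξ.2⟩)
  have hle : -(D / B) ≤ D / B := by linarith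
  have hfi : IntegrableOn f (Set.Ioc (-(D / B)) (D / B)) := by
    refine Integrable.mono' hki.integrableOn hfm.aestronglyMeasurable ?_
    filter_upwards [ae_restrict_mem measurableSet_Ioc] with ξ hξ
    rw [Real.norm_of_nonneg (hf0 ξ)]
    exact hfk' ξ hξ
  have hint : ∫ ξ in (-(D / B))..(D / B), f ξ
      ≤ 2 * (C₁ * bigN α a₀ η (2 * α) + C₂ * bigN α a₀ η (α + δ)) := by
    rw [intervalIntegral.integral_of_le hle]
    refine (setIntegral_mono_on hfi hki.integrableOn measurableSet_Ioc hfk').trans ?_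
    refine (setIntegral_le_integral hki (ae_of_all _ hk0)).trans_eq ?_
    simp only [hk]
    rw [integral_add ((hwi _ (by linarith)).const_mul C₁) ((hwi _ (by linarith)).const_mul C₂),
      integral_const_mul, integral_const_mul, hw]
    simp only [integral_exp_mul_abs_rpow]
    ring
  have key := hc.2 (sumLaw (symmetrize μ₀) L) G inferInstance inferInstance (densitySup G) (D / B)
    hT (differentiable_cdf_of_integrable_charFun G hGi) (abs_deriv_cdf_le_densitySup G hGi)
    ((intervalIntegrable_iff_integrableOn_Ioc_of_le hle).2 hfi) x
  refine key.trans ?_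
  have hpi := Real.pi_pos
  have h2 := mul_le_mul_of_nonneg_left hint (one_div_pos.2 hpi).le
  refine (add_le_add_left h2 _).trans_eq ?_
  simp only [C₁, C₂]
  field_simp
  ring

/-- The explicit rate of convergence to the stable law. -/
lemma IsAdmissible.abs_cdf_sub_le {p t : ℝ} (hp : 0 < p) (hα : α = 2 / (1 + p)) (ha₀ : 0 < a₀)
    (hδ : 0 < δ) (hb : BddAbove (Set.range fun ξ => |vStar α a₀ μ₀ ξ|))
    (hadm : IsAdmissible α a₀ δ μ₀ η d ρ) (hG : IsSymmStable α a₀ G) (hc : IsBerryEsseenConst c)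
    {μ : ℝ → Measure ℝ} (hμ : IsKacSolution p μ₀ μ) (ht : 0 ≤ t) (x : ℝ) :
    |cdf (μ t) x - cdf G x| ≤
      8 / (5 * Real.pi) * bigM α a₀ μ₀ ^ 2 * bigN α a₀ η (2 * α)
          * Real.exp (-t * (1 - 2 * bigA 4))
        + 2 / Real.pi * ρ * bigN α a₀ η (α + δ)
          * Real.exp (-t * (1 - 2 * bigA (2 + 2 * δ / α)))
        + c * densitySup G / dTilde α a₀ μ₀ d * meanMaxBeta p t
        + Real.exp (-t) / 2 * asymmetry μ₀ := by
  have hp1 : 0 < 1 + p := by linarith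
  have hα0 : 0 < α := by rw [hα]; positivity
  have hαp : α * (1 + p) = 2 := by rw [hα]; field_simp
  have := isProbabilityMeasure_treeAnglesLaw ht
  have hM := bigM_pos (α := α) (μ₀ := μ₀) ha₀
  have hD := dTilde_pos (α := α) (μ₀ := μ₀) ha₀ hadm.d_pos
  have hρ := hadm.rho_pos
  obtain ⟨i1, b1⟩ := integral_powerSum_le (m := 2 * α) hp hαp (by linarith) ht
  obtain ⟨i2, b2⟩ := integral_powerSum_le (m := α + δ) hp hαp (by linarith) ht
  -- The moments of order `2α` and `α + δ` become the indices `4` and `2 + 2δ/α` of `bigA`.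
  have e1 : 2 * α * (1 + p) = 4 := by rw [mul_assoc, hαp]; norm_num
  have e2 : (α + δ) * (1 + p) = 2 + 2 * δ / α := by
    have : 1 + p = 2 / α := by rw [eq_div_iff hα0.ne', mul_comm]; exact hαp
    rw [add_mul, hαp, this]; ring
  rw [e1] at b1
  rw [e2] at b2
  have i3 := integrable_maxBeta (p := p) hp.le ht
  set K₁ := 8 / (5 * Real.pi) * bigM α a₀ μ₀ ^ 2 * bigN α a₀ η (2 * α)
  set K₂ := 2 / Real.pi * ρ * bigN α a₀ η (α + δ)
  set K₃ := c * densitySup G / dTilde α a₀ μ₀ d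
  have hK₁ : 0 ≤ K₁ := mul_nonneg (by positivity) (bigN_nonneg _ _ _ _)
  have hK₂ : 0 ≤ K₂ := mul_nonneg (by positivity) (bigN_nonneg _ _ _ _)
  obtain ⟨i0, h0⟩ := cdf_mckeanLaw p (symmetrize μ₀) ht x
  have hs : symmetrize (μ t) = mckeanLaw p (symmetrize μ₀) t :=
    (hμ.symmetrize hp.le).eq_mckeanLaw hp.le ht
  have hsym : |cdf (symmetrize (μ t)) x - cdf G x| ≤
      K₁ * Real.exp (-t * (1 - 2 * bigA 4))
        + K₂ * Real.exp (-t * (1 - 2 * bigA (2 + 2 * δ / α))) + K₃ * meanMaxBeta p t := by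
    have hdiff : cdf (symmetrize (μ t)) x - cdf G x
        = ∫ ω, (cdf (sumLaw (symmetrize μ₀) (ω.1.betas p ω.2)) x - cdf G x)
          ∂(treeAnglesLaw t) := by
      rw [hs, h0, integral_sub i0 (integrable_const _)]
      simp
    rw [hdiff]
    refine (abs_integral_le_integral_abs).trans ?_
    have hi : Integrable (fun ω : McKeanTree × (ℕ → ℝ) =>
        K₁ * powerSum (2 * α) (ω.1.betas p ω.2) + K₂ * powerSum (α + δ) (ω.1.betas p ω.2)
          + K₃ * maxBeta p ω.1 ω.2) (treeAnglesLaw t) :=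
      ((i1.const_mul K₁).add (i2.const_mul K₂)).add (i3.const_mul K₃)
    refine (integral_mono (i0.sub (integrable_const _)).abs hi fun ω =>
      hadm.abs_cdf_sumLaw_sub_le hα0 ha₀ hδ hb hG hc (maxBeta_pos hp _ _)
        (powerSum_betas_eq_one hp hαp _ _) (abs_le_maxBeta p _ _) x).trans ?_
    have i12 : Integrable (fun ω : McKeanTree × (ℕ → ℝ) => K₁ * powerSum (2 * α) (ω.1.betas p ω.2)
        + K₂ * powerSum (α + δ) (ω.1.betas p ω.2)) (treeAnglesLaw t) :=
      (i1.const_mul K₁).add (i2.const_mul K₂)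
    rw [integral_add i12 (i3.const_mul K₃),
      integral_add (i1.const_mul K₁) (i2.const_mul K₂), integral_const_mul, integral_const_mul,
      integral_const_mul]
    exact add_le_add (add_le_add (mul_le_mul_of_nonneg_left b1 hK₁)
      (mul_le_mul_of_nonneg_left b2 hK₂)) le_rfl
  have := (abs_sub_le (cdf (μ t) x) (cdf (symmetrize (μ t)) x) (cdf G x)).trans
    (add_le_add (hμ.abs_cdf_sub_cdf_symmetrize_le hp.le ht x) hsym)
  linarith

end Rate

/-! ### Exponential decay -/

/-- `|sin| ^ m ≤ sin²`, strictly at `π / 4`, and `sin²` has mean `1/2`. -/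
lemma bigA_lt_half {m : ℝ} (hm : 2 < m) : bigA m < 1 / 2 := by
  have hpi := Real.pi_pos
  have hcont : Continuous fun θ : ℝ => |Real.sin θ| ^ m :=
    Real.continuous_sin.abs.rpow_const fun _ => Or.inr (by linarith)
  have h : ∫ θ in (0 : ℝ)..(2 * Real.pi), |Real.sin θ| ^ m
      < ∫ θ in (0 : ℝ)..(2 * Real.pi), Real.sin θ ^ 2 := by
    refine intervalIntegral.integral_lt_integral_of_continuousOn_of_le_of_exists_lt
      (by positivity) hcont.continuousOn (by fun_prop) (fun θ _ => ?_)
      ⟨Real.pi / 4, ⟨by positivity, by linarith⟩, ?_⟩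
    · rcases eq_or_ne (Real.sin θ) 0 with h | h
      · simp [h, Real.zero_rpow (show m ≠ 0 by linarith)]
      · rw [← sq_abs, ← Real.rpow_natCast]
        exact Real.rpow_le_rpow_of_exponent_ge (abs_pos.2 h) (Real.abs_sin_le_one θ)
          (by push_cast; linarith)
    · have h0 : 0 < Real.sin (Real.pi / 4) := Real.sin_pos_of_pos_of_lt_pi (by positivity) (by linarith)
      have h1 : Real.sin (Real.pi / 4) < 1 := by
        rw [← Real.sin_pi_div_two]
        exact Real.sin_lt_sin_of_lt_of_le_pi_div_two (by linarith) le_rfl (by linarith)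
      rw [abs_of_pos h0, ← Real.rpow_natCast (Real.sin (Real.pi / 4)) 2]
      exact Real.rpow_lt_rpow_of_exponent_gt h0 h1 (by push_cast; linarith)
  rw [integral_sin_sq] at h
  simp at h
  rw [bigA, one_div_mul_eq_div, div_lt_iff₀ (by positivity)]
  linarith

/-- The expected largest weight decays exponentially. -/
lemma meanMaxBeta_le {p t : ℝ} (hp : 0 < p) (ht : 0 ≤ t) :
    meanMaxBeta p t ≤ 2 * Real.exp (-((1 - 2 * bigA (4 * (1 + p))) / 4) * t) := by
  have hp1 : 0 < 1 + p := by linarith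
  have := isProbabilityMeasure_treeAnglesLaw ht
  have hαp : 2 / (1 + p) * (1 + p) = 2 := by field_simp
  have hα4 : 2 / (1 + p) ≤ 4 := by rw [div_le_iff₀ hp1]; linarith
  obtain ⟨i1, b1⟩ := integral_powerSum_le hp hαp hα4 ht
  set κ := 1 - 2 * bigA (4 * (1 + p))
  -- The threshold is the fourth root of the bound on the mean fourth power sum, which balances the
  -- two terms of `ε + ε⁻³ E ∑ |β_j|⁴`.
  set ε := Real.exp (-(κ / 4) * t) with hε
  have hε0 : 0 < ε := Real.exp_pos _
  have h4 : Real.exp (-t * κ) = ε ^ 4 := by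
    rw [hε, ← Real.exp_nat_mul]; congr 1; push_cast; ring
  rw [h4] at b1
  have hpt : ∀ ω : McKeanTree × (ℕ → ℝ),
      maxBeta p ω.1 ω.2 ≤ ε + (ε ^ 3)⁻¹ * powerSum 4 (ω.1.betas p ω.2) := by
    intro ω
    set B := maxBeta p ω.1 ω.2 with hB
    have hB0 : 0 ≤ B := maxBeta_nonneg _ _ _
    have hB4 : B ^ 4 ≤ powerSum 4 (ω.1.betas p ω.2) := by
      rcases maxBeta_eq_zero_or p ω.1 ω.2 with h | ⟨b, hb, h⟩
      · rw [hB, h]; simpa using powerSum_nonneg 4 (ω.1.betas p ω.2)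
      · rw [hB, h]
        have := rpow_le_powerSum 4 hb
        rwa [show (4 : ℝ) = ((4 : ℕ) : ℝ) by norm_num, Real.rpow_natCast] at this
    rcases le_total B ε with h | h
    · exact h.trans (le_add_of_nonneg_right (mul_nonneg (by positivity) (powerSum_nonneg _ _)))
    -- As in Markov's inequality: above the threshold, `B` is at most `B (B / ε)³`.
    · have h3 : B ≤ (ε ^ 3)⁻¹ * B ^ 4 := by
        rw [inv_mul_eq_div, le_div_iff₀ (by positivity)]
        calc B * ε ^ 3 ≤ B * B ^ 3 := by gcongr
          _ = B ^ 4 := by ring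
      have h4 : (ε ^ 3)⁻¹ * B ^ 4 ≤ (ε ^ 3)⁻¹ * powerSum 4 (ω.1.betas p ω.2) := by gcongr
      linarith
  have hi : Integrable (fun ω : McKeanTree × (ℕ → ℝ) =>
      ε + (ε ^ 3)⁻¹ * powerSum 4 (ω.1.betas p ω.2)) (treeAnglesLaw t) :=
    (integrable_const _).add (i1.const_mul _)
  have h1 : meanMaxBeta p t ≤ ∫ ω, (ε + (ε ^ 3)⁻¹ * powerSum 4 (ω.1.betas p ω.2))
      ∂(treeAnglesLaw t) :=
    integral_mono (integrable_maxBeta hp.le ht) hi hpt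
  rw [integral_add (integrable_const _) (i1.const_mul _), integral_const_mul] at h1
  simp only [integral_const, probReal_univ, one_smul] at h1
  have h2 : (ε ^ 3)⁻¹ * ∫ ω, powerSum 4 (ω.1.betas p ω.2) ∂(treeAnglesLaw t)
      ≤ (ε ^ 3)⁻¹ * ε ^ 4 := by gcongr
  have h3 : (ε ^ 3)⁻¹ * ε ^ 4 = ε := by field_simp
  linarith

end

end InelasticKac

open InelasticKac

theorem theorem5 (p α a₀ δ : ℝ) (hp : 0 < p) (hα : α = 2 / (1 + p)) (ha₀ : 0 < a₀) (hδ : 0 < δ)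
    (μ₀ G : Measure ℝ) [IsProbabilityMeasure μ₀] [IsProbabilityMeasure G]
    (hG : IsSymmStable α a₀ G)
    (hμ₀ : InDomainNormalAttraction α μ₀ G)
    (hv : (fun ξ : ℝ => vStar α a₀ μ₀ ξ) =O[𝓝 0] (fun ξ : ℝ => |ξ| ^ δ))
    (μ : ℝ → Measure ℝ) (hμ : IsKacSolution p μ₀ μ) :
    (∃ c : ℝ, IsBerryEsseenConst c) ∧
    (∀ η : ℝ, 0 < η → η < a₀ → ∃ d ρ : ℝ, IsAdmissible α a₀ δ μ₀ η d ρ) ∧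
    (∀ c η d ρ : ℝ, IsBerryEsseenConst c → IsAdmissible α a₀ δ μ₀ η d ρ →
      ∀ t : ℝ, 0 ≤ t →
        kolmogorov (μ t) G ≤
          8 / (5 * Real.pi) * bigM α a₀ μ₀ ^ 2 * bigN α a₀ η (2 * α)
              * Real.exp (-t * (1 - 2 * bigA 4))
            + 64 / (25 * Real.pi) * bigM α a₀ μ₀ ^ 4 * bigN α a₀ η (4 * α)
              * Real.exp (-t * (1 - 2 * bigA 6))
            + 2 / Real.pi * ρ * bigN α a₀ η (α + δ)
              * Real.exp (-t * (1 - 2 * bigA (2 + 2 * δ / α)))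
            + 2 * ρ ^ 2 * bigN α a₀ η (2 * α + 2 * δ)
              * Real.exp (-t * (1 - 2 * bigA (2 + 4 * δ / α)))
            + c * densitySup G / dTilde α a₀ μ₀ d * meanMaxBeta p t
            + Real.exp (-t) / 2 * asymmetry μ₀) ∧
    (∃ a₃ b : ℝ, 0 < a₃ ∧ 0 < b ∧
      ∀ t : ℝ, 0 ≤ t → kolmogorov (μ t) G ≤ a₃ * Real.exp (-b * t)) := by
  have hp1 : 0 < 1 + p := by linarith
  have hα0 : 0 < α := by rw [hα]; positivity
  have hpi := Real.pi_pos
  have hb := bddAbove_vStar ha₀ hα0 hδ hv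
  have hadmissible : ∀ η : ℝ, 0 < η → η < a₀ → ∃ d ρ : ℝ, IsAdmissible α a₀ δ μ₀ η d ρ :=
    fun η hη hηa => exists_isAdmissible ha₀ hα0 hδ hv hη hηa
  refine ⟨⟨_, isBerryEsseenConst_esseen⟩, hadmissible, ?_, ?_⟩
  · intro c η d ρ hc hadm t ht
    refine ciSup_le fun x => (hadm.abs_cdf_sub_le hp hα ha₀ hδ hb hG hc hμ ht x).trans ?_
    -- The bound just applied has only four terms; the terms in `M⁴` and `ρ²` are nonnegative and
    -- may be added.
    have h2 : 0 ≤ 64 / (25 * Real.pi) * bigM α a₀ μ₀ ^ 4 * bigN α a₀ η (4 * α)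
        * Real.exp (-t * (1 - 2 * bigA 6)) :=
      mul_nonneg (mul_nonneg (by positivity) (bigN_nonneg _ _ _ _)) (Real.exp_pos _).le
    have h4 : 0 ≤ 2 * ρ ^ 2 * bigN α a₀ η (2 * α + 2 * δ)
        * Real.exp (-t * (1 - 2 * bigA (2 + 4 * δ / α))) :=
      mul_nonneg (mul_nonneg (by positivity) (bigN_nonneg _ _ _ _)) (Real.exp_pos _).le
    linarith
  · obtain ⟨d, ρ, hadm⟩ := hadmissible (a₀ / 2) (by positivity) (by linarith)
    have hD := dTilde_pos (α := α) (μ₀ := μ₀) ha₀ hadm.d_pos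
    have hρ := hadm.rho_pos
    have hc := isBerryEsseenConst_esseen
    set κ₁ := 1 - 2 * bigA 4 with hκ₁
    set κ₂ := 1 - 2 * bigA (2 + 2 * δ / α) with hκ₂
    set κ₃ := (1 - 2 * bigA (4 * (1 + p))) / 4 with hκ₃
    have k1 : 0 < κ₁ := by linarith [bigA_lt_half (m := 4) (by norm_num)]
    have k2 : 0 < κ₂ := by
      have : 0 < 2 * δ / α := by positivity
      linarith [bigA_lt_half (m := 2 + 2 * δ / α) (by linarith)]
    have k3 : 0 < κ₃ := by linarith [bigA_lt_half (m := 4 * (1 + p)) (by linarith)]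
    set K₁ := 8 / (5 * Real.pi) * bigM α a₀ μ₀ ^ 2 * bigN α a₀ (a₀ / 2) (2 * α)
    set K₂ := 2 / Real.pi * ρ * bigN α a₀ (a₀ / 2) (α + δ)
    set K₃ := 40 / Real.pi * densitySup G / dTilde α a₀ μ₀ d
    have hK₁ : 0 ≤ K₁ := mul_nonneg (by positivity) (bigN_nonneg _ _ _ _)
    have hK₂ : 0 ≤ K₂ := mul_nonneg (by positivity) (bigN_nonneg _ _ _ _)
    have hK₃ : 0 ≤ K₃ := div_nonneg (mul_nonneg (by positivity) (densitySup_nonneg G)) hD.le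
    have hA := asymmetry_nonneg μ₀
    -- The slowest of the four rates; the entry `1` belongs to the asymmetry term. In the constant
    -- below, `K₃ * 2` comes from `meanMaxBeta_le` and the final `1` only ensures positivity.
    set b := min (min κ₁ κ₂) (min κ₃ 1) with hbdef
    refine ⟨K₁ + K₂ + K₃ * 2 + asymmetry μ₀ / 2 + 1, b, by positivity,
      by simp only [hbdef, lt_min_iff]; exact ⟨⟨k1, k2⟩, k3, one_pos⟩, fun t ht => ?_⟩
    refine ciSup_le fun x => (hadm.abs_cdf_sub_le hp hα ha₀ hδ hb hG hc hμ ht x).trans ?_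
    have hexp : ∀ κ, b ≤ κ → Real.exp (-κ * t) ≤ Real.exp (-b * t) := fun κ h => by
      gcongr
    have g1 := hexp κ₁ ((min_le_left _ _).trans (min_le_left _ _))
    have g2 := hexp κ₂ ((min_le_left _ _).trans (min_le_right _ _))
    have g3 := hexp κ₃ ((min_le_right _ _).trans (min_le_left _ _))
    have g4 := hexp 1 ((min_le_right _ _).trans (min_le_right _ _))
    have gm := (meanMaxBeta_le hp ht).trans (mul_le_mul_of_nonneg_left g3 two_pos.le)
    rw [show -t * κ₁ = -κ₁ * t by ring, show -t * κ₂ = -κ₂ * t by ring]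
    rw [show -1 * t = -t by ring] at g4
    have := Real.exp_pos (-b * t)
    have s1 := mul_le_mul_of_nonneg_left g1 hK₁
    have s2 := mul_le_mul_of_nonneg_left g2 hK₂
    have s3 := mul_le_mul_of_nonneg_left gm hK₃
    have s4 := mul_le_mul_of_nonneg_right g4 (div_nonneg hA two_pos.le)
    linarith
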